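/- Let $F$ be a field of characteristic zero (for instance, a local field of characteristic zero). All algebraic groups are over $F$; for a finite field extension $K/F$ and a finite dimensional space $W$ over $K$, groups such as $GL(W)$, $O(W)$, $U(W)$ are regarded as algebraic groups over $F$ by restriction of scalars (so that their $F$-points are the $K$-linear automorphisms, the orthogonal transformations, the unitary transformations of $W$). A quadratic space is a finite dimensional space with a non-degenerate quadratic (equivalently, symmetric bilinear) form; a hermitian space over a field with involution $(K,\tau)$ is a finite dimensional $K$-space with a non-degenerate $\tau$-hermitian form. A symmetric pair $(G,H,\theta)$ consists of a group $G$ with an involution $\theta$ and $H=G^\theta$. Put $\sigma(g)=\theta(g^{-1})$ and $s(g)=g\,\sigma(g)$. A descendant of $(G,H,\theta)$ is a pair $(G_x,H_x,\theta|_{G_x})$, where $x=s(g)$ for some $g\in G(F)$ such that $HgH$ is (Zariski) closed in $G$, and $G_x$, $H_x$ are the centralizers of $x$ in $G$, $H$. Products of pairs are finite products of groups with the product involution, and "is a product of" means isomorphic to it, by an isomorphism of algebraic groups over $F$ commuting with the involutions. The involution of $(GL(W),O(W))$ is $g\mapsto (g^{t})^{-1}$, that of $(GL(W),U(W))$ is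 $g\mapsto (g^{*})^{-1}$ (transpose and adjoint with respect to the form), and that of $(GL(W)\times GL(W),\Delta GL(W))$ is $(g_1,g_2)\mapsto(g_2,g_1)$. If $K$ is a field with an involution $\tau$, $L=K^{\tau}$, and $(W,B)$ is a quadratic space over $L$, then $W_K=K\otimes_L W$ carries the hermitian form $(a\otimes v,b\otimes w)\mapsto\tau(a)b\,B(v,w)$, and $(U(W_K),O(W))$ is the symmetric pair with the involution $g\mapsto(\tau\otimes1)\,g\,(\tau\otimes1)$. An extension $(D',\tau')$ of a field with involution $(D,\tau)$ is a finite field extension $D'$ of $D$ with an involution $\tau'$ that extends $\tau$. Theorem. (1) Let $D/F$ be a quadratic extension with non-trivial automorphism $\tau$, let $V$ be a quadratic space over $F$, and $V_D=D\otimes_F V$. Then every descendant of $(U(V_D),O(V))$ is a product of pairs of the types (i) $(GL(W),O(W))$ for a quadratic space $W$ over a finite extension $F'$ of $F$; (ii) $(U(W_{D'}),O(W))$ for an extension $(D',\tau')$ of $(D,\tau)$ and a quadratic space $W$ over $D'^{\tau'}$. (2) Let $V$ be a quadratic space over $F$. Then every descendant of $(GL(V),O(V))$ is a product of pairs of the type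 $(GL(W),O(W))$ for a quadratic space $W$ over a finite extension $F'$ of $F$. (3) Let $D/F$ be a quadratic extension with non-trivial automorphism $\tau$, and let $V$ be a hermitian space over $(D,\tau)$. Then every descendant of $(GL(V),U(V))$ is a product of pairs of the types (i) $(GL(W)\times GL(W),\Delta GL(W))$ for a finite dimensional space $W$ over a finite extension $D'$ of $D$; (ii) $(GL(W),U(W))$ for a hermitian space $W$ over an extension $(D',\tau')$ of $(D,\tau)$. -/

import Mathlib

open scoped TensorProduct

universe u

/-! ## Algebraic groups with an involution, through their functors of points -/

/-- A symmetric pair `(G, H, θ)` over `F`, given by its functor of points: a functor `R ↦ G(R)` from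
commutative `F`-algebras to groups, with a natural involution `θ` of it; `H` is the fixed point
group of `θ` (see `SymmetricPair.H`).  All the pairs below are built from explicit linear algebraic
groups. -/
structure SymmetricPair (F : Type u) [Field F] where
  /-- The group `G(R)` of points with values in `R`. -/
  G : (R : Type u) → [CommRing R] → [Algebra F R] → Type u
  [group : ∀ (R : Type u) [CommRing R] [Algebra F R], Group (G R)]
  map : ∀ {R S : Type u} [CommRing R] [Algebra F R] [CommRing S] [Algebra F S],
    (R →ₐ[F] S) → (G R →* G S)
  map_id : ∀ (R : Type u) [CommRing R] [Algebra F R] (g : G R), map (AlgHom.id F R) g = g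
  map_comp : ∀ {R S T : Type u} [CommRing R] [Algebra F R] [CommRing S] [Algebra F S]
    [CommRing T] [Algebra F T] (ψ : S →ₐ[F] T) (φ : R →ₐ[F] S) (g : G R),
    map (ψ.comp φ) g = map ψ (map φ g)
  /-- The involution. -/
  θ : ∀ {R : Type u} [CommRing R] [Algebra F R], G R →* G R
  θ_θ : ∀ {R : Type u} [CommRing R] [Algebra F R] (g : G R), θ (θ g) = g
  map_θ : ∀ {R S : Type u} [CommRing R] [Algebra F R] [CommRing S] [Algebra F S]
    (φ : R →ₐ[F] S) (g : G R), map φ (θ g) = θ (map φ g)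

namespace SymmetricPair

variable {F : Type u} [Field F]

attribute [instance] SymmetricPair.group

/-- The subgroup `H = G^θ`, on `R`-points. -/
def H (X : SymmetricPair F) (R : Type u) [CommRing R] [Algebra F R] : Subgroup (X.G R) where
  carrier := {g | X.θ g = g}
  mul_mem' := by
    intro a b ha hb
    simp only [Set.mem_ofPred_eq] at *
    rw [map_mul, ha, hb]
  one_mem' := map_one _
  inv_mem' := by
    intro a ha
    simp only [Set.mem_ofPred_eq] at *
    rw [map_inv, ha]

/-- An isomorphism of symmetric pairs: a natural isomorphism of the groups (that is, by Yoneda, an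
isomorphism of algebraic groups over `F`) which commutes with the involutions.  It then
carries `H` onto `H`. -/
structure Iso (X Y : SymmetricPair F) where
  toEquiv : ∀ (R : Type u) [CommRing R] [Algebra F R], X.G R ≃* Y.G R
  natural : ∀ {R S : Type u} [CommRing R] [Algebra F R] [CommRing S] [Algebra F S]
    (φ : R →ₐ[F] S) (g : X.G R), toEquiv S (X.map φ g) = Y.map φ (toEquiv R g)
  comm : ∀ {R : Type u} [CommRing R] [Algebra F R] (g : X.G R),
    toEquiv R (X.θ g) = Y.θ (toEquiv R g)

/-- The product of a finite family of symmetric pairs. -/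
def prod {n : ℕ} (P : Fin n → SymmetricPair F) : SymmetricPair F where
  G R _ _ := ∀ i, (P i).G R
  map φ := MonoidHom.piMap fun i => (P i).map φ
  map_id R _ _ g := funext fun i => (P i).map_id R (g i)
  map_comp ψ φ g := funext fun i => (P i).map_comp ψ φ (g i)
  θ := MonoidHom.piMap fun i => (P i).θ
  θ_θ g := funext fun i => (P i).θ_θ (g i)
  map_θ φ g := funext fun i => (P i).map_θ φ (g i)

/-- `X` is isomorphic to a finite product of pairs each of which is of type `T`. -/
def IsProductOf (T : SymmetricPair F → Prop) (X : SymmetricPair F) : Prop :=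
  ∃ (n : ℕ) (P : Fin n → SymmetricPair F), (∀ i, T (P i)) ∧ Nonempty (Iso X (prod P))

/-! ### Closed orbits -/

/-- A regular function on `G` defined over `F`: a natural transformation from `G` to the affine
line, that is, an element of the coordinate ring `F[G]`. -/
structure RegularFunction (X : SymmetricPair F) where
  toFun : ∀ {R : Type u} [CommRing R] [Algebra F R], X.G R → R
  natural : ∀ {R S : Type u} [CommRing R] [Algebra F R] [CommRing S] [Algebra F S]
    (φ : R →ₐ[F] S) (g : X.G R), toFun (X.map φ g) = φ (toFun g)

/-- The regular functions on the variety `G(F̄)` over the algebraic closure: `F̄`-linear combinations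
of the elements of `F[G]`, as functions on `G(F̄)`. -/
noncomputable def geometricFunctions (X : SymmetricPair F) :
    Submodule (AlgebraicClosure F) (X.G (AlgebraicClosure F) → AlgebraicClosure F) :=
  Submodule.span _ {f | ∃ φ : X.RegularFunction, f = fun g => φ.toFun g}

/-- Zariski closed subsets of `G(F̄)`: the common zero sets of families of regular functions. -/
def IsZariskiClosed (X : SymmetricPair F) (Z : Set (X.G (AlgebraicClosure F))) : Prop :=
  ∃ S : Set (X.G (AlgebraicClosure F) → AlgebraicClosure F),
    S ⊆ X.geometricFunctions ∧ Z = {p | ∀ f ∈ S, f p = 0}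

/-- For `g ∈ G(F)`, the orbit `H g H` is closed in the variety `G`. -/
def HasClosedOrbit (X : SymmetricPair F) (g : X.G F) : Prop :=
  X.IsZariskiClosed (DoubleCoset.doubleCoset
    (X.map (Algebra.ofId F (AlgebraicClosure F)) g)
    (X.H (AlgebraicClosure F)) (X.H (AlgebraicClosure F)))

/-! ### Descendants -/

/-- The anti-involution `σ(g) = θ(g⁻¹)`. -/
def σ (X : SymmetricPair F) {R : Type u} [CommRing R] [Algebra F R] (g : X.G R) : X.G R :=
  X.θ g⁻¹

/-- The symmetrization map `s(g) = g σ(g)`. -/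
def s (X : SymmetricPair F) {R : Type u} [CommRing R] [Algebra F R] (g : X.G R) : X.G R :=
  g * X.σ g

theorem θ_map_s (X : SymmetricPair F) (g : X.G F) (R : Type u) [CommRing R] [Algebra F R] :
    X.θ (X.map (Algebra.ofId F R) (X.s g)) = (X.map (Algebra.ofId F R) (X.s g))⁻¹ := by
  rw [← X.map_θ, ← map_inv]
  congr 1
  simp [s, σ, X.θ_θ]

theorem map_ofId (X : SymmetricPair F) (x : X.G F) {R S : Type u} [CommRing R] [Algebra F R]
    [CommRing S] [Algebra F S] (φ : R →ₐ[F] S) :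
    X.map φ (X.map (Algebra.ofId F R) x) = X.map (Algebra.ofId F S) x := by
  rw [← X.map_comp, Subsingleton.elim (φ.comp (Algebra.ofId F R)) (Algebra.ofId F S)]

/-- For `x = s(g)`, the symmetric pair `(G_x, H_x, θ|_{G_x})`, where `G_x` is the centralizer of
`x` in `G` (and `H_x`, the centralizer of `x` in `H`, is the fixed point group of `θ` on `G_x`). -/
def centralizerPair (X : SymmetricPair F) (g : X.G F) : SymmetricPair F where
  G R _ _ := Subgroup.centralizer {X.map (Algebra.ofId F R) (X.s g)}
  map {R S} _ _ _ _ φ := ((X.map φ).comp (Subgroup.subtype _)).codRestrict _ (by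
    rintro ⟨y, hy⟩
    rw [Subgroup.mem_centralizer_singleton_iff] at hy ⊢
    simp only [MonoidHom.coe_comp, Subgroup.coe_subtype, Function.comp_apply]
    rw [← X.map_ofId _ φ, ← map_mul, ← map_mul, hy])
  map_id R _ _ y := Subtype.ext (X.map_id R y.1)
  map_comp ψ φ y := Subtype.ext (X.map_comp ψ φ y.1)
  θ {R} _ _ := ((X.θ).comp (Subgroup.subtype _)).codRestrict _ (by
    rintro ⟨y, hy⟩
    rw [Subgroup.mem_centralizer_singleton_iff] at hy ⊢
    simp only [MonoidHom.coe_comp, Subgroup.coe_subtype, Function.comp_apply]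
    have h := congrArg X.θ hy
    rw [map_mul, map_mul, X.θ_map_s] at h
    exact (Commute.inv_right_iff (a := X.θ y)).mp h)
  θ_θ y := Subtype.ext (X.θ_θ y.1)
  map_θ φ y := Subtype.ext (X.map_θ φ y.1)

/-- `Y` is a descendant of `X = (G, H, θ)`: it is `(G_x, H_x, θ|_{G_x})` for `x = s(g)`, where
`g ∈ G(F)` is such that `H g H` is closed. -/
def IsDescendant (X Y : SymmetricPair F) : Prop :=
  ∃ g : X.G F, X.HasClosedOrbit g ∧ Y = X.centralizerPair g

end SymmetricPair

/-! ## Groups of units of algebras with involution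

For a finite dimensional space `V` over a finite extension `K` of `F`, put `E = End_K(V)`.  For every
commutative `F`-algebra `R` one has `R ⊗_F E = End_{R ⊗_F K}(R ⊗_F V)`, so the functor
`R ↦ (R ⊗_F E)ˣ` is the algebraic group `GL(V)`, viewed as a group over `F` (its group of `F`-points
is `GL_K(V)`). -/

/-- An `F`-linear anti-automorphism of order at most two of an `F`-algebra. -/
structure AntiInvolution (F E : Type u) [Field F] [Ring E] [Algebra F E] where
  toLin : E →ₗ[F] E
  map_mul' : ∀ x y, toLin (x * y) = toLin y * toLin x
  invol : ∀ x, toLin (toLin x) = x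

namespace AntiInvolution

variable {F E : Type u} [Field F] [Ring E] [Algebra F E] (a : AntiInvolution F E)

theorem map_one' : a.toLin 1 = 1 := by
  have h := a.map_mul' (a.toLin 1) 1
  rw [mul_one, a.invol, mul_one] at h
  exact h.symm

variable (R : Type u) [CommRing R] [Algebra F R]

/-- The `R`-linear extension of an anti-involution to `R ⊗_F E`. -/
noncomputable def ext : R ⊗[F] E →ₗ[R] R ⊗[F] E := a.toLin.baseChange R

theorem ext_tmul (r : R) (x : E) : a.ext R (r ⊗ₜ x) = r ⊗ₜ a.toLin x := by
  simp [ext]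

theorem ext_one : a.ext R 1 = 1 := by
  rw [Algebra.TensorProduct.one_def, ext_tmul, a.map_one']

theorem ext_mul (x y : R ⊗[F] E) : a.ext R (x * y) = a.ext R y * a.ext R x := by
  induction x with
  | zero => simp
  | add x₁ x₂ h₁ h₂ => simp [add_mul, mul_add, h₁, h₂]
  | tmul r x =>
    induction y with
    | zero => simp
    | add y₁ y₂ h₁ h₂ => simp [add_mul, mul_add, h₁, h₂]
    | tmul s y =>
      simp [ext_tmul, a.map_mul', mul_comm]

theorem ext_ext (x : R ⊗[F] E) : a.ext R (a.ext R x) = x := by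
  induction x with
  | zero => simp
  | add x₁ x₂ h₁ h₂ => simp [h₁, h₂]
  | tmul r x => simp [ext_tmul, a.invol]

variable {R}

theorem map_ext {S : Type u} [CommRing S] [Algebra F S] (φ : R →ₐ[F] S) (x : R ⊗[F] E) :
    Algebra.TensorProduct.map φ (AlgHom.id F E) (a.ext R x) =
      a.ext S (Algebra.TensorProduct.map φ (AlgHom.id F E) x) := by
  induction x with
  | zero => simp
  | add x₁ x₂ h₁ h₂ => simp [h₁, h₂]
  | tmul r x => simp [ext_tmul]

/-- `g ↦ (a g)⁻¹` on the units of `R ⊗_F E`. -/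
noncomputable def unitsInv : (R ⊗[F] E)ˣ →* (R ⊗[F] E)ˣ where
  toFun g :=
    { val := a.ext R (g⁻¹ : (R ⊗[F] E)ˣ)
      inv := a.ext R g
      val_inv := by rw [← a.ext_mul]; simp [a.ext_one]
      inv_val := by rw [← a.ext_mul]; simp [a.ext_one] }
  map_one' := by ext; simp [a.ext_one]
  map_mul' g h := by ext; simp [a.ext_mul]

end AntiInvolution

section Pairs

variable {F E : Type u} [Field F] [Ring E] [Algebra F E]

/-- Functoriality of `R ↦ (R ⊗_F E)ˣ`. -/
noncomputable def unitsMap (E : Type u) [Ring E] [Algebra F E] {R S : Type u} [CommRing R]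
    [Algebra F R] [CommRing S] [Algebra F S] (φ : R →ₐ[F] S) : (R ⊗[F] E)ˣ →* (S ⊗[F] E)ˣ :=
  Units.map (Algebra.TensorProduct.map φ (AlgHom.id F E) : R ⊗[F] E →* S ⊗[F] E)

theorem unitsMap_id (R : Type u) [CommRing R] [Algebra F R] (g : (R ⊗[F] E)ˣ) :
    unitsMap E (AlgHom.id F R) g = g := by
  ext
  simp [unitsMap]

theorem unitsMap_comp {R S T : Type u} [CommRing R] [Algebra F R] [CommRing S] [Algebra F S]
    [CommRing T] [Algebra F T] (ψ : S →ₐ[F] T) (φ : R →ₐ[F] S) (g : (R ⊗[F] E)ˣ) :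
    unitsMap E (ψ.comp φ) g = unitsMap E ψ (unitsMap E φ g) := by
  ext
  simp only [unitsMap, Units.coe_map, MonoidHom.coe_coe]
  rw [← AlgHom.comp_apply, ← Algebra.TensorProduct.map_comp, AlgHom.id_comp]

/-- For `E = End(V)` and the adjoint anti-involution `a` of a form on `V`: the pair of the general
linear group `G = GL(V)` and the isometry group `H` of the form, with the involution
`θ(g) = a(g)⁻¹`. -/
noncomputable def generalLinearPair (a : AntiInvolution F E) : SymmetricPair F where
  G R _ _ := (R ⊗[F] E)ˣ
  map φ := unitsMap E φ
  map_id := unitsMap_id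
  map_comp := unitsMap_comp
  θ := a.unitsInv
  θ_θ g := by ext; exact a.ext_ext _ _
  map_θ φ g := by ext; exact a.map_ext φ _

/-- The pair `(GL × GL, ΔGL)` where `GL(R) = (R ⊗_F E)ˣ`, with `θ(g₁, g₂) = (g₂, g₁)`. -/
noncomputable def diagonalPair (F E : Type u) [Field F] [Ring E] [Algebra F E] :
    SymmetricPair F where
  G R _ _ := (R ⊗[F] E)ˣ × (R ⊗[F] E)ˣ
  map φ := (unitsMap E φ).prodMap (unitsMap E φ)
  map_id R _ _ g := Prod.ext (unitsMap_id R g.1) (unitsMap_id R g.2)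
  map_comp ψ φ g := Prod.ext (unitsMap_comp ψ φ g.1) (unitsMap_comp ψ φ g.2)
  θ := (MonoidHom.snd _ _).prod (MonoidHom.fst _ _)
  θ_θ _ := rfl
  map_θ _ _ := rfl

theorem unitsInv_eq_iff (a : AntiInvolution F E) (R : Type u) [CommRing R] [Algebra F R]
    (g : (R ⊗[F] E)ˣ) : a.unitsInv g = g ↔ a.ext R g * g = 1 := by
  rw [← inv_mul_eq_one, Units.ext_iff]
  rfl

/-- The `R`-points `{g | a(g) g = 1}` of the unitary group of an algebra with anti-involution.  When
`a` is the adjoint anti-involution of a form, this is the isometry group of the form. -/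
def unitaryPoints (a : AntiInvolution F E) (R : Type u) [CommRing R] [Algebra F R] :
    Subgroup (R ⊗[F] E)ˣ where
  carrier := {g | a.ext R g * g = 1}
  mul_mem' := by
    intro x y hx hy
    simp only [Set.mem_ofPred_eq, ← unitsInv_eq_iff] at *
    rw [map_mul, hx, hy]
  one_mem' := (unitsInv_eq_iff a R 1).mp (map_one _)
  inv_mem' := by
    intro x hx
    simp only [Set.mem_ofPred_eq, ← unitsInv_eq_iff] at *
    rw [map_inv, hx]

/-- The `R`-linear extension to units of an automorphism of `E`. -/
noncomputable def unitsAut (b : E →ₐ[F] E) (R : Type u) [CommRing R] [Algebra F R] :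
    (R ⊗[F] E)ˣ →* (R ⊗[F] E)ˣ :=
  Units.map (Algebra.TensorProduct.map (AlgHom.id F R) b : R ⊗[F] E →* R ⊗[F] E)

theorem unitsAut_unitsInv (a : AntiInvolution F E) (b : E →ₐ[F] E)
    (hab : ∀ x, b (a.toLin x) = a.toLin (b x)) (R : Type u) [CommRing R] [Algebra F R]
    (g : (R ⊗[F] E)ˣ) : a.unitsInv (unitsAut b R g) = unitsAut b R (a.unitsInv g) := by
  have key : ∀ x : R ⊗[F] E, a.ext R (Algebra.TensorProduct.map (AlgHom.id F R) b x) =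
      Algebra.TensorProduct.map (AlgHom.id F R) b (a.ext R x) := by
    intro x
    induction x with
    | zero => simp
    | add x₁ x₂ h₁ h₂ => simp [h₁, h₂]
    | tmul r x => simp [AntiInvolution.ext_tmul, hab]
  ext
  exact key _

/-- For an anti-involution `a` and a commuting automorphism `b` of order at most two of `E`: the pair
with `G(R) = {g | a(g) g = 1}` and `θ = b`. -/
noncomputable def unitaryPair (a : AntiInvolution F E) (b : E →ₐ[F] E) (hb : ∀ x, b (b x) = x)
    (hab : ∀ x, b (a.toLin x) = a.toLin (b x)) : SymmetricPair F where
  G R _ _ := unitaryPoints a R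
  map {R S} _ _ _ _ φ := ((unitsMap E φ).comp (Subgroup.subtype _)).codRestrict _ (by
    rintro ⟨g, hg⟩
    refine (unitsInv_eq_iff a S _).mp ?_
    change a.unitsInv (unitsMap E φ g) = unitsMap E φ g
    have h : unitsMap E φ (a.unitsInv g) = a.unitsInv (unitsMap E φ g) := by
      ext; exact a.map_ext φ _
    rw [← h, (unitsInv_eq_iff a R g).mpr hg])
  map_id R _ _ g := Subtype.ext (unitsMap_id R g.1)
  map_comp ψ φ g := Subtype.ext (unitsMap_comp ψ φ g.1)
  θ {R} _ _ := ((unitsAut b R).comp (Subgroup.subtype _)).codRestrict _ (by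
    rintro ⟨g, hg⟩
    refine (unitsInv_eq_iff a R _).mp ?_
    change a.unitsInv (unitsAut b R g) = unitsAut b R g
    rw [unitsAut_unitsInv a b hab, (unitsInv_eq_iff a R g).mpr hg])
  θ_θ {R} _ _ g := by
    apply Subtype.ext
    apply Units.ext
    change Algebra.TensorProduct.map (AlgHom.id F R) b
      (Algebra.TensorProduct.map (AlgHom.id F R) b (g.1 : R ⊗[F] E)) = g.1
    rw [← AlgHom.comp_apply, ← Algebra.TensorProduct.map_comp, AlgHom.id_comp,
      show b.comp b = AlgHom.id F E from AlgHom.ext hb, Algebra.TensorProduct.map_id]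
    rfl
  map_θ {R S} _ _ _ _ φ g := by
    apply Subtype.ext
    apply Units.ext
    change Algebra.TensorProduct.map φ (AlgHom.id F E)
      (Algebra.TensorProduct.map (AlgHom.id F R) b (g.1 : R ⊗[F] E)) =
      Algebra.TensorProduct.map (AlgHom.id F S) b
        (Algebra.TensorProduct.map φ (AlgHom.id F E) (g.1 : R ⊗[F] E))
    rw [← AlgHom.comp_apply, ← AlgHom.comp_apply, ← Algebra.TensorProduct.map_comp,
      ← Algebra.TensorProduct.map_comp, AlgHom.id_comp, AlgHom.id_comp, AlgHom.comp_id,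
      AlgHom.comp_id]

end Pairs

/-! ## Hermitian and quadratic spaces -/

/-- A non-degenerate `σ`-hermitian form: `B(k v, w) = σ(k) B(v, w)`, `B(v, k w) = k B(v, w)` and
`σ(B(v, w)) = B(w, v)`. -/
structure HermitianForm {K : Type u} [Field K] (σ : K →+* K) (V : Type u) [AddCommGroup V]
    [Module K V] where
  form : V →ₛₗ[σ] V →ₗ[K] K
  symm : form.IsSymm
  nondegenerate : form.Nondegenerate

/-- The structure of a quadratic space in characteristic different from two: a non-degenerate
symmetric bilinear form. -/
abbrev QuadraticSpaceForm (K : Type u) [Field K] (V : Type u) [AddCommGroup V] [Module K V] :=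
  HermitianForm (RingHom.id K) V

namespace HermitianForm

section Adjoint

variable {K V : Type u} [Field K] [AddCommGroup V] [Module K V] {σ : K →+* K}
  (B : HermitianForm σ V)

theorem ext_left {x y : V} (h : ∀ z, B.form x z = B.form y z) : x = y := by
  rw [← sub_eq_zero]
  refine B.nondegenerate.1 _ fun z => ?_
  rw [map_sub, LinearMap.sub_apply, h, sub_self]

variable (F : Type u) [Field F] [Algebra F K] [FiniteDimensional F K] [FiniteDimensional K V]
  [Module F V] [IsScalarTower F K V]

theorem exists_form_eq
    (hσ : ∀ r : F, σ (algebraMap F K r) = algebraMap F K r)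
    (f : V →ₗ[K] K) : ∃ x, B.form x = f := by
  let e : V →ₗ[F] (V →ₗ[K] K) :=
    { toFun := fun x => B.form x
      map_add' := fun x y => map_add _ x y
      map_smul' := fun r x => by
        rw [← algebraMap_smul K r x, map_smulₛₗ, hσ, algebraMap_smul]
        rfl }
  have : FiniteDimensional F V := Module.Finite.trans K V
  have : FiniteDimensional F (V →ₗ[K] K) := Module.Finite.trans K _
  have hinj : Function.Injective e := fun x y h =>
    B.ext_left fun z => congrArg (fun l : V →ₗ[K] K => l z) h
  have hrank : Module.finrank F V = Module.finrank F (V →ₗ[K] K) := by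
    rw [← Module.finrank_mul_finrank F K V, ← Module.finrank_mul_finrank F K (V →ₗ[K] K)]
    congr 1
    exact (Subspace.dual_finrank_eq (K := K) (V := V)).symm
  exact (LinearMap.injective_iff_surjective_of_finrank_eq_finrank hrank).mp hinj f

theorem exists_adjoint
    (hσ : ∀ r : F, σ (algebraMap F K r) = algebraMap F K r)
    (f : Module.End K V) :
    ∃ g : Module.End K V, ∀ x y, B.form (g x) y = B.form x (f y) := by
  choose g hg using fun x => B.exists_form_eq F hσ (B.form x ∘ₗ f)
  have hg' : ∀ x y, B.form (g x) y = B.form x (f y) := fun x y => by rw [hg]; rfl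
  refine ⟨{ toFun := g, map_add' := fun x y => ?_, map_smul' := fun k x => ?_ }, hg'⟩
  · refine B.ext_left fun z => ?_
    simp [hg']
  · refine B.ext_left fun z => ?_
    simp [hg']

variable (hσ : ∀ r : F, σ (algebraMap F K r) = algebraMap F K r)

/-- The adjoint `f*` of an endomorphism: `B(f* x, y) = B(x, f y)`. -/
noncomputable def adjoint (f : Module.End K V) : Module.End K V :=
  (B.exists_adjoint F hσ f).choose

theorem form_adjoint_left (f : Module.End K V) (x y : V) :
    B.form (B.adjoint F hσ f x) y = B.form x (f y) :=
  (B.exists_adjoint F hσ f).choose_spec x y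

theorem form_adjoint_right (f : Module.End K V) (x y : V) :
    B.form (f x) y = B.form x (B.adjoint F hσ f y) := by
  rw [← B.symm.eq, ← B.form_adjoint_left F hσ, B.symm.eq]

theorem eq_adjoint {f g : Module.End K V} (h : ∀ x y, B.form (g x) y = B.form x (f y)) :
    g = B.adjoint F hσ f :=
  LinearMap.ext fun x => B.ext_left fun y => by rw [h, B.form_adjoint_left]

/-- The adjoint as an `F`-linear anti-involution of `End_K(V)`. -/
noncomputable def adjointInvolution : AntiInvolution F (Module.End K V) where
  toLin :=
    { toFun := B.adjoint F hσ
      map_add' := fun f g => (B.eq_adjoint F hσ fun x y => by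
        simp [B.form_adjoint_left F hσ]).symm
      map_smul' := fun r f => (B.eq_adjoint F hσ fun x y => by
        simp only [RingHom.id_apply, LinearMap.smul_apply]
        rw [← algebraMap_smul K r (f y), ← algebraMap_smul K r (B.adjoint F hσ f x),
          map_smulₛₗ, hσ, LinearMap.smul_apply, B.form_adjoint_left F hσ, map_smul]).symm }
  map_mul' f g := (B.eq_adjoint F hσ fun x y => by
    simp [B.form_adjoint_left F hσ]).symm
  invol f := (B.eq_adjoint F hσ fun x y => B.form_adjoint_right F hσ f x y).symm

end Adjoint

section ExtensionOfScalars

variable {L K : Type u} [Field L] [Field K] [Algebra L K] (τ : K ≃ₐ[L] K)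
  {W : Type u} [AddCommGroup W] [Module L W]
  (B : QuadraticSpaceForm L W)

/-- The `τ`-semilinear map `τ ⊗ 1` of `K ⊗_L W`. -/
noncomputable def conj (W : Type u) [AddCommGroup W] [Module L W] :
    K ⊗[L] W →ₛₗ[(τ : K →+* K)] K ⊗[L] W where
  toFun := LinearMap.rTensor W τ.toLinearMap
  map_add' := map_add _
  map_smul' k x := by
    induction x with
    | zero => simp
    | add x y hx hy => simp only [smul_add, map_add, hx, hy]
    | tmul a w => simp [TensorProduct.smul_tmul']

theorem conj_tmul (k : K) (w : W) : conj τ W (k ⊗ₜ w) = τ k ⊗ₜ w := rfl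

theorem conj_conj (hτ : ∀ k, τ (τ k) = k) (x : K ⊗[L] W) : conj τ W (conj τ W x) = x := by
  induction x with
  | zero => simp
  | add x y hx hy => simp [hx, hy]
  | tmul a w => simp [conj_tmul, hτ]

/-- The sesquilinear extension of a bilinear form:
`(a ⊗ v, b ⊗ w) ↦ τ(a) b B(v, w)`. -/
noncomputable def extendForm : K ⊗[L] W →ₛₗ[(τ : K →+* K)] K ⊗[L] W →ₗ[K] K :=
  LinearMap.comp (LinearMap.BilinForm.baseChange K B.form) (conj τ W)

theorem extendForm_tmul (a b : K) (v w : W) :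
    extendForm τ B (a ⊗ₜ v) (b ⊗ₜ w) = τ a * b * algebraMap L K (B.form v w) := by
  change LinearMap.BilinForm.baseChange K B.form (τ a ⊗ₜ v) (b ⊗ₜ w) = _
  rw [LinearMap.BilinForm.baseChange_tmul, Algebra.smul_def, mul_comm]

theorem extendForm_symm (hτ : ∀ k, τ (τ k) = k) (x y : K ⊗[L] W) :
    τ (extendForm τ B x y) = extendForm τ B y x := by
  induction x with
  | zero => simp
  | add x₁ x₂ h₁ h₂ => simp [h₁, h₂]
  | tmul a v =>
    induction y with
    | zero => simp
    | add x₁ x₂ h₁ h₂ => simp [h₁, h₂]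
    | tmul b w =>
      rw [extendForm_tmul, extendForm_tmul, map_mul, map_mul, hτ, AlgEquiv.commutes,
        show B.form v w = B.form w v from (B.symm.eq v w), mul_comm a]

theorem extendForm_separatingRight [FiniteDimensional L W] (y : K ⊗[L] W)
    (h : ∀ x, extendForm τ B x y = 0) : y = 0 := by
  let b := Module.finBasis L W
  let d := LinearMap.BilinForm.dualBasis B.form B.nondegenerate b
  have key : ∀ (i) (z : K ⊗[L] W), extendForm τ B (1 ⊗ₜ d i) z = (b.baseChange K).repr z i := by
    intro i z
    induction z with
    | zero => simp
    | add x₁ x₂ h₁ h₂ => simp [h₁, h₂]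
    | tmul k w =>
      rw [extendForm_tmul, Module.Basis.baseChange_repr_tmul, map_one, one_mul, Algebra.smul_def,
        mul_comm]
      congr 2
      conv_lhs => rw [← b.sum_repr w, map_sum]
      have hd : ∀ j, B.form (d i) (b j) = if j = i then 1 else 0 :=
        LinearMap.BilinForm.apply_dualBasis_left B.nondegenerate b i
      simp [hd]
  apply (b.baseChange K).ext_elem
  intro i
  rw [← key, h, map_zero]
  rfl

/-- The hermitian space `W_K = K ⊗_L W` over `(K, τ)` obtained from a quadratic space `W` over `L` by
extension of scalars. -/
noncomputable def extend [FiniteDimensional L W] (hτ : ∀ k, τ (τ k) = k) :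
    HermitianForm (τ : K →+* K) (K ⊗[L] W) where
  form := extendForm τ B
  symm := ⟨extendForm_symm τ B hτ⟩
  nondegenerate := by
    refine ⟨fun x h => ?_, extendForm_separatingRight τ B⟩
    refine extendForm_separatingRight τ B x fun y => ?_
    rw [← extendForm_symm τ B hτ, h, map_zero]

theorem extendForm_conj (x y : K ⊗[L] W) :
    extendForm τ B (conj τ W x) (conj τ W y) = τ (extendForm τ B x y) := by
  induction x with
  | zero => simp
  | add x₁ x₂ h₁ h₂ => simp [h₁, h₂]
  | tmul a v =>
    induction y with
    | zero => simp
    | add x₁ x₂ h₁ h₂ => simp [h₁, h₂]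
    | tmul b w => simp [conj_tmul, extendForm_tmul]

/-- The automorphism `f ↦ (τ ⊗ 1) f (τ ⊗ 1)` of `End_K(K ⊗_L W)`. -/
noncomputable def conjEnd (hτ : ∀ k, τ (τ k) = k) (F W : Type u) [Field F] [Algebra F L]
    [Algebra F K] [IsScalarTower F L K] [AddCommGroup W] [Module L W] :
    Module.End K (K ⊗[L] W) →ₐ[F] Module.End K (K ⊗[L] W) where
  toFun f :=
    { toFun := fun x => conj τ W (f (conj τ W x))
      map_add' := fun x y => by simp
      map_smul' := fun k x => by simp [hτ] }
  map_one' := LinearMap.ext fun x => conj_conj τ hτ x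
  map_zero' := LinearMap.ext fun x => by simp
  map_mul' f g := LinearMap.ext fun x => by simp [conj_conj τ hτ]
  map_add' f g := LinearMap.ext fun x => by simp
  commutes' r := LinearMap.ext fun x => by
    simp only [LinearMap.coe_mk, AddHom.coe_mk, Module.algebraMap_end_apply]
    rw [← algebraMap_smul K r (conj τ W x), map_smulₛₗ, conj_conj τ hτ,
      IsScalarTower.algebraMap_apply F L K]
    change τ (algebraMap L K (algebraMap F L r)) • x = _
    rw [τ.commutes, ← IsScalarTower.algebraMap_apply F L K, algebraMap_smul]

theorem commutes_of_tower (F : Type u) [Field F] [Algebra F L] [Algebra F K]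
    [IsScalarTower F L K] (r : F) : (τ : K →+* K) (algebraMap F K r) = algebraMap F K r := by
  rw [IsScalarTower.algebraMap_apply F L K]
  exact τ.commutes _

/-- The adjoint anti-involution of `End_K(K ⊗_L W)` for the extended hermitian form. -/
noncomputable def extendAdjoint [FiniteDimensional L W] (hτ : ∀ k, τ (τ k) = k) (F : Type u)
    [Field F] [Algebra F L] [Algebra F K] [IsScalarTower F L K] [FiniteDimensional F K] :
    AntiInvolution F (Module.End K (K ⊗[L] W)) :=
  (extend τ B hτ).adjointInvolution F (commutes_of_tower τ F)

theorem conjEnd_conjEnd (hτ : ∀ k, τ (τ k) = k) (F : Type u)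
    [Field F] [Algebra F L] [Algebra F K] [IsScalarTower F L K]
    (f : Module.End K (K ⊗[L] W)) : conjEnd τ hτ F W (conjEnd τ hτ F W f) = f :=
  LinearMap.ext fun x => by simp [conjEnd, conj_conj τ hτ]

theorem conjEnd_extendAdjoint [FiniteDimensional L W] (hτ : ∀ k, τ (τ k) = k) (F : Type u)
    [Field F] [Algebra F L] [Algebra F K] [IsScalarTower F L K] [FiniteDimensional F K]
    (f : Module.End K (K ⊗[L] W)) :
    conjEnd τ hτ F W ((extendAdjoint τ B hτ F).toLin f) =
      (extendAdjoint τ B hτ F).toLin (conjEnd τ hτ F W f) := by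
  have hs := commutes_of_tower τ F
  refine (extend τ B hτ).eq_adjoint F hs fun x y => ?_
  have h := extendForm_conj τ B
  have hc := conj_conj (W := W) τ hτ
  change extendForm τ B (conj τ W ((extend τ B hτ).adjoint F hs f (conj τ W x))) y =
    extendForm τ B x (conj τ W (f (conj τ W y)))
  have h1 := h ((extend τ B hτ).adjoint F hs f (conj τ W x)) (conj τ W y)
  have h2 := h (conj τ W x) (f (conj τ W y))
  rw [hc] at h1 h2
  rw [h1, h2]
  congr 1
  exact (extend τ B hτ).form_adjoint_left F hs f _ _

end ExtensionOfScalars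

end HermitianForm

/-! ## The pairs of the theorem -/

section Types

variable (F : Type u) [Field F]

/-- The pair `(GL(W), O(W))` for a quadratic space `(W, B)` over a finite extension `K` of `F`, as a
symmetric pair over `F`; `θ(g)` is the inverse of the transpose of `g` with respect to `B`. -/
noncomputable def pairGLO {K W : Type u} [Field K] [Algebra F K] [FiniteDimensional F K]
    [AddCommGroup W] [Module K W] [FiniteDimensional K W] [Module F W] [IsScalarTower F K W]
    (B : QuadraticSpaceForm K W) : SymmetricPair F :=
  generalLinearPair (B.adjointInvolution F fun _ => rfl)

/-- The pair `(GL(W), U(W))` for a hermitian space `(W, B)` over `(K, τ)`, where `K` is a finite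
extension of `F`, as a symmetric pair over `F`; `θ(g)` is the inverse of the adjoint of `g` with
respect to `B`. -/
noncomputable def pairGLU {K W : Type u} [Field K] [Algebra F K] [FiniteDimensional F K]
    (τ : K ≃ₐ[F] K) [AddCommGroup W] [Module K W] [FiniteDimensional K W] [Module F W]
    [IsScalarTower F K W] (B : HermitianForm (τ : K →+* K) W) : SymmetricPair F :=
  generalLinearPair (B.adjointInvolution F fun r => τ.commutes r)

/-- The pair `(GL(W) × GL(W), ΔGL(W))` for a linear space `W` over a finite extension `K` of `F`, as
a symmetric pair over `F`. -/
noncomputable def pairGLGL (K W : Type u) [Field K] [Algebra F K] [AddCommGroup W] [Module K W]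
    [Module F W] [IsScalarTower F K W] : SymmetricPair F :=
  diagonalPair F (Module.End K W)

/-- The pair `(U(W_K), O(W))`, where `K/L` is an extension with an involution `τ`, `(W, B)` is a
quadratic space over `L` and `W_K = K ⊗_L W` is the hermitian space obtained from it, as a symmetric
pair over `F`; the involution is `θ(g) = (τ ⊗ 1) g (τ ⊗ 1)`. -/
noncomputable def pairUO {L K W : Type u} [Field L] [Field K] [Algebra F L] [Algebra F K]
    [Algebra L K] [IsScalarTower F L K] [FiniteDimensional F K] (τ : K ≃ₐ[L] K)
    (hτ : ∀ k, τ (τ k) = k) [AddCommGroup W] [Module L W] [FiniteDimensional L W]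
    (B : QuadraticSpaceForm L W) : SymmetricPair F :=
  unitaryPair (HermitianForm.extendAdjoint τ B hτ F) (HermitianForm.conjEnd τ hτ F W)
    (HermitianForm.conjEnd_conjEnd τ hτ F) (HermitianForm.conjEnd_extendAdjoint τ B hτ F)

/-- The type of pairs `(GL(W), O(W))` for a quadratic space `W` over a finite extension of `F`. -/
def IsGLO (Y : SymmetricPair F) : Prop :=
  ∃ (K : Type u) (_ : Field K) (_ : Algebra F K) (_ : FiniteDimensional F K)
    (W : Type u) (_ : AddCommGroup W) (_ : Module K W) (_ : FiniteDimensional K W)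
    (_ : Module F W) (_ : IsScalarTower F K W) (B : QuadraticSpaceForm K W),
    Y = pairGLO F B

variable (D : Type u) [Field D] [Algebra F D] (τ : D ≃ₐ[F] D)

/-- The type of pairs `(GL(W) × GL(W), ΔGL(W))` for a linear space `W` over a finite extension `D'`
of `D`. -/
def IsGLGL (Y : SymmetricPair F) : Prop :=
  ∃ (D' : Type u) (_ : Field D') (_ : Algebra F D') (_ : Algebra D D')
    (_ : IsScalarTower F D D') (_ : FiniteDimensional F D')
    (W : Type u) (_ : AddCommGroup W) (_ : Module D' W) (_ : FiniteDimensional D' W)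
    (_ : Module F W) (_ : IsScalarTower F D' W),
    Y = pairGLGL F D' W

variable {D}

/-- The type of pairs `(GL(W), U(W))` for a hermitian space `W` over a finite extension `(D', τ')`
of `(D, τ)`: `D'` is a field extension of `D` and `τ'` is an involution of `D'` which
extends `τ`. -/
def IsGLU (Y : SymmetricPair F) : Prop :=
  ∃ (D' : Type u) (_ : Field D') (_ : Algebra F D') (_ : Algebra D D')
    (_ : IsScalarTower F D D') (_ : FiniteDimensional F D') (τ' : D' ≃ₐ[F] D')
    (_ : ∀ d, τ' (τ' d) = d) (_ : ∀ d : D, τ' (algebraMap D D' d) = algebraMap D D' (τ d))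
    (W : Type u) (_ : AddCommGroup W) (_ : Module D' W) (_ : FiniteDimensional D' W)
    (_ : Module F W) (_ : IsScalarTower F D' W) (B : HermitianForm (τ' : D' →+* D') W),
    Y = pairGLU F τ' B

/-- The type of pairs `(U(W_{D'}), O(W))` for a quadratic space `W` over the fixed field
`L = D'^{τ'}` of a finite extension `(D', τ')` of `(D, τ)`. -/
def IsUO (Y : SymmetricPair F) : Prop :=
  ∃ (D' : Type u) (_ : Field D') (_ : Algebra F D') (_ : Algebra D D')
    (_ : IsScalarTower F D D') (_ : FiniteDimensional F D')
    (L : Type u) (_ : Field L) (_ : Algebra F L) (_ : Algebra L D') (_ : IsScalarTower F L D')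
    (τ' : D' ≃ₐ[L] D') (hτ' : ∀ d, τ' (τ' d) = d)
    (_ : ∀ d : D, τ' (algebraMap D D' d) = algebraMap D D' (τ d))
    (_ : ∀ d : D', τ' d = d → d ∈ Set.range (algebraMap L D'))
    (W : Type u) (_ : AddCommGroup W) (_ : Module L W) (_ : FiniteDimensional L W)
    (B : QuadraticSpaceForm L W),
    Y = pairUO F τ' hτ' B

end Types

open scoped TensorProduct Polynomial

/-! ## Rescaling of nilpotent endomorphisms of semisimple modules -/

/-! Let `E = End_K(V)` with `K = F` or `K = D`, let `a` be the adjoint of the form and let `x =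
s(g)`. Two facts give the theorem: a closed orbit forces `x` to be semisimple, and the centralizer
of a semisimple `x` breaks up over the maximal ideals of `K[x]`.

Semisimplicity. For `(GL, O)` and `(GL, U)` one has `x = g a(g)`, a symmetric element. Over the
algebraic closure write `x = s + n` (Jordan); `s` and `n` are polynomials in `x`, hence symmetric.
For `c ≠ 0` the nilpotent `n` is conjugate to `c n` by a unit commuting with `s`
(`Module.End.exists_unit_mul_eq_smul_mul`), and a polar decomposition turns the conjugating unit
into an isometry (`exists_isometry_conj`). If `ω` is a square root of `1 + (X - 1) x⁻¹ n`, the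
polynomial curve `c ↦ ω(c) g` has symmetrization `s + c n` (`exists_deformation`). It lies in `H g
H` for `c ≠ 0`, hence also at `c = 0` since the orbit is closed, so `x` is conjugate to `s`. For
`U(V_D)`, an idempotent of the base change of `D` identifies the unitary group with a general linear
group and `b` with the involution attached to the anti-involution `b ∘ a`; the same curve is carried
over by `toUnitary`.

Blocks. Now `C = K[x]` is a product of fields `C/m`, and the centralizer of `x` is `End_C(V)`, the
product of the algebras `End_{C/m}(V_m)`. The adjoint induces an involution `τ` of `C` which
permutes the ideals `m`. If `m` is fixed, the form on `V_m` is the trace of a hermitian form over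
`C/m`, and the block is a pair of the original kind; in the unitary case conjugation descends it to
the fixed field of the involution. If two ideals are exchanged, the two blocks are tied together by
the adjoint: they give `(GL × GL, ΔGL)`, or in the unitary case a single `GL` whose involution comes
from the symmetric form `β(c v, w)`, with `c` the conjugation of `V`. When `K = F`, `τ` fixes `F`
and `x`, so it is trivial and no exchange occurs. -/

theorem IsCompl.isCompl_sup_of_disjoint {α : Type*} [Lattice α] [BoundedOrder α]
    [IsModularLattice α] {a b c : α} (h : Disjoint a b) (hc : IsCompl (a ⊔ b) c) :
    IsCompl a (b ⊔ c) :=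
  ⟨h.disjoint_sup_right_of_disjoint_sup_left hc.disjoint,
    by rw [codisjoint_iff, ← sup_assoc]; exact hc.codisjoint.eq_top⟩

/-- A nilpotent endomorphism of a semisimple module is conjugate to each of its non-zero
multiples. -/
theorem Module.End.exists_unit_mul_eq_smul_mul {k S M : Type*} [Field k] [Ring S] [Algebra k S]
    [AddCommGroup M] [Module k M] [Module S M] [IsScalarTower k S M] [IsSemisimpleModule S M]
    [IsArtinian S M] (n : Module.End S M) (hn : IsNilpotent n) {c : k} (hc : c ≠ 0) :
    ∃ u : (Module.End S M)ˣ, (u : Module.End S M) * n = c • (n * u) := by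
  obtain ⟨N, hN⟩ := hn
  induction N generalizing M with
  | zero =>
    have : (1 : Module.End S M) = 0 := by simpa using hN
    refine ⟨1, ?_⟩
    have h0 : n = 0 := by rw [← one_mul n, this, zero_mul]
    simp [h0]
  | succ N ih =>
    -- An injective endomorphism of an artinian module is bijective, so injectivity of the
    -- intertwiner is all that has to be arranged.
    have key : ∀ v : Module.End S M, Function.Injective v → v * n = c • (n * v) →
        ∃ u : (Module.End S M)ˣ, (u : Module.End S M) * n = c • (n * u) := by
      intro v hv h
      have hu := (Module.End.isUnit_iff v).mpr
        ⟨hv, IsArtinian.surjective_of_injective_endomorphism v hv⟩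
      exact ⟨hu.unit, h⟩
    let R' := LinearMap.range n
    let Z := LinearMap.ker n
    let n' : Module.End S R' := n.restrict (fun v _ => ⟨v, rfl⟩)
    -- On the range of `n` the nilpotency index drops by one; the induction hypothesis supplies an
    -- intertwiner `u'` there, to be extended to `M`.
    have hn' : n' ^ N = 0 := by
      have hpow : ∀ (j : ℕ) (y : R'), ((n' ^ j) y : M) = (n ^ j) y := by
        intro j
        induction j with
        | zero => intro y; simp
        | succ j hj => intro y; rw [pow_succ, pow_succ]; exact hj (n' y)
      ext ⟨_, v, rfl⟩
      rw [hpow]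
      have := congrArg (fun f : Module.End S M => f v) hN
      rw [pow_succ] at this
      exact this
    obtain ⟨u', hu'⟩ := ih n' hn'
    obtain ⟨T, hT⟩ := exists_isCompl (R' ⊓ Z)
    let Z₁ := T ⊓ Z
    have hZ : Z = (R' ⊓ Z) ⊔ Z₁ := by
      change Z = (R' ⊓ Z) ⊔ (T ⊓ Z)
      rw [← sup_inf_assoc_of_le _ inf_le_right, hT.sup_eq_top, top_inf_eq]
    have hd : Disjoint R' Z₁ := by
      rw [disjoint_iff, eq_bot_iff, ← hT.inf_eq_bot]
      exact le_inf (le_inf inf_le_left (inf_le_right.trans inf_le_right))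
        (inf_le_right.trans inf_le_left)
    obtain ⟨C, hC⟩ := exists_isCompl (R' ⊔ Z₁)
    have h1 : IsCompl R' (Z₁ ⊔ C) := IsCompl.isCompl_sup_of_disjoint hd hC
    have h2 : IsCompl Z₁ (R' ⊔ C) :=
      IsCompl.isCompl_sup_of_disjoint hd.symm (by rwa [sup_comm])
    let p : M →ₗ[S] R' := R'.projectionOnto _ h1
    let q : M →ₗ[S] M := Z₁.projection _ h2
    -- Semisimplicity gives a section `g` of `n` over its range.
    obtain ⟨g, hg⟩ := IsSemisimpleModule.lifting_property n.rangeRestrict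
      n.surjective_rangeRestrict LinearMap.id
    have hg' : ∀ y : R', n (g y) = y := fun y =>
      congrArg Subtype.val (congrArg (fun f : R' →ₗ[S] R' => f y) hg)
    -- The defect `c⁻¹ u' n - n u' p` of the extension `u' p`. It vanishes on the range of `n` by
    -- the choice of `u'`, and on `Z₁` because `n` and `p` do.
    let d : M →ₗ[S] R' :=
      c⁻¹ • ((u' : Module.End S R') ∘ₗ n.rangeRestrict) - n' ∘ₗ (u' : Module.End S R') ∘ₗ p
    have hu'' : ∀ y, (u' : Module.End S R') (n' y) = c • n' ((u' : Module.End S R') y) :=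
      fun y => congrArg (fun f : Module.End S R' => f y) hu'
    have hinj : Function.Injective (u' : Module.End S R') :=
      ((Module.End.isUnit_iff _).mp u'.isUnit).1
    have hpR : ∀ y : R', p y = y := fun y => Submodule.projectionOnto_apply_left h1 y
    have hn'R : ∀ y : R', n.rangeRestrict y = n' y := fun y => rfl
    have hdR : ∀ y : R', d y = 0 := by
      intro y
      change c⁻¹ • (u' : Module.End S R') (n.rangeRestrict y) - n' ((u' : Module.End S R') (p y)) = 0
      rw [hn'R, hu'', hpR, smul_smul, inv_mul_cancel₀ hc, one_smul, sub_self]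
    have hdZ : ∀ z ∈ Z₁, d z = 0 := by
      intro z hz
      have hz1 : p z = 0 := (Submodule.projectionOnto_apply_eq_zero_iff h1).mpr
        (Submodule.mem_sup_left hz)
      have hz2 : n.rangeRestrict z = 0 := Subtype.ext (LinearMap.mem_ker.mp hz.2)
      change c⁻¹ • (u' : Module.End S R') (n.rangeRestrict z) -
        n' ((u' : Module.End S R') (p z)) = 0
      rw [hz1, hz2]; simp
    -- `g ∘ d` cancels the defect, so that `n v = c⁻¹ u' n`. The projection `q` onto the kernel
    -- vectors outside the range does not affect `n v` and makes `v` injective on the kernel of `n`.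
    let v : Module.End S M := R'.subtype ∘ₗ (u' : Module.End S R') ∘ₗ p + g ∘ₗ d + q
    have hq : ∀ x, n (q x) = 0 := fun x =>
      LinearMap.mem_ker.mp (Submodule.projection_apply_mem h2 x).2
    have hnv : ∀ x, n (v x) = c⁻¹ • ((u' : Module.End S R') (n.rangeRestrict x) : M) := by
      intro x
      change n (((u' : Module.End S R') (p x) : M) + g (d x) + q x) = _
      rw [map_add, map_add, hq, hg', add_zero]
      change n ((u' : Module.End S R') (p x) : M) + ((c⁻¹ • (u' : Module.End S R')
        (n.rangeRestrict x) - n' ((u' : Module.End S R') (p x)) : R') : M) = _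
      rw [Submodule.coe_sub]
      change n ((u' : Module.End S R') (p x) : M) + (_ - n ((u' : Module.End S R') (p x) : M)) = _
      simp
    refine key v ?_ ?_
    · rw [← LinearMap.ker_eq_bot, eq_bot_iff]
      intro x hx
      rw [LinearMap.mem_ker] at hx
      have h3 := hnv x
      rw [hx, map_zero] at h3
      have h4 : n.rangeRestrict x = 0 := by
        apply hinj
        rw [map_zero]
        apply Subtype.ext
        have := congrArg (fun y => c • y) h3
        simpa [smul_smul, hc] using this.symm
      have hxZ : x ∈ Z := congrArg Subtype.val h4
      rw [hZ] at hxZ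
      obtain ⟨m, hm, z, hz, rfl⟩ := Submodule.mem_sup.mp hxZ
      have hm' : p m = ⟨m, hm.1⟩ := hpR ⟨m, hm.1⟩
      have hz' : p z = 0 := (Submodule.projectionOnto_apply_eq_zero_iff h1).mpr
        (Submodule.mem_sup_left hz)
      have hqm : q m = 0 := (Submodule.projection_apply_eq_zero_iff h2).mpr
        (Submodule.mem_sup_left hm.1)
      have hqz : q z = z := Submodule.projection_apply_left h2 ⟨z, hz⟩
      have h5 : ((u' : Module.End S R') ⟨m, hm.1⟩ : M) + z = 0 := by
        have : v (m + z) = ((u' : Module.End S R') (p (m + z)) : M) + g (d (m + z)) + q (m + z) :=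
          rfl
        rw [this, map_add p, map_add d, map_add q, hm', hz', hqm, hqz, hdZ z hz,
          hdR ⟨m, hm.1⟩] at hx
        simpa using hx
      have hz0 : z = 0 := by
        refine (Submodule.disjoint_def.mp hd) z ?_ hz
        rw [← neg_eq_of_add_eq_zero_right h5]
        exact R'.neg_mem (Subtype.property _)
      rw [hz0, add_zero] at h5
      have : (⟨m, hm.1⟩ : R') = 0 := hinj (by rw [map_zero]; exact Subtype.ext h5)
      rw [hz0, show m = 0 from congrArg Subtype.val this]
      simp
    · ext x
      change v (n x) = c • n (v x)
      rw [hnv, smul_smul, mul_inv_cancel₀ hc, one_smul]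
      have : v (n x) = ((u' : Module.End S R') (p (n x)) : M) + g (d (n x)) + q (n x) := rfl
      have hdn : d (n x) = 0 := hdR (n.rangeRestrict x)
      rw [this, hdn, (Submodule.projection_apply_eq_zero_iff h2).mpr
        (Submodule.mem_sup_left ⟨x, rfl⟩), map_zero, add_zero, add_zero]
      exact congrArg (fun y => ((u' : Module.End S R') y : M)) (hpR (n.rangeRestrict x))

/-! ## Reduced algebras over perfect fields -/

/-- Such an algebra is a finite product of finite field extensions, all separable because `k` is
perfect. -/
theorem Algebra.FormallyUnramified.of_isReduced (k A : Type u) [Field k] [PerfectField k]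
    [CommRing A] [Algebra k A] [Module.Finite k A] [IsReduced A] :
    Algebra.FormallyUnramified k A := by
  have : IsArtinianRing A := .of_finite k A
  let _ (m : MaximalSpectrum A) : Field (A ⧸ m.asIdeal) := Ideal.Quotient.field m.asIdeal
  have (m : MaximalSpectrum A) : Algebra.FormallyEtale k (A ⧸ m.asIdeal) := by
    have : Module.Finite k (A ⧸ m.asIdeal) := inferInstance
    have : Algebra.IsAlgebraic k (A ⧸ m.asIdeal) := Algebra.IsAlgebraic.of_finite _ _
    exact Algebra.FormallyEtale.of_isSeparable _ _
  have : Algebra.FormallyEtale k (∀ m : MaximalSpectrum A, A ⧸ m.asIdeal) :=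
    (Algebra.FormallyEtale.pi_iff _).mpr this
  exact Algebra.FormallyUnramified.of_equiv ((IsArtinianRing.equivPi A).restrictScalars k).symm

/-- Unlike reducedness, being unramified passes to tensor products and quotients; for finite
algebras over a perfect field the two notions agree. -/
theorem isReduced_of_surjective_tensorProduct (k A B C : Type u) [Field k] [PerfectField k]
    [CommRing A] [Algebra k A] [Module.Finite k A] [IsReduced A]
    [CommRing B] [Algebra k B] [Module.Finite k B] [IsReduced B]
    [CommRing C] [Algebra k C] (f : A ⊗[k] B →ₐ[k] C) (hf : Function.Surjective f) :
    IsReduced C := by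
  have := Algebra.FormallyUnramified.of_isReduced k A
  have := Algebra.FormallyUnramified.of_isReduced k B
  have : Algebra.FormallyUnramified k (A ⊗[k] B) := Algebra.FormallyUnramified.comp k A (A ⊗[k] B)
  have := Algebra.FormallyUnramified.of_surjective f hf
  have : Module.Finite k C := Module.Finite.of_surjective f.toLinearMap hf
  exact Algebra.FormallyUnramified.isReduced_of_field k C

/-! ## Elements which generate a reduced algebra -/

section Reduced

open scoped IsMulCommutative

variable {k A : Type u} [Field k] [Ring A] [Algebra k A]

/-- Semisimplicity of `s` is expressed throughout by reducedness of `R[s]`. In this polynomial form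
it is easily carried along injective homomorphisms. -/
theorem isReduced_adjoin_singleton_iff {R B : Type*} [CommRing R] [Ring B] [Algebra R B] (s : B) :
    IsReduced (Algebra.adjoin R {s}) ↔
      ∀ p : R[X], IsNilpotent (Polynomial.aeval s p) → Polynomial.aeval s p = 0 := by
  constructor
  · intro h p hp
    have hmem : Polynomial.aeval s p ∈ Algebra.adjoin R {s} :=
      Polynomial.aeval_mem_adjoin_singleton R s
    have : IsNilpotent (⟨_, hmem⟩ : Algebra.adjoin R {s}) := by
      obtain ⟨m, hm⟩ := hp
      exact ⟨m, Subtype.ext hm⟩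
    exact congrArg Subtype.val this.eq_zero
  · refine fun h => ⟨fun ⟨y, hy⟩ hn => ?_⟩
    rw [Algebra.adjoin_singleton_eq_range_aeval] at hy
    obtain ⟨p, rfl⟩ := hy
    refine Subtype.ext (h p ?_)
    obtain ⟨m, hm⟩ := hn
    exact ⟨m, congrArg Subtype.val hm⟩

theorem isReduced_of_adjoin_range_eq_top (k C : Type u) [Field k] [PerfectField k]
    [CommRing C] [Algebra k C] [Module.Finite k C] [IsReduced C] {S₀ S : Type u} [CommRing S₀]
    [Algebra k S₀] [Module.Finite k S₀] [IsReduced S₀] [CommRing S] [Algebra k S] [Algebra C S]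
    [IsScalarTower k C S] (f : S₀ →ₐ[k] S) (hf : Algebra.adjoin C (Set.range f) = ⊤) :
    IsReduced S := by
  refine isReduced_of_surjective_tensorProduct k S₀ C _
    (Algebra.TensorProduct.productMap f (IsScalarTower.toAlgHom k C S)) fun y => ?_
  have hy : y ∈ Algebra.adjoin C (Set.range f) := hf ▸ Algebra.mem_top
  induction hy using Algebra.adjoin_induction with
  | mem x hx =>
    obtain ⟨t, rfl⟩ := hx
    exact ⟨t ⊗ₜ 1, by simp⟩
  | algebraMap r => exact ⟨1 ⊗ₜ r, by simp⟩
  | add x y _ _ hx hy =>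
    obtain ⟨a, rfl⟩ := hx
    obtain ⟨b, rfl⟩ := hy
    exact ⟨a + b, map_add _ _ _⟩
  | mul x y _ _ hx hy =>
    obtain ⟨a, rfl⟩ := hx
    obtain ⟨b, rfl⟩ := hy
    exact ⟨a * b, map_mul _ _ _⟩

/-- `C[s]` is a quotient of `k[s] ⊗ C`, a tensor product of reduced finite algebras over a perfect
field. -/
theorem isReduced_adjoin_singleton_extend (k C B : Type u) [Field k] [PerfectField k]
    [CommRing C] [Algebra k C] [Module.Finite k C] [IsReduced C] [Ring B] [Algebra k B]
    [Algebra C B] [IsScalarTower k C B] [Module.Finite k B] (s : B)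
    [IsReduced (Algebra.adjoin k {s})] : IsReduced (Algebra.adjoin C {s}) := by
  have hle : ∀ y ∈ Algebra.adjoin k {s}, y ∈ Algebra.adjoin C {s} := by
    intro y hy
    exact (Algebra.adjoin_le (S := (Algebra.adjoin C {s}).restrictScalars k)
      (Set.singleton_subset_iff.mpr (Algebra.self_mem_adjoin_singleton C s))) hy
  let f : Algebra.adjoin k {s} →ₐ[k] Algebra.adjoin C {s} :=
    (Algebra.adjoin k {s}).val.codRestrict ((Algebra.adjoin C {s}).restrictScalars k)
      fun y => hle y y.2
  refine isReduced_of_adjoin_range_eq_top k C f (top_le_iff.mp ?_)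
  rw [← Algebra.adjoin_adjoin_coe_preimage (R := C) (s := {s})]
  refine Algebra.adjoin_mono ?_
  rintro ⟨y, hy⟩ hys
  exact ⟨⟨s, Algebra.self_mem_adjoin_singleton k s⟩, Subtype.ext (Set.mem_singleton_iff.mp hys).symm⟩

/-- In an algebra of endomorphisms over an étale algebra, a nilpotent element which commutes with a
semisimple element is conjugate to its multiples by the centralizer of the latter. -/
theorem Module.End.exists_unit_commute_rescale {k C M : Type u} [Field k] [PerfectField k]
    [CommRing C] [Algebra k C] [Module.Finite k C] [IsReduced C] [AddCommGroup M] [Module C M]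
    [Module k M] [IsScalarTower k C M] [Module.Finite C M] [Module.Finite k (Module.End C M)]
    (s n : Module.End C M)
    (hs : IsReduced (Algebra.adjoin k {s})) (hsn : Commute s n) (hn : IsNilpotent n)
    {c : k} (hc : c ≠ 0) :
    ∃ u : (Module.End C M)ˣ, (u : Module.End C M) * s = s * u ∧
      (u : Module.End C M) * n = c • (n * u) := by
  have hred : IsReduced (Algebra.adjoin C {s}) :=
    isReduced_adjoin_singleton_extend k C _ s
  -- `S = C[s]` is reduced and artinian, hence semisimple, so `M` is a semisimple `S`-module on
  -- which `n` acts linearly. A unit of `End_S(M)` is a unit of `End_C(M)` that commutes with `s`.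
  let S := Algebra.adjoin C {s}
  have hfin : Module.Finite k S :=
    Module.Finite.of_injective ((S.restrictScalars k).val.toLinearMap) Subtype.val_injective
  have : IsArtinianRing S := .of_finite k S
  have : IsSemisimpleRing S := IsArtinianRing.isSemisimpleRing_of_isReduced S
  have : Module.Finite S M := Module.Finite.of_restrictScalars_finite C S M
  have : IsScalarTower k S M := ⟨fun a b m => by
    change ((a • b : S) : Module.End C M) m = a • (b : Module.End C M) m
    rfl⟩
  let n' : Module.End S M :=
    { toFun := n
      map_add' := map_add n
      map_smul' := fun t m => by
        have : Commute (t : Module.End C M) n := by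
          have h := Algebra.adjoin_le_centralizer_centralizer C {s} t.2
          rw [Subalgebra.mem_centralizer_iff] at h
          exact (h n (by rw [SetLike.mem_coe, Subalgebra.mem_centralizer_iff]; rintro _ rfl; exact hsn)).symm
        exact (congrArg (fun f : Module.End C M => f m) this).symm }
  have hn' : IsNilpotent n' := by
    obtain ⟨m, hm⟩ := hn
    refine ⟨m, ?_⟩
    have hpow : ∀ (j : ℕ) (y : M), (n' ^ j) y = (n ^ j) y := by
      intro j
      induction j with
      | zero => intro y; simp
      | succ j hj => intro y; rw [pow_succ, pow_succ]; exact hj (n' y)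
    ext y
    rw [hpow, hm]; rfl
  obtain ⟨u, hu⟩ := Module.End.exists_unit_mul_eq_smul_mul n' hn' hc
  let r : Module.End S M →* Module.End C M :=
    { toFun := fun f => f.restrictScalars C
      map_one' := rfl
      map_mul' := fun _ _ => rfl }
  refine ⟨Units.map r u, ?_, ?_⟩
  · ext m
    exact (u : Module.End S M).map_smul (⟨s, Algebra.self_mem_adjoin_singleton C s⟩ : S) m
  · ext m
    exact congrArg (fun f : Module.End S M => f m) hu

end Reduced

/-! ## Jordan decomposition and square roots in finite dimensional algebras -/

section Algebras

open scoped IsMulCommutative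

variable {k A : Type u} [Field k] [Ring A] [Algebra k A]

theorem exists_aeval_of_mem_adjoin_singleton {R B : Type*} [CommRing R] [Ring B] [Algebra R B]
    {x y : B} (h : y ∈ Algebra.adjoin R {x}) : ∃ p : R[X], Polynomial.aeval x p = y := by
  rw [Algebra.adjoin_singleton_eq_range_aeval] at h
  exact h

/-- The Jordan decomposition in a finite dimensional algebra. -/
theorem exists_isNilpotent_isReduced_adjoin [PerfectField k] [Module.Finite k A] (x : A) :
    ∃ n s : A, n ∈ Algebra.adjoin k {x} ∧ s ∈ Algebra.adjoin k {x} ∧ IsNilpotent n ∧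
      IsReduced (Algebra.adjoin k {s}) ∧ x = s + n := by
  have hinj : Function.Injective (Algebra.lmul k A) := fun a b h => by
    simpa using congrArg (fun f : Module.End k A => f 1) h
  -- The left regular representation is faithful, and both parts are polynomials in the given
  -- element, so the decomposition of left multiplication comes from one in `A`.
  obtain ⟨n', hn', s', hs', hn, hs, h⟩ :=
    (Algebra.lmul k A x).exists_isNilpotent_isSemisimple
  obtain ⟨p, rfl⟩ := exists_aeval_of_mem_adjoin_singleton hn'
  obtain ⟨q, rfl⟩ := exists_aeval_of_mem_adjoin_singleton hs'
  rw [Polynomial.aeval_algHom_apply] at hn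
  rw [Polynomial.aeval_algHom_apply] at hs
  rw [Polynomial.aeval_algHom_apply, Polynomial.aeval_algHom_apply, ← map_add] at h
  refine ⟨Polynomial.aeval x p, Polynomial.aeval x q, Polynomial.aeval_mem_adjoin_singleton _ _,
    Polynomial.aeval_mem_adjoin_singleton _ _, (IsNilpotent.map_iff hinj).mp hn, ?_, ?_⟩
  · refine (isReduced_adjoin_singleton_iff _).mpr fun f hf => hinj ?_
    rw [map_zero, ← Polynomial.aeval_algHom_apply]
    refine Module.End.eq_zero_of_isNilpotent_isSemisimple ?_ (hs.aeval f)
    rw [Polynomial.aeval_algHom_apply]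
    exact hf.map _
  · rw [add_comm]; exact hinj h

/-- Newton's method for `X² - q` started at `z`: the derivative `2 z` is a unit and the initial
error is nilpotent. -/
theorem exists_sq_eq_of_isNilpotent_sub {S : Type*} [CommRing S] (h2 : IsUnit (2 : S)) {q z : S}
    (hz : IsUnit z) (h : IsNilpotent (z ^ 2 - q)) : ∃ r : S, r ^ 2 = q := by
  obtain ⟨r, hr, -⟩ := Polynomial.existsUnique_nilpotent_sub_and_aeval_eq_zero
    (P := (Polynomial.X ^ 2 - Polynomial.C q : S[X])) (x := z) (by simpa using h)
    (by simpa [one_add_one_eq_two] using h2.mul hz)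
  exact ⟨r, by simpa [sub_eq_zero] using hr.2⟩

theorem exists_mem_adjoin_sq_eq_one_add [CharZero k] {z : A} (hz : IsNilpotent z) :
    ∃ r ∈ Algebra.adjoin k {z}, r ^ 2 = 1 + z := by
  let z' : Algebra.adjoin k {z} := ⟨z, Algebra.self_mem_adjoin_singleton k z⟩
  have hz' : IsNilpotent z' := by
    obtain ⟨m, hm⟩ := hz
    exact ⟨m, Subtype.ext hm⟩
  have h2 : IsUnit (2 : Algebra.adjoin k {z}) := by
    have := (IsUnit.mk0 (2 : k) two_ne_zero).map (algebraMap k (Algebra.adjoin k {z}))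
    rwa [map_ofNat] at this
  obtain ⟨r, hr⟩ := exists_sq_eq_of_isNilpotent_sub h2 (q := 1 + z') (z := 1) isUnit_one (by
    have : (1 : Algebra.adjoin k {z}) ^ 2 - (1 + z') = -z' := by ring
    rw [this]
    exact hz'.neg)
  exact ⟨r, r.2, congrArg Subtype.val hr⟩

theorem Polynomial.dvd_pow_natDegree_of_roots {K : Type*} [Field K] [IsAlgClosed K] {m f : K[X]}
    (hm : m ≠ 0) (h : ∀ a, m.IsRoot a → f.IsRoot a) : m ∣ f ^ m.natDegree := by
  have hs := IsAlgClosed.splits m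
  rw [hs.natDegree_eq_card_roots]
  conv_lhs => rw [hs.eq_prod_roots]
  rw [(IsUnit.map Polynomial.C (IsUnit.mk0 _
    (Polynomial.leadingCoeff_ne_zero.mpr hm))).mul_left_dvd]
  have : ∀ s : Multiset K, (∀ a ∈ s, f.IsRoot a) →
      (s.map fun a => Polynomial.X - Polynomial.C a).prod ∣ f ^ s.card := by
    intro s
    induction s using Multiset.induction with
    | empty => simp
    | cons a s ih =>
      intro hs
      rw [Multiset.map_cons, Multiset.prod_cons, Multiset.card_cons, pow_succ']
      exact mul_dvd_mul (Polynomial.dvd_iff_isRoot.mpr (hs a (Multiset.mem_cons_self a s)))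
        (ih fun b hb => hs b (Multiset.mem_cons_of_mem hb))
  exact this _ fun a ha => h a (Polynomial.isRoot_of_mem_roots ha)

/-- A unit of `A` is a non-zero-divisor of the artinian ring `k[q]`, hence a unit already there. -/
theorem isUnit_adjoin_singleton_self [Module.Finite k A] {q : A} (hq : IsUnit q) :
    IsUnit (⟨q, Algebra.self_mem_adjoin_singleton k q⟩ : Algebra.adjoin k {q}) := by
  have : Module.Finite k (Algebra.adjoin k {q}) :=
    Module.Finite.of_injective (Algebra.adjoin k {q}).val.toLinearMap Subtype.val_injective
  have : IsArtinianRing (Algebra.adjoin k {q}) := .of_finite k _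
  refine IsArtinianRing.isUnit_of_mem_nonZeroDivisors ?_
  rw [mem_nonZeroDivisors_iff_right]
  intro y hy
  have : (y : A) * q = 0 := congrArg Subtype.val hy
  exact Subtype.ext (hq.mul_left_eq_zero.mp this)

theorem Units.inv_mem_adjoin_singleton [Module.Finite k A] (q : Aˣ) :
    ((q⁻¹ : Aˣ) : A) ∈ Algebra.adjoin k {(q : A)} := by
  obtain ⟨v, hv⟩ := isUnit_adjoin_singleton_self (k := k) q.isUnit
  have h1 : (q : A) * ((v⁻¹ : (Algebra.adjoin k {(q : A)})ˣ) : Algebra.adjoin k {(q : A)}) = 1 := by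
    have := congrArg Subtype.val v.mul_inv
    rwa [hv] at this
  rw [Units.inv_eq_of_mul_eq_one_right h1]
  exact Subtype.property _

/-- Interpolating square roots of the roots of the minimal polynomial gives `P` with `P(q)² - q`
nilpotent, which Newton's method corrects. It is essential that the root is a polynomial in `q`: it
inherits symmetry from `q` and commutes with whatever `q` commutes with. -/
theorem exists_mem_adjoin_sq_eq [CharZero k] [IsAlgClosed k] [Module.Finite k A] {q : A}
    (hq : IsUnit q) : ∃ r ∈ Algebra.adjoin k {q}, r ^ 2 = q := by
  classical
  let S := Algebra.adjoin k {q}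
  let q' : S := ⟨q, Algebra.self_mem_adjoin_singleton k q⟩
  have : Module.Finite k S :=
    Module.Finite.of_injective S.val.toLinearMap Subtype.val_injective
  have hq' : IsUnit q' := isUnit_adjoin_singleton_self hq
  have h2 : IsUnit (2 : S) := by
    have := (IsUnit.mk0 (2 : k) two_ne_zero).map (algebraMap k S)
    rwa [map_ofNat] at this
  choose f hf using fun a : k => IsAlgClosed.exists_pow_nat_eq a (n := 2) two_pos
  let m := minpoly k q'
  have hm : m ≠ 0 := minpoly.ne_zero (IsIntegral.of_finite k q')
  let P := Lagrange.interpolate m.roots.toFinset id f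
  have hdvd := Polynomial.dvd_pow_natDegree_of_roots (f := P ^ 2 - Polynomial.X) hm fun a ha => by
    have hP : P.eval a = f a := Lagrange.eval_interpolate_at_node f
      (Function.injective_id.injOn) (Multiset.mem_toFinset.mpr ((Polynomial.mem_roots hm).mpr ha))
    simp [hP, hf]
  have hnil : IsNilpotent (Polynomial.aeval q' P ^ 2 - q') := by
    refine ⟨m.natDegree, ?_⟩
    have := Polynomial.aeval_eq_zero_of_dvd_aeval_eq_zero hdvd (minpoly.aeval k q')
    simpa using this
  have hu : IsUnit (Polynomial.aeval q' P) := by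
    refine isUnit_of_mul_isUnit_left (y := Polynomial.aeval q' P) ?_
    have := hnil.isUnit_add_left_of_commute hq' (Commute.all _ _)
    rwa [add_sub_cancel, sq] at this
  obtain ⟨r, hr⟩ := exists_sq_eq_of_isNilpotent_sub h2 hu hnil
  exact ⟨r, r.2, congrArg Subtype.val hr⟩

/-- In `k ⊗ End_K(V)` a nilpotent element which commutes with a semisimple element is conjugate to
its multiples by the centralizer of the latter. -/
theorem exists_unit_commute_rescale_tensor_end {F K V : Type u} [Field F] [CharZero F]
    [PerfectField k] [Algebra F k] [Field K] [Algebra F K] [FiniteDimensional F K]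
    [AddCommGroup V] [Module K V] [FiniteDimensional K V] [Module F V] [IsScalarTower F K V]
    (s n : k ⊗[F] Module.End K V) (hs : IsReduced (Algebra.adjoin k {s})) (hsn : Commute s n)
    (hn : IsNilpotent n) {c : k} (hc : c ≠ 0) :
    ∃ u : (k ⊗[F] Module.End K V)ˣ, (u : k ⊗[F] Module.End K V) * s = s * u ∧
      (u : k ⊗[F] Module.End K V) * n = c • (n * u) := by
  -- After base change `End_K(V)` becomes a matrix algebra over `C`, in general not a field but
  -- reduced since `K/F` is separable. The factor `Unit` below is the size of the `1 × 1` matrices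
  -- with which `k` is identified.
  let C := k ⊗[F] K
  have : Algebra.FormallyUnramified F K := .of_isReduced F K
  have : Algebra.FormallyUnramified k C := inferInstance
  have : IsReduced C := Algebra.FormallyUnramified.isReduced_of_field k C
  let ι := Fin (Module.finrank K V)
  let e₁ : Module.End K V ≃ₐ[F] Matrix ι ι K :=
    (algEquivMatrix (Module.finBasis K V)).restrictScalars F
  let e : k ⊗[F] Module.End K V ≃ₐ[k] Module.End C (Unit × ι → C) :=
    (((Algebra.TensorProduct.congr (Matrix.uniqueAlgEquiv (m := Unit) (R := k)).symm e₁).trans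
      (Matrix.kroneckerTMulAlgEquiv Unit ι F k k K)).trans
      ((Matrix.toLinAlgEquiv' (R := C) (n := Unit × ι)).restrictScalars k))
  have hs' : IsReduced (Algebra.adjoin k {e s}) := by
    rw [isReduced_adjoin_singleton_iff] at hs ⊢
    intro p hp
    rw [← AlgEquiv.coe_toAlgHom, Polynomial.aeval_algHom_apply] at hp ⊢
    rw [hs p ((IsNilpotent.map_iff e.injective).mp hp), map_zero]
  have : Module.Finite k (Module.End C (Unit × ι → C)) := by
    have : Module.Finite F (Module.End K V) := Module.Finite.trans K _
    exact Module.Finite.equiv e.toLinearEquiv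
  obtain ⟨u, h1, h2⟩ := Module.End.exists_unit_commute_rescale (k := k) (e s) (e n) hs'
    (hsn.map e) (hn.map e) hc
  refine ⟨Units.map (e.symm : _ →* _) u, e.injective ?_, e.injective ?_⟩
  · simpa using h1
  · simpa using h2

end Algebras

/-! ## Deformation of symmetric elements to their semisimple parts -/

section AntiHom

variable {k A : Type u} [Field k] [Ring A] [Algebra k A]

theorem map_aeval_of_map_mul_rev {R B : Type*} [CommRing R] [Ring B] [Algebra R B]
    (S : B →ₗ[R] B) (hS : ∀ x y, S (x * y) = S y * S x) (h1 : S 1 = 1) (x : B) (p : R[X]) :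
    S (Polynomial.aeval x p) = Polynomial.aeval (S x) p := by
  have hpow : ∀ m : ℕ, S (x ^ m) = S x ^ m := by
    intro m
    induction m with
    | zero => simpa using h1
    | succ m ih => rw [pow_succ, hS, ih, pow_succ']
  induction p using Polynomial.induction_on' with
  | add p q hp hq => rw [map_add, map_add, hp, hq, map_add]
  | monomial m a => rw [Polynomial.aeval_monomial, Polynomial.aeval_monomial, ← Algebra.smul_def,
      ← Algebra.smul_def, map_smul, hpow]

theorem commute_of_mem_adjoin_singleton {R B : Type*} [CommRing R] [Ring B] [Algebra R B]
    {x y z : B} (hy : y ∈ Algebra.adjoin R {x}) (h : Commute x z) : Commute y z := by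
  have h1 := Algebra.adjoin_le_centralizer_centralizer R {x} hy
  rw [Subalgebra.mem_centralizer_iff] at h1
  refine (h1 z ?_).symm
  rw [SetLike.mem_coe, Subalgebra.mem_centralizer_iff]
  rintro _ rfl
  exact h

/-- If two symmetric elements are conjugate, then they are conjugate by an isometry. -/
theorem exists_isometry_conj [CharZero k] [IsAlgClosed k] [Module.Finite k A] (S : A →ₗ[k] A)
    (hS : ∀ x y, S (x * y) = S y * S x) (h1 : S 1 = 1) (hSS : ∀ x, S (S x) = x) {x y : A}
    (hx : S x = x) (hy : S y = y) (u : Aˣ) (hu : u * x = y * u) :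
    ∃ h : Aˣ, S h * h = 1 ∧ h * x = y * h := by
  have hSu : IsUnit (S u) := by
    refine ⟨⟨S u, S (u⁻¹ : Aˣ), ?_, ?_⟩, rfl⟩ <;> rw [← hS] <;> simp [h1]
  have hq : IsUnit (S u * u) := hSu.mul u.isUnit
  obtain ⟨r, hr, hrq⟩ := exists_mem_adjoin_sq_eq (k := k) hq
  have hru : IsUnit r := by
    rw [sq] at hrq
    have hc : Commute r r := rfl
    exact (hc.isUnit_mul_iff.mp (hrq ▸ hq)).1
  have hqx : Commute (S u * u) x := by
    have : S u * y = x * S u := by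
      conv_lhs => rw [← hy]
      rw [← hS, ← hu, hS, hx]
    change S u * u * x = x * (S u * u)
    rw [mul_assoc, hu, ← mul_assoc, this, mul_assoc]
  have hrx : Commute r x := commute_of_mem_adjoin_singleton hr hqx
  have hSr : S r = r := by
    obtain ⟨p, rfl⟩ := exists_aeval_of_mem_adjoin_singleton hr
    rw [map_aeval_of_map_mul_rev S hS h1, hS, hSS]
  obtain ⟨v, rfl⟩ := hru
  have hSv : S (v⁻¹ : Aˣ) = (v⁻¹ : Aˣ) := by
    have : S (v⁻¹ : Aˣ) * v = 1 := by
      conv_lhs => rw [← hSr]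
      rw [← hS]; simp [h1]
    exact Units.eq_inv_of_mul_eq_one_right this
  refine ⟨u * v⁻¹, ?_, ?_⟩
  · rw [Units.val_mul, hS, hSv, mul_assoc, ← mul_assoc (S u), ← hrq, sq]
    simp
  · have : Commute ((v⁻¹ : Aˣ) : A) x := Commute.units_inv_left hrx
    rw [Units.val_mul, mul_assoc, this.eq, ← mul_assoc, hu, mul_assoc]

-- In the commutative algebra `k[x]` the difference `f(x) - f(s)` is nilpotent because `x - s` is.
-- Hence `f(s)` is nilpotent along with `f(x)`, and it lies in the reduced algebra `k[s]`.
open scoped IsMulCommutative in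
theorem aeval_eq_zero_of_isReduced {x s n : A} (hs : s ∈ Algebra.adjoin k {x})
    (hn : IsNilpotent n) (hred : IsReduced (Algebra.adjoin k {s})) (h : x = s + n) (f : k[X])
    (hf : IsNilpotent (Polynomial.aeval x f)) : Polynomial.aeval s f = 0 := by
  let T := Algebra.adjoin k {x}
  let x' : T := ⟨x, Algebra.self_mem_adjoin_singleton k x⟩
  let s' : T := ⟨s, hs⟩
  have hx : (Polynomial.aeval x' f : A) = Polynomial.aeval x f :=
    (Polynomial.aeval_algHom_apply T.val x' f).symm
  have hs : (Polynomial.aeval s' f : A) = Polynomial.aeval s f :=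
    (Polynomial.aeval_algHom_apply T.val s' f).symm
  have hn' : IsNilpotent (x' - s') := by
    refine (IsNilpotent.map_iff (f := T.val) Subtype.val_injective).mp ?_
    change IsNilpotent (x - s)
    rwa [h, add_sub_cancel_left]
  have h1 := Polynomial.isNilpotent_aeval_sub_of_isNilpotent_sub f hn'
  have h2 : IsNilpotent (Polynomial.aeval x' f) :=
    (IsNilpotent.map_iff (f := T.val) Subtype.val_injective).mp (by rwa [← hx] at hf)
  have h3 : IsNilpotent (Polynomial.aeval s' f) := by
    have := (Commute.all _ _).isNilpotent_sub h2 h1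
    rwa [sub_sub_cancel] at this
  refine (isReduced_adjoin_singleton_iff s).mp hred f ?_
  rw [← hs]
  exact h3.map T.val

end AntiHom

section Deformation

variable {F E : Type u} [Field F] [Ring E] [Algebra F E]

namespace AntiInvolution

variable (a : AntiInvolution F E) (R : Type u) [CommRing R] [Algebra F R]

theorem ext_aeval (x : R ⊗[F] E) (p : F[X]) :
    a.ext R (Polynomial.aeval x p) = Polynomial.aeval (a.ext R x) p :=
  map_aeval_of_map_mul_rev ((a.ext R).restrictScalars F) (a.ext_mul R) (a.ext_one R) x p

theorem ext_inv {x : (R ⊗[F] E)ˣ} (hx : a.ext R x = x) :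
    a.ext R (x⁻¹ : (R ⊗[F] E)ˣ) = (x⁻¹ : (R ⊗[F] E)ˣ) := by
  have : a.ext R (x⁻¹ : (R ⊗[F] E)ˣ) * x = 1 := by
    conv_lhs => rw [← hx]
    rw [← a.ext_mul, Units.mul_inv, a.ext_one]
  exact Units.eq_inv_of_mul_eq_one_right this

end AntiInvolution

theorem unitsMap_ofId (x : (F ⊗[F] E)ˣ) {R S : Type u} [CommRing R] [Algebra F R]
    [CommRing S] [Algebra F S] (φ : R →ₐ[F] S) :
    unitsMap E φ (unitsMap E (Algebra.ofId F R) x) = unitsMap E (Algebra.ofId F S) x := by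
  rw [← unitsMap_comp, Subsingleton.elim (φ.comp (Algebra.ofId F R)) (Algebra.ofId F S)]

/-- Evaluation of polynomials over an extension `k` of `F`, as a map of `F`-algebras. -/
noncomputable def evalHom (F : Type u) [Field F] {k : Type u} [Field k] [Algebra F k] (c : k) :
    k[X] →ₐ[F] k :=
  (Polynomial.aeval c).restrictScalars F

/-- A nilpotent element commuting with a semisimple element is conjugate to its multiples by the
centralizer of the latter. -/
def HasRescaling (k A : Type u) [Field k] [Ring A] [Algebra k A] : Prop :=
  ∀ s n : A, IsReduced (Algebra.adjoin k {s}) → Commute s n → IsNilpotent n → ∀ c : k, c ≠ 0 →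
    ∃ u : Aˣ, (u : A) * s = s * u ∧ (u : A) * n = c • (n * u)

theorem map_smul_tensor {R S : Type u} [CommRing R] [Algebra F R] [CommRing S] [Algebra F S]
    (φ : R →ₐ[F] S) (t : R) (y : R ⊗[F] E) :
    Algebra.TensorProduct.map φ (AlgHom.id F E) (t • y) =
      φ t • Algebra.TensorProduct.map φ (AlgHom.id F E) y := by
  rw [Algebra.smul_def, map_mul, Algebra.smul_def]
  simp [Algebra.TensorProduct.algebraMap_apply]

/-- A symmetric invertible element `x` can be deformed, by means of symmetric elements `ω` which
commute with it, to its semisimple part, within its conjugacy class under isometries. -/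
theorem exists_deformation [CharZero F] {k : Type u} [Field k] [Algebra F k] [IsAlgClosed k]
    [Module.Finite F E] (a : AntiInvolution F E) (hE : HasRescaling k (k ⊗[F] E))
    (x : (F ⊗[F] E)ˣ) (hx : a.ext F x = x) :
    ∃ ω : (k[X] ⊗[F] E)ˣ, a.ext k[X] ω = ω ∧
      Commute (ω : k[X] ⊗[F] E) (unitsMap E (Algebra.ofId F k[X]) x) ∧
      (∀ c : k, c ≠ 0 → ∃ h : (k ⊗[F] E)ˣ, a.ext k h * h = 1 ∧
        h * unitsMap E (Algebra.ofId F k) x =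
          unitsMap E (evalHom F c) ω ^ 2 * unitsMap E (Algebra.ofId F k) x * h) ∧
      ∀ f : F[X], IsNilpotent (Polynomial.aeval
        (unitsMap E (Algebra.ofId F k) x : k ⊗[F] E) f) →
        Polynomial.aeval ((unitsMap E (evalHom F (0 : k)) ω ^ 2 *
          unitsMap E (Algebra.ofId F k) x : (k ⊗[F] E)ˣ) : k ⊗[F] E) f = 0 := by
  have : CharZero k := charZero_of_injective_algebraMap (algebraMap F k).injective
  set y := unitsMap E (Algebra.ofId F k) x with hy
  have hay : a.ext k y = y := by
    have := a.map_ext (Algebra.ofId F k) (x : F ⊗[F] E)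
    rw [hx] at this
    exact this.symm
  obtain ⟨n, s, hn, hs, hnil, hred, hyn⟩ :=
    exists_isNilpotent_isReduced_adjoin (k := k) (y : k ⊗[F] E)
  have hay' : ∀ z ∈ Algebra.adjoin k {(y : k ⊗[F] E)}, a.ext k z = z := by
    intro z hz
    obtain ⟨p, rfl⟩ := exists_aeval_of_mem_adjoin_singleton hz
    rw [map_aeval_of_map_mul_rev (a.ext k) (a.ext_mul k) (a.ext_one k), hay]
  have hyn' : Commute n (y : k ⊗[F] E) := commute_of_mem_adjoin_singleton hn rfl
  have hys' : Commute s (y : k ⊗[F] E) := commute_of_mem_adjoin_singleton hs rfl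
  have hsn : Commute s n := (commute_of_mem_adjoin_singleton hn hys'.symm).symm
  -- With `y = s + n` one has `s + c n = y + (c - 1) n = (1 + (c - 1) z) y`. Hence the factor `X -
  -- 1` in `N` below: parameter `1` gives `y` and parameter `0` its semisimple part.
  let z : k ⊗[F] E := (y⁻¹ : (k ⊗[F] E)ˣ) * n
  have hzy : Commute ((y⁻¹ : (k ⊗[F] E)ˣ) : k ⊗[F] E) n := Commute.units_inv_left hyn'.symm
  have hz : IsNilpotent z := hzy.isNilpotent_mul_left hnil
  have haz : a.ext k z = z := by
    rw [a.ext_mul, a.ext_inv k hay, hay' n hn]; exact hzy.eq.symm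
  have hzy' : Commute z y := (Commute.units_inv_left rfl : Commute _ _).mul_left hyn'
  let ι : k →ₐ[F] k[X] := (Polynomial.CAlgHom (R := k) (A := k)).restrictScalars F
  have hι : ∀ c : k, (evalHom F c).comp ι = AlgHom.id F k := fun c =>
    AlgHom.ext fun t => by simp [evalHom, ι]
  let j : k ⊗[F] E →ₐ[F] k[X] ⊗[F] E := Algebra.TensorProduct.map ι (AlgHom.id F E)
  have hj : ∀ (c : k) (w : k ⊗[F] E),
      Algebra.TensorProduct.map (evalHom F c) (AlgHom.id F E) (j w) = w := by
    intro c w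
    rw [← AlgHom.comp_apply, ← Algebra.TensorProduct.map_comp, hι, AlgHom.id_comp,
      Algebra.TensorProduct.map_id]
    rfl
  let N : k[X] ⊗[F] E := (Polynomial.X - 1 : k[X]) • j z
  have hN : IsNilpotent N := (hz.map j).smul _
  have haN : a.ext k[X] N = N := by
    change a.ext k[X] ((Polynomial.X - 1 : k[X]) • j z) = _
    rw [map_smul, ← a.map_ext, haz]
  -- The root is a polynomial in the nilpotent `N`, hence symmetric and commuting with `x`. Taking
  -- it over `k[X]` makes it a polynomial curve rather than a separate choice for each `c`.
  obtain ⟨r, hr, hr2⟩ := exists_mem_adjoin_sq_eq_one_add (k := F) hN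
  have hru : IsUnit r := by
    have hc : Commute r r := rfl
    refine (hc.isUnit_mul_iff.mp ?_).1
    rw [← sq, hr2]
    exact hN.isUnit_one_add
  obtain ⟨ω, rfl⟩ := hru
  have hω : ∀ c : k, ((unitsMap E (evalHom F c) ω ^ 2 * y : (k ⊗[F] E)ˣ) : k ⊗[F] E) =
      s + c • n := by
    intro c
    have h1 := congrArg (Algebra.TensorProduct.map (evalHom F c) (AlgHom.id F E)) hr2
    rw [map_pow, map_add, map_one, map_smul_tensor, hj] at h1
    have h2 : (unitsMap E (evalHom F c) ω : k ⊗[F] E) ^ 2 = 1 + evalHom F c (Polynomial.X - 1) • z :=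
      h1
    rw [Units.val_mul, Units.val_pow_eq_pow_val, h2, add_mul, one_mul, smul_mul_assoc,
      show z * (y : k ⊗[F] E) = n by
        rw [hzy'.eq]; exact Units.mul_inv_cancel_left y n]
    conv_lhs => rw [hyn]
    simp [evalHom, sub_smul]
  refine ⟨ω, ?_, ?_, ?_, ?_⟩
  · obtain ⟨p, hp⟩ := exists_aeval_of_mem_adjoin_singleton hr
    rw [← hp, a.ext_aeval, haN]
  · refine commute_of_mem_adjoin_singleton hr ?_
    have : (unitsMap E (Algebra.ofId F k[X]) x : k[X] ⊗[F] E) = j y :=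
      congrArg Units.val (unitsMap_ofId x ι).symm
    rw [this]
    exact (hzy'.map j).smul_left _
  · intro c hc
    obtain ⟨u, hu1, hu2⟩ := hE s n hred hsn hnil c hc
    obtain ⟨h, hh1, hh2⟩ := exists_isometry_conj (a.ext k) (a.ext_mul k) (a.ext_one k)
      (a.ext_ext k) hay (y := s + c • n) (by rw [map_add, map_smul, hay' n hn, hay' s hs]) u (by
        conv_lhs => rw [hyn]
        rw [mul_add, hu1, hu2, add_mul, smul_mul_assoc])
    exact ⟨h, hh1, Units.ext (by rw [Units.val_mul, Units.val_mul, hω, hh2])⟩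
  · intro f hf
    rw [hω, zero_smul, add_zero, ← Polynomial.aeval_map_algebraMap k]
    rw [← Polynomial.aeval_map_algebraMap k] at hf
    exact aeval_eq_zero_of_isReduced hs hnil hred hyn _ hf

end Deformation

/-! ## Closed orbits and semisimplicity -/

namespace SymmetricPair

variable {F : Type u} [Field F] (X : SymmetricPair F)

theorem mem_H_iff {R : Type u} [CommRing R] [Algebra F R] {g : X.G R} :
    g ∈ X.H R ↔ X.θ g = g := Iff.rfl

theorem map_s {R S : Type u} [CommRing R] [Algebra F R] [CommRing S] [Algebra F S]
    (φ : R →ₐ[F] S) (g : X.G R) : X.map φ (X.s g) = X.s (X.map φ g) := by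
  simp [s, σ, X.map_θ]

/-- The fibres of `s` are the cosets `g H`, and `s(h g) = h s(g) h⁻¹` for `h ∈ H`; so `H`-conjugacy
of symmetrizations detects membership in `H g H`. -/
theorem mem_doubleCoset_of_s_eq {R : Type u} [CommRing R] [Algebra F R] {g y h : X.G R}
    (hh : h ∈ X.H R) (hs : X.s y = h * X.s g * h⁻¹) :
    y ∈ DoubleCoset.doubleCoset g (X.H R) (X.H R) := by
  rw [DoubleCoset.mem_doubleCoset]
  refine ⟨h, hh, (h * g)⁻¹ * y, ?_, by group⟩
  rw [mem_H_iff] at hh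
  rw [SetLike.mem_coe, mem_H_iff]
  have h1 : y * X.σ y = h * g * X.σ g * h⁻¹ := by
    rw [show y * X.σ y = X.s y from rfl, hs, s]; simp only [mul_assoc]
  have h2 : X.θ y = (X.σ y)⁻¹ := by simp [σ]
  have h3 : X.θ g = (X.σ g)⁻¹ := by simp [σ]
  rw [map_mul, map_inv, map_mul, hh, h2, h3]
  have h4 : X.σ y = y⁻¹ * (h * g * X.σ g * h⁻¹) := by rw [← h1]; group
  rw [h4]
  group

theorem exists_s_eq_of_mem_doubleCoset {R : Type u} [CommRing R] [Algebra F R] {g y : X.G R}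
    (hy : y ∈ DoubleCoset.doubleCoset g (X.H R) (X.H R)) :
    ∃ h ∈ X.H R, X.s y = h * X.s g * h⁻¹ := by
  rw [DoubleCoset.mem_doubleCoset] at hy
  obtain ⟨h, hh, h', hh', rfl⟩ := hy
  rw [SetLike.mem_coe, mem_H_iff] at hh hh'
  refine ⟨h, hh, ?_⟩
  simp only [s, σ, mul_inv_rev, map_mul, map_inv, hh, hh']
  group

variable {X}

/-- A point of `G` over the polynomial ring is a curve parametrized by the affine line. Regular
functions become polynomials along it, and a polynomial vanishing at every `c ≠ 0` vanishes at `0`.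
-/
theorem HasClosedOrbit.map_eval_zero_mem {g : X.G F} (hg : X.HasClosedOrbit g)
    (γ : X.G (AlgebraicClosure F)[X])
    (h : ∀ c : AlgebraicClosure F, c ≠ 0 → X.map (evalHom F c) γ ∈
      DoubleCoset.doubleCoset (X.map (Algebra.ofId F (AlgebraicClosure F)) g)
        (X.H (AlgebraicClosure F)) (X.H (AlgebraicClosure F))) :
    X.map (evalHom F 0) γ ∈
      DoubleCoset.doubleCoset (X.map (Algebra.ofId F (AlgebraicClosure F)) g)
        (X.H (AlgebraicClosure F)) (X.H (AlgebraicClosure F)) := by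
  obtain ⟨S, hS, hZ⟩ := hg
  rw [hZ] at h ⊢
  intro f hf
  have key : ∃ P : (AlgebraicClosure F)[X], ∀ c, f (X.map (evalHom F c) γ) = P.eval c := by
    have := hS hf
    clear hf
    unfold geometricFunctions at this
    induction this using Submodule.span_induction with
    | mem f hf =>
      obtain ⟨φ, rfl⟩ := hf
      refine ⟨φ.toFun γ, fun c => ?_⟩
      change φ.toFun (X.map (evalHom F c) γ) = _
      rw [φ.natural]
      simp [evalHom]
    | zero => exact ⟨0, fun c => by simp⟩
    | add f₁ f₂ _ _ h₁ h₂ =>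
      obtain ⟨P₁, h₁⟩ := h₁
      obtain ⟨P₂, h₂⟩ := h₂
      exact ⟨P₁ + P₂, fun c => by simp [h₁, h₂]⟩
    | smul a f _ h =>
      obtain ⟨P, h⟩ := h
      exact ⟨a • P, fun c => by simp [h]⟩
  obtain ⟨P, hP⟩ := key
  have hP0 : P = 0 := by
    refine Polynomial.eq_zero_of_infinite_isRoot P
      (Set.Infinite.mono ?_ (Set.finite_singleton (0 : AlgebraicClosure F)).infinite_compl)
    intro c hc
    change P.eval c = 0
    rw [← hP]
    exact h c hc f hf
  rw [hP, hP0, Polynomial.eval_zero]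

theorem HasClosedOrbit.exists_conj {g : X.G F} (hg : X.HasClosedOrbit g)
    (γ : X.G (AlgebraicClosure F)[X])
    (h : ∀ c : AlgebraicClosure F, c ≠ 0 → ∃ h ∈ X.H (AlgebraicClosure F),
      X.s (X.map (evalHom F c) γ) =
        h * X.map (Algebra.ofId F (AlgebraicClosure F)) (X.s g) * h⁻¹) :
    ∃ h ∈ X.H (AlgebraicClosure F), X.s (X.map (evalHom F 0) γ) =
        h * X.map (Algebra.ofId F (AlgebraicClosure F)) (X.s g) * h⁻¹ := by
  rw [X.map_s] at h ⊢
  refine X.exists_s_eq_of_mem_doubleCoset (hg.map_eval_zero_mem γ fun c hc => ?_)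
  obtain ⟨h, hh, e⟩ := h c hc
  exact X.mem_doubleCoset_of_s_eq hh e

end SymmetricPair

/-! ### Semisimplicity of `s(g)` for the general linear pairs. -/

section GeneralLinear

variable {F E : Type u} [Field F] [Ring E] [Algebra F E]

theorem map_ofId_injective (k : Type u) [Field k] [Algebra F k] :
    Function.Injective (Algebra.TensorProduct.map (Algebra.ofId F k) (AlgHom.id F E)) :=
  Module.Flat.rTensor_preserves_injective_linearMap (M := E) (Algebra.ofId F k).toLinearMap
    (Algebra.ofId F k).injective

theorem aeval_map_ofId (k : Type u) [Field k] [Algebra F k] (x : (F ⊗[F] E)ˣ) (f : F[X]) :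
    Polynomial.aeval (unitsMap E (Algebra.ofId F k) x : k ⊗[F] E) f =
      Algebra.TensorProduct.map (Algebra.ofId F k) (AlgHom.id F E)
        (Polynomial.aeval (x : F ⊗[F] E) f) :=
  Polynomial.aeval_algHom_apply (Algebra.TensorProduct.map (Algebra.ofId F k) (AlgHom.id F E)) _ _

theorem Units.aeval_conj {A : Type*} [Ring A] [Algebra F A] (h x : Aˣ) (f : F[X]) :
    Polynomial.aeval ((h * x * h⁻¹ : Aˣ) : A) f =
      h * Polynomial.aeval (x : A) f * (h⁻¹ : Aˣ) := by
  induction f using Polynomial.induction_on' with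
  | add p q hp hq => rw [map_add, map_add, hp, hq, mul_add, add_mul]
  | monomial m r =>
    rw [Polynomial.aeval_monomial, Polynomial.aeval_monomial, ← Algebra.smul_def,
      ← Algebra.smul_def, ← Units.val_pow_eq_pow_val, _root_.conj_pow, mul_smul_comm, smul_mul_assoc]
    simp

/-- The symmetrization map `g ↦ g a(g)` of the group of units. -/
noncomputable def AntiInvolution.symmetrization (a : AntiInvolution F E) {R : Type u} [CommRing R]
    [Algebra F R] (g : (R ⊗[F] E)ˣ) : (R ⊗[F] E)ˣ :=
  g * a.unitsInv g⁻¹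

namespace AntiInvolution

variable (a : AntiInvolution F E) {R : Type u} [CommRing R] [Algebra F R] (g : (R ⊗[F] E)ˣ)

theorem val_symmetrization : (a.symmetrization g : R ⊗[F] E) = g * a.ext R g := by
  change (g : R ⊗[F] E) * a.ext R ((g⁻¹)⁻¹ : (R ⊗[F] E)ˣ) = _
  rw [inv_inv]

theorem ext_symmetrization : a.ext R (a.symmetrization g) = a.symmetrization g := by
  rw [val_symmetrization, a.ext_mul, a.ext_ext]

theorem unitsMap_symmetrization {S : Type u} [CommRing S] [Algebra F S] (φ : R →ₐ[F] S) :
    unitsMap E φ (a.symmetrization g) = a.symmetrization (unitsMap E φ g) :=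
  (generalLinearPair a).map_s φ g

end AntiInvolution

/-- For the pairs `(GL, O)` and `(GL, U)`: if the orbit of `g` is closed, then `s(g)` is
semisimple. -/
theorem aeval_eq_zero_of_hasClosedOrbit_generalLinearPair [CharZero F] [Module.Finite F E]
    (a : AntiInvolution F E)
    (hE : HasRescaling (AlgebraicClosure F) (AlgebraicClosure F ⊗[F] E)) (g : (F ⊗[F] E)ˣ)
    (hg : (generalLinearPair a).HasClosedOrbit g) (f : F[X])
    (hf : IsNilpotent (Polynomial.aeval (a.symmetrization g : F ⊗[F] E) f)) :
    Polynomial.aeval (a.symmetrization g : F ⊗[F] E) f = 0 := by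
  let k := AlgebraicClosure F
  set x := a.symmetrization g with hx
  obtain ⟨ω, hω1, hω2, hω3, hω4⟩ := exists_deformation (k := k) a hE x (a.ext_symmetrization g)
  -- As `ω` is symmetric and commutes with `x`, the symmetrization of `ω g` is `ω x ω = ω² x`, the
  -- deformation of `x` to its semisimple part.
  let γ : (k[X] ⊗[F] E)ˣ := ω * unitsMap E (Algebra.ofId F k[X]) g
  have hsγ : a.symmetrization γ = ω ^ 2 * unitsMap E (Algebra.ofId F k[X]) x := by
    apply Units.ext
    have h1 : (unitsMap E (Algebra.ofId F k[X]) x : k[X] ⊗[F] E) =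
        unitsMap E (Algebra.ofId F k[X]) g * a.ext k[X] (unitsMap E (Algebra.ofId F k[X]) g) := by
      rw [hx, a.unitsMap_symmetrization, a.val_symmetrization]
    rw [a.val_symmetrization, Units.val_mul, a.ext_mul, hω1, Units.val_mul,
      Units.val_pow_eq_pow_val, sq, mul_assoc (ω : k[X] ⊗[F] E) ω, hω2.eq, h1]
    simp only [mul_assoc]
  have hsγc : ∀ c : k, a.symmetrization (unitsMap E (evalHom F c) γ) =
      unitsMap E (evalHom F c) ω ^ 2 * unitsMap E (Algebra.ofId F k) x := by
    intro c
    rw [← a.unitsMap_symmetrization, hsγ, map_mul, map_pow, unitsMap_ofId]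
  have h0 : ∃ h : (k ⊗[F] E)ˣ, a.unitsInv h = h ∧
      a.symmetrization (unitsMap E (evalHom F (0 : k)) γ) =
        h * unitsMap E (Algebra.ofId F k) x * h⁻¹ :=
    hg.exists_conj γ fun c hc => by
      obtain ⟨h, hh1, hh2⟩ := hω3 c hc
      exact ⟨h, (unitsInv_eq_iff a k h).mpr hh1,
        (hsγc c).trans (eq_mul_inv_of_mul_eq hh2.symm)⟩
  obtain ⟨h, -, hh⟩ := h0
  rw [hsγc] at hh
  -- If `f(x)` is nilpotent, `f` kills the semisimple end of the curve; by closedness that end is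
  -- conjugate to `x`, so `f(x) = 0`.
  have h1 := hω4 f (by rw [aeval_map_ofId]; exact hf.map _)
  rw [hh, Units.aeval_conj] at h1
  refine map_ofId_injective (F := F) (E := E) k ?_
  rw [map_zero, ← aeval_map_ofId]
  simpa using h1

end GeneralLinear

/-! ### Semisimplicity of `s(g)` for the unitary pairs, by splitting the quadratic extension. -/

section Unitary

/-- For a central idempotent `e` and two homomorphisms `p, q` to the group of units, the
homomorphism `e p + (1 - e) q`. -/
def mixHom {G A : Type*} [Group G] [Ring A] (e : A) (he : e * e = e) (hc : ∀ y, e * y = y * e)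
    (p q : G →* Aˣ) : G →* Aˣ :=
  MonoidHom.toHomUnits
    { toFun := fun u => e * p u + (1 - e) * q u
      map_one' := by simp
      map_mul' := fun u v => by
        have h1 : e * (1 - e) = 0 := by rw [mul_sub, he, mul_one, sub_self]
        have h2 : (1 - e) * e = 0 := by rw [sub_mul, he, one_mul, sub_self]
        have h3 : (1 - e) * (1 - e) = 1 - e := by rw [mul_sub, h2, mul_one, sub_zero]
        have hc' : ∀ y, (1 - e) * y = y * (1 - e) := fun y => by
          rw [sub_mul, mul_sub, hc, one_mul, mul_one]
        have key : ∀ c d y z : A, (∀ y, d * y = y * d) →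
            c * y * (d * z) = c * d * (y * z) := fun c d y z hd => by
          rw [mul_assoc, ← mul_assoc y, ← hd y]; simp only [mul_assoc]
        rw [add_mul, mul_add, mul_add, key _ _ _ _ hc, key _ _ _ _ hc', key _ _ _ _ hc,
          key _ _ _ _ hc', h1, h2, h3, he]
        simp }

variable {F E : Type u} [Field F] [Ring E] [Algebra F E]

/-- The composition of an anti-involution with a commuting involutive automorphism. -/
def AntiInvolution.comp (a : AntiInvolution F E) (b : E →ₐ[F] E) (hb : ∀ x, b (b x) = x)
    (hab : ∀ x, b (a.toLin x) = a.toLin (b x)) : AntiInvolution F E where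
  toLin := b.toLinearMap ∘ₗ a.toLin
  map_mul' x y := by simp [a.map_mul']
  invol x := by simp [← hab, a.invol, hb]

theorem AntiInvolution.ext_comp (a : AntiInvolution F E) (b : E →ₐ[F] E) (hb : ∀ x, b (b x) = x)
    (hab : ∀ x, b (a.toLin x) = a.toLin (b x)) (R : Type u) [CommRing R] [Algebra F R]
    (y : R ⊗[F] E) : (a.comp b hb hab).ext R y =
      Algebra.TensorProduct.map (AlgHom.id F R) b (a.ext R y) := by
  induction y with
  | zero => simp
  | add x y hx hy => simp [hx, hy]
  | tmul r x => simp [AntiInvolution.ext_tmul, AntiInvolution.comp]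

variable (a : AntiInvolution F E) (b : E →ₐ[F] E) (hb : ∀ x, b (b x) = x)
    (hab : ∀ x, b (a.toLin x) = a.toLin (b x))

theorem unitsInv_unitsInv (R : Type u) [CommRing R] [Algebra F R] (y : (R ⊗[F] E)ˣ) :
    a.unitsInv (a.unitsInv y) = y :=
  (generalLinearPair a).θ_θ (R := R) y

theorem unitsMap_unitsInv {R S : Type u} [CommRing R] [Algebra F R] [CommRing S] [Algebra F S]
    (φ : R →ₐ[F] S) (y : (R ⊗[F] E)ˣ) :
    unitsMap E φ (a.unitsInv y) = a.unitsInv (unitsMap E φ y) :=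
  (generalLinearPair a).map_θ φ y

include hb in
theorem unitsAut_unitsAut (R : Type u) [CommRing R] [Algebra F R] (y : (R ⊗[F] E)ˣ) :
    unitsAut b R (unitsAut b R y) = y := by
  apply Units.ext
  change Algebra.TensorProduct.map (AlgHom.id F R) b
    (Algebra.TensorProduct.map (AlgHom.id F R) b (y : R ⊗[F] E)) = y
  rw [← AlgHom.comp_apply, ← Algebra.TensorProduct.map_comp, AlgHom.id_comp,
    show b.comp b = AlgHom.id F E from AlgHom.ext hb, Algebra.TensorProduct.map_id]
  rfl

theorem comp_unitsInv (R : Type u) [CommRing R] [Algebra F R] (y : (R ⊗[F] E)ˣ) :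
    (a.comp b hb hab).unitsInv y = unitsAut b R (a.unitsInv y) :=
  Units.ext (a.ext_comp b hb hab R _)

section Idempotent

variable (F) (δ : E) {R : Type u} [CommRing R] [Algebra F R]

/-- The element `(1 + t ⊗ δ) / 2` of `R ⊗ E`. -/
noncomputable def halfIdempotent (t : R) : R ⊗[F] E :=
  (2⁻¹ : F) • (1 + t ⊗ₜ[F] δ)

variable {F δ} {d : F} {t : R}

theorem halfIdempotent_comm (hc : ∀ y, δ * y = y * δ) (y : R ⊗[F] E) :
    halfIdempotent F δ t * y = y * halfIdempotent F δ t := by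
  have h : (t ⊗ₜ[F] δ) * y = y * (t ⊗ₜ[F] δ) := by
    induction y with
    | zero => simp
    | add x y hx hy => rw [mul_add, hx, hy, add_mul]
    | tmul r x => simp [hc, mul_comm]
  unfold halfIdempotent
  rw [smul_mul_assoc, mul_smul_comm, add_mul, mul_add, h, one_mul, mul_one]

theorem map_ring_halfIdempotent {S : Type u} [CommRing S] [Algebra F S] (φ : R →ₐ[F] S) :
    Algebra.TensorProduct.map φ (AlgHom.id F E) (halfIdempotent F δ t) =
      halfIdempotent F δ (φ t) := by
  rw [halfIdempotent, halfIdempotent, map_smul, map_add, map_one]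
  simp

variable [CharZero F]

theorem halfIdempotent_mul_self (hδ : δ * δ = algebraMap F E d) (ht : t * t * algebraMap F R d = 1) :
    halfIdempotent F δ t * halfIdempotent F δ t = halfIdempotent F δ t := by
  have h : (t ⊗ₜ[F] δ : R ⊗[F] E) * t ⊗ₜ[F] δ = 1 := by
    rw [Algebra.TensorProduct.tmul_mul_tmul, hδ, Algebra.algebraMap_eq_smul_one d,
      ← TensorProduct.smul_tmul, Algebra.smul_def, mul_comm, ht, Algebra.TensorProduct.one_def]
  unfold halfIdempotent
  rw [smul_mul_smul_comm, mul_add, add_mul, add_mul, h, one_mul, mul_one, one_mul,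
    show (1 : R ⊗[F] E) + t ⊗ₜ[F] δ + (t ⊗ₜ[F] δ + 1) = (2 : F) • (1 + t ⊗ₜ[F] δ) by rw [two_smul]; abel,
    smul_smul]
  congr 1
  norm_num

theorem one_sub_halfIdempotent :
    1 - halfIdempotent F δ t = (2⁻¹ : F) • (1 - t ⊗ₜ[F] δ) := by
  unfold halfIdempotent
  rw [sub_eq_iff_eq_add, ← smul_add, sub_add_add_cancel, ← two_smul F (1 : R ⊗[F] E), smul_smul]
  norm_num

/-- The sign in `a δ = -δ` exchanges the two complementary idempotents. This is why an element of
the unitary group is determined by its component at one of them, which may be any unit. -/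
theorem ext_halfIdempotent (ha : a.toLin δ = -δ) :
    a.ext R (halfIdempotent F δ t) = 1 - halfIdempotent F δ t := by
  rw [one_sub_halfIdempotent, halfIdempotent, LinearMap.map_smul_of_tower, map_add, a.ext_one,
    a.ext_tmul, ha, TensorProduct.tmul_neg, sub_eq_add_neg]

theorem map_halfIdempotent (hbδ : b δ = -δ) :
    Algebra.TensorProduct.map (AlgHom.id F R) b (halfIdempotent F δ t) =
      1 - halfIdempotent F δ t := by
  rw [one_sub_halfIdempotent, halfIdempotent, map_smul, map_add, map_one]
  simp [hbδ, TensorProduct.tmul_neg, sub_eq_add_neg]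

variable (hδ : δ * δ = algebraMap F E d) (hc : ∀ y, δ * y = y * δ)
  (ht : t * t * algebraMap F R d = 1)

/-- The homomorphism `u ↦ e u + (1 - e) a(u)⁻¹` from the group of units to the unitary group, where
`e = (1 + t ⊗ δ) / 2`. -/
noncomputable def toUnitary : (R ⊗[F] E)ˣ →* (R ⊗[F] E)ˣ :=
  mixHom (halfIdempotent F δ t) (halfIdempotent_mul_self hδ ht) (halfIdempotent_comm hc)
    (MonoidHom.id _) a.unitsInv

theorem val_toUnitary (y : (R ⊗[F] E)ˣ) : (toUnitary a hδ hc ht y : R ⊗[F] E) =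
    halfIdempotent F δ t * y + (1 - halfIdempotent F δ t) * a.unitsInv y := rfl

theorem unitsInv_toUnitary (ha : a.toLin δ = -δ) (y : (R ⊗[F] E)ˣ) :
    a.unitsInv (toUnitary a hδ hc ht y) = toUnitary a hδ hc ht y := by
  have h1 : ∀ v : (R ⊗[F] E)ˣ, (a.unitsInv v : R ⊗[F] E) = a.ext R (v⁻¹ : (R ⊗[F] E)ˣ) :=
    fun _ => rfl
  apply Units.ext
  rw [h1, ← map_inv, val_toUnitary, val_toUnitary, map_add, a.ext_mul, a.ext_mul, map_sub, a.ext_one,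
    ext_halfIdempotent a ha, h1, h1, inv_inv, a.ext_ext, sub_sub_cancel, ← halfIdempotent_comm hc,
    add_comm, mul_sub, sub_mul, mul_one, one_mul, ← halfIdempotent_comm hc]

-- Through `toUnitary` the involution `b` of the unitary group becomes `y ↦ b(a(y)⁻¹)`, the
-- involution of the general linear pair of the anti-involution `b ∘ a`. The deformation for general
-- linear pairs thus applies.
include hab in
theorem unitsAut_toUnitary (hbδ : b δ = -δ) (y : (R ⊗[F] E)ˣ) :
    unitsAut b R (toUnitary a hδ hc ht y) =
      toUnitary a hδ hc ht (unitsAut b R (a.unitsInv y)) := by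
  have h1 : ∀ v : (R ⊗[F] E)ˣ, (unitsAut b R v : R ⊗[F] E) =
    Algebra.TensorProduct.map (AlgHom.id F R) b v := fun _ => rfl
  apply Units.ext
  rw [val_toUnitary, unitsAut_unitsInv a b hab, unitsInv_unitsInv, h1, val_toUnitary, map_add,
    map_mul, map_mul, map_sub, map_one, map_halfIdempotent b hbδ, sub_sub_cancel, add_comm]
  rw [h1, h1]

theorem toUnitary_eq_self (y : (R ⊗[F] E)ˣ) (hy : a.unitsInv y = y) :
    toUnitary a hδ hc ht y = y := by
  apply Units.ext
  rw [val_toUnitary, hy, sub_mul, one_mul, add_sub_cancel]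

theorem unitsMap_toUnitary {S : Type u} [CommRing S] [Algebra F S] (φ : R →ₐ[F] S)
    (ht' : φ t * φ t * algebraMap F S d = 1) (y : (R ⊗[F] E)ˣ) :
    unitsMap E φ (toUnitary a hδ hc ht y) = toUnitary a hδ hc ht' (unitsMap E φ y) := by
  apply Units.ext
  change Algebra.TensorProduct.map φ (AlgHom.id F E) (toUnitary a hδ hc ht y : R ⊗[F] E) = _
  rw [val_toUnitary, val_toUnitary, map_add, map_mul, map_mul, map_sub, map_one,
    map_ring_halfIdempotent, ← unitsMap_unitsInv]
  rfl

theorem halfIdempotent_mul_toUnitary (y : (R ⊗[F] E)ˣ) :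
    halfIdempotent F δ t * toUnitary a hδ hc ht y = halfIdempotent F δ t * y := by
  rw [val_toUnitary, mul_add, ← mul_assoc, ← mul_assoc, mul_sub, halfIdempotent_mul_self hδ ht,
    mul_one, sub_self, zero_mul, add_zero]

/-- At the first idempotent `toUnitary` is the identity, so polynomial identities for `y` survive
there. -/
theorem halfIdempotent_mul_aeval_toUnitary (y : (R ⊗[F] E)ˣ) (f : F[X]) :
    halfIdempotent F δ t * Polynomial.aeval (toUnitary a hδ hc ht y : R ⊗[F] E) f =
      halfIdempotent F δ t * Polynomial.aeval (y : R ⊗[F] E) f := by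
  induction f using Polynomial.induction_on' with
  | add p q hp hq => rw [map_add, map_add, mul_add, hp, hq, mul_add]
  | monomial m r =>
    rw [Polynomial.aeval_monomial, Polynomial.aeval_monomial, ← Algebra.smul_def,
      ← Algebra.smul_def, mul_smul_comm, mul_smul_comm, ← Units.val_pow_eq_pow_val,
      ← Units.val_pow_eq_pow_val, ← map_pow, halfIdempotent_mul_toUnitary]

end Idempotent

/-- The symmetrization map of the pair `unitaryPair a b`, on the ambient group of units. -/
noncomputable def unitarySymmetrization {R : Type u} [CommRing R] [Algebra F R]
    (g : (R ⊗[F] E)ˣ) : (R ⊗[F] E)ˣ :=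
  g * unitsAut b R g⁻¹

theorem unitsMap_unitsAut {R S : Type u} [CommRing R] [Algebra F R] [CommRing S] [Algebra F S]
    (φ : R →ₐ[F] S) (y : (R ⊗[F] E)ˣ) :
    unitsMap E φ (unitsAut b R y) = unitsAut b S (unitsMap E φ y) := by
  apply Units.ext
  change Algebra.TensorProduct.map φ (AlgHom.id F E)
    (Algebra.TensorProduct.map (AlgHom.id F R) b (y : R ⊗[F] E)) =
    Algebra.TensorProduct.map (AlgHom.id F S) b
      (Algebra.TensorProduct.map φ (AlgHom.id F E) (y : R ⊗[F] E))
  rw [← AlgHom.comp_apply, ← AlgHom.comp_apply, ← Algebra.TensorProduct.map_comp,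
    ← Algebra.TensorProduct.map_comp, AlgHom.id_comp, AlgHom.id_comp, AlgHom.comp_id,
    AlgHom.comp_id]

theorem unitsMap_unitarySymmetrization {R S : Type u} [CommRing R] [Algebra F R] [CommRing S]
    [Algebra F S] (φ : R →ₐ[F] S) (y : (R ⊗[F] E)ˣ) :
    unitsMap E φ (unitarySymmetrization b y) = unitarySymmetrization b (unitsMap E φ y) := by
  rw [unitarySymmetrization, map_mul, unitsMap_unitsAut, map_inv, unitarySymmetrization]

include hab in
theorem unitsInv_unitarySymmetrization {R : Type u} [CommRing R] [Algebra F R] (y : (R ⊗[F] E)ˣ)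
    (hy : a.unitsInv y = y) :
    a.unitsInv (unitarySymmetrization b y) = unitarySymmetrization b y := by
  rw [unitarySymmetrization, map_mul, unitsAut_unitsInv a b hab, map_inv, hy]

include hb in
theorem unitsAut_unitarySymmetrization {R : Type u} [CommRing R] [Algebra F R]
    (y : (R ⊗[F] E)ˣ) :
    unitsAut b R (unitarySymmetrization b y) = (unitarySymmetrization b y)⁻¹ := by
  rw [unitarySymmetrization, map_mul, unitsAut_unitsAut b hb]
  simp

/-- For the pairs `(U(V_D), O(V))`: if the orbit of `g` is closed, then `s(g)` is semisimple. -/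
theorem aeval_eq_zero_of_hasClosedOrbit_unitaryPair [CharZero F] [Module.Finite F E]
    (hE : HasRescaling (AlgebraicClosure F) (AlgebraicClosure F ⊗[F] E))
    {δ : E} {d : F} (hd : d ≠ 0) (hδ : δ * δ = algebraMap F E d) (hc : ∀ y, δ * y = y * δ)
    (ha : a.toLin δ = -δ) (hbδ : b δ = -δ) (g : unitaryPoints a F)
    (hg : (unitaryPair a b hb hab).HasClosedOrbit g) (f : F[X])
    (hf : IsNilpotent (Polynomial.aeval (unitarySymmetrization b (g : (F ⊗[F] E)ˣ) : F ⊗[F] E) f)) :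
    Polynomial.aeval (unitarySymmetrization b (g : (F ⊗[F] E)ˣ) : F ⊗[F] E) f = 0 := by
  let k := AlgebraicClosure F
  set x := unitarySymmetrization b (g : (F ⊗[F] E)ˣ) with hx
  have hgu : a.unitsInv (g : (F ⊗[F] E)ˣ) = g := (unitsInv_eq_iff a F _).mpr g.2
  have hax : a.unitsInv x = x := unitsInv_unitarySymmetrization a b hab _ hgu
  have hbx : unitsAut b F x = x⁻¹ := unitsAut_unitarySymmetrization b hb _
  -- The square root of `d = δ²` splits the extension over the algebraic closure; the parameter of
  -- the idempotent is `t = r⁻¹`, so that `t² d = 1`.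
  obtain ⟨r, hr⟩ := IsAlgClosed.exists_pow_nat_eq (algebraMap F k d) (n := 2) two_pos
  have hd' : algebraMap F k d ≠ 0 := by simpa using hd
  have hr0 : r ≠ 0 := by rintro rfl; rw [zero_pow two_ne_zero] at hr; exact hd' hr.symm
  have ht : r⁻¹ * r⁻¹ * algebraMap F k d = 1 := by rw [← hr, sq, mul_assoc, inv_mul_cancel_left₀ hr0, inv_mul_cancel₀ hr0]
  have htX : Polynomial.C r⁻¹ * Polynomial.C r⁻¹ * algebraMap F k[X] d = 1 := by
    rw [IsScalarTower.algebraMap_apply F k k[X], Polynomial.algebraMap_apply, ← Polynomial.C_mul,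
      Algebra.algebraMap_self, RingHom.id_apply, ← Polynomial.C_mul, ht, Polynomial.C_1]
  have hev : ∀ c : k, evalHom F c (Polynomial.C r⁻¹) = r⁻¹ := fun c => by simp [evalHom]
  let U := toUnitary a hδ hc ht
  let UX := toUnitary a hδ hc htX
  let e := halfIdempotent F δ r⁻¹
  let τ := a.comp b hb hab
  -- Both `a` and `b` invert `x`: the first since `x` is unitary, the second since `x = g b(g)⁻¹`.
  -- Their composite therefore fixes it.
  have hτx : τ.ext F x = x := by
    have h1 : τ.unitsInv x = x⁻¹ := by rw [comp_unitsInv, hax, hbx]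
    have h2 := congrArg (fun y : (F ⊗[F] E)ˣ => y⁻¹) h1
    rw [← map_inv, inv_inv] at h2
    have h3 : (τ.unitsInv x⁻¹ : F ⊗[F] E) = τ.ext F ((x⁻¹)⁻¹ : (F ⊗[F] E)ˣ) := rfl
    rw [inv_inv, h2] at h3
    exact h3.symm
  obtain ⟨ω, hω1, hω2, hω3, hω4⟩ := exists_deformation (k := k) τ hE x hτx
  have hω1' : τ.unitsInv ω = ω⁻¹ := by
    apply Units.ext
    have h1 : (τ.unitsInv ω : k[X] ⊗[F] E) = τ.ext k[X] (ω⁻¹ : (k[X] ⊗[F] E)ˣ) := rfl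
    rw [h1, τ.ext_inv k[X] hω1]
  -- The curve `ω g` of the general linear case, with `ω` carried into the unitary group. Since
  -- `toUnitary` fixes the unitary element `x`, the symmetrization is the image of `ω² x`.
  let γ₀ : (k[X] ⊗[F] E)ˣ := UX ω * unitsMap E (Algebra.ofId F k[X]) g
  have hγ₀ : a.unitsInv γ₀ = γ₀ := by
    rw [map_mul, unitsInv_toUnitary a hδ hc htX ha, ← unitsMap_unitsInv, hgu]
  have hxX : ∀ (R : Type u) [CommRing R] [Algebra F R],
      a.unitsInv (unitsMap E (Algebra.ofId F R) x) = unitsMap E (Algebra.ofId F R) x := by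
    intro R _ _
    rw [← unitsMap_unitsInv, hax]
  let γ : unitaryPoints a k[X] := ⟨γ₀, (unitsInv_eq_iff a _ _).mp hγ₀⟩
  have hω2' : ω * unitsMap E (Algebra.ofId F k[X]) x = unitsMap E (Algebra.ofId F k[X]) x * ω :=
    Units.ext hω2
  have hsγ : unitarySymmetrization b γ₀ = UX (ω ^ 2 * unitsMap E (Algebra.ofId F k[X]) x) := by
    have h1 : unitsMap E (Algebra.ofId F k[X]) x = unitsMap E (Algebra.ofId F k[X]) g *
        unitsAut b k[X] (unitsMap E (Algebra.ofId F k[X]) g)⁻¹ :=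
      unitsMap_unitarySymmetrization b (Algebra.ofId F k[X]) g
    have h2 : unitsAut b k[X] (UX ω)⁻¹ = UX ω := by
      rw [map_inv, unitsAut_toUnitary a b hab hδ hc htX hbδ, ← comp_unitsInv a b hb hab, hω1',
        map_inv, inv_inv]
    rw [unitarySymmetrization, mul_inv_rev, map_mul, h2]
    have h3 := toUnitary_eq_self a hδ hc htX _ (hxX k[X])
    rw [sq, mul_assoc ω ω, hω2', map_mul, map_mul, h3, h1]
    simp only [mul_assoc, γ₀]
  have hsγc : ∀ c : k, unitarySymmetrization b (unitsMap E (evalHom F c) γ₀) =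
      U (unitsMap E (evalHom F c) ω ^ 2 * unitsMap E (Algebra.ofId F k) x) := by
    intro c
    have hev' : evalHom F c (Polynomial.C r⁻¹) * evalHom F c (Polynomial.C r⁻¹) *
        algebraMap F k d = 1 := by rw [hev, ht]
    have hU : toUnitary a hδ hc hev' = U := by
      have : ∀ (t : k) (h : t * t * algebraMap F k d = 1), t = r⁻¹ →
          toUnitary a hδ hc h = U := by
        rintro t h rfl; rfl
      exact this _ _ (hev c)
    rw [← unitsMap_unitarySymmetrization, hsγ, unitsMap_toUnitary a hδ hc htX _ hev', map_mul,
      map_pow, unitsMap_ofId, hU]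
  have h0 : ∃ h : (k ⊗[F] E)ˣ, unitarySymmetrization b (unitsMap E (evalHom F (0 : k)) γ₀) =
        h * unitsMap E (Algebra.ofId F k) x * h⁻¹ := by
    obtain ⟨h, -, hh⟩ := hg.exists_conj γ fun c hc0 => by
      obtain ⟨h, hh1, hh2⟩ := hω3 c hc0
      let h' : unitaryPoints a k :=
        ⟨U h, (unitsInv_eq_iff a k _).mp (unitsInv_toUnitary a hδ hc ht ha h)⟩
      refine ⟨h', Subtype.ext ?_, Subtype.ext ?_⟩
      · change unitsAut b k (U h) = U h
        rw [unitsAut_toUnitary a b hab hδ hc ht hbδ, ← comp_unitsInv a b hb hab,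
          (unitsInv_eq_iff τ k h).mpr hh1]
      · refine (hsγc c).trans (eq_mul_inv_of_mul_eq ?_)
        change U _ * U h = U h * unitsMap E (Algebra.ofId F k) x
        have h3 := toUnitary_eq_self a hδ hc ht _ (hxX k)
        conv_rhs => rw [← h3]
        rw [← map_mul, ← hh2, map_mul]
    exact ⟨h.1, congrArg Subtype.val hh⟩
  obtain ⟨h, hh⟩ := h0
  rw [hsγc] at hh
  have key : ∀ f : F[X], IsNilpotent (Polynomial.aeval (x : F ⊗[F] E) f) →
      e * Algebra.TensorProduct.map (Algebra.ofId F k) (AlgHom.id F E)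
        (Polynomial.aeval (x : F ⊗[F] E) f) = 0 := by
    intro f hf
    have h1 := hω4 f (by rw [aeval_map_ofId]; exact hf.map _)
    have h2 := halfIdempotent_mul_aeval_toUnitary a hδ hc ht
      (unitsMap E (evalHom F (0 : k)) ω ^ 2 * unitsMap E (Algebra.ofId F k) x) f
    rw [h1, mul_zero] at h2
    have h3 := Units.aeval_conj h (unitsMap E (Algebra.ofId F k) x) f
    rw [← hh] at h3
    rw [h3, ← mul_assoc, ← mul_assoc, halfIdempotent_comm hc, mul_assoc (h : k ⊗[F] E)] at h2
    rw [← aeval_map_ofId]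
    simpa using h2
  have key2 := key f hf
  -- So far only the component of `f(x)` at one idempotent is known to vanish. As `a` inverts `x`
  -- and `x⁻¹` is a polynomial in `x`, `a(f(x))` is again a nilpotent polynomial in `x`; its
  -- component at the same idempotent vanishes, and `a` carries this to the other idempotent.
  have hinv : ∃ f₂ : F[X], Polynomial.aeval (x : F ⊗[F] E) f₂ =
      a.ext F (Polynomial.aeval (x : F ⊗[F] E) f) := by
    refine exists_aeval_of_mem_adjoin_singleton ?_
    rw [a.ext_aeval]
    have h1 : a.ext F (x : F ⊗[F] E) = (x⁻¹ : (F ⊗[F] E)ˣ) := by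
      have h4 := congrArg (fun y : (F ⊗[F] E)ˣ => y⁻¹) hax
      rw [← map_inv] at h4
      have h3 : (a.unitsInv x⁻¹ : F ⊗[F] E) = a.ext F ((x⁻¹)⁻¹ : (F ⊗[F] E)ˣ) := rfl
      rw [inv_inv, h4] at h3
      exact h3.symm
    rw [h1]
    exact (Algebra.adjoin_le (Set.singleton_subset_iff.mpr (Units.inv_mem_adjoin_singleton x)))
      (Polynomial.aeval_mem_adjoin_singleton F _)
  obtain ⟨f₂, hf₂⟩ := hinv
  have key3 := key f₂ (by
    rw [hf₂]
    obtain ⟨m, hm⟩ := hf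
    refine ⟨m, ?_⟩
    have h5 : ∀ (y : F ⊗[F] E) (j : ℕ), a.ext F y ^ j = a.ext F (y ^ j) := by
      intro y j
      induction j with
      | zero => rw [pow_zero, pow_zero, a.ext_one]
      | succ j ih => rw [pow_succ, ih, ← a.ext_mul, ← pow_succ']
    rw [h5, hm, map_zero])
  rw [hf₂, a.map_ext] at key3
  have key4 := congrArg (a.ext k) key3
  rw [a.ext_mul, a.ext_ext, map_zero, ext_halfIdempotent a ha, mul_sub, mul_one,
    ← halfIdempotent_comm hc, key2, sub_zero] at key4
  exact map_ofId_injective k (by rw [key4, map_zero])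

end Unitary

/-! ## Products of symmetric pairs -/

namespace SymmetricPair

variable {F : Type u} [Field F]

/-- The composition of isomorphisms of symmetric pairs. -/
def Iso.trans {X Y W : SymmetricPair F} (e : Iso X Y) (f : Iso Y W) : Iso X W where
  toEquiv R _ _ := (e.toEquiv R).trans (f.toEquiv R)
  natural φ g := by simp [e.natural, f.natural]
  comm g := by simp [e.comm, f.comm]

theorem IsProductOf.of_iso {T : SymmetricPair F → Prop} {X Y : SymmetricPair F} (e : Iso X Y)
    (h : Y.IsProductOf T) : X.IsProductOf T := by
  obtain ⟨n, P, hP, ⟨f⟩⟩ := h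
  exact ⟨n, P, hP, ⟨e.trans f⟩⟩

/-- A bijective homomorphism of symmetric pairs is an isomorphism. -/
noncomputable def Iso.ofBijective {X Y : SymmetricPair F}
    (ψ : ∀ (R : Type u) [CommRing R] [Algebra F R], X.G R →* Y.G R)
    (hnat : ∀ {R S : Type u} [CommRing R] [Algebra F R] [CommRing S] [Algebra F S]
      (φ : R →ₐ[F] S) (g : X.G R), ψ S (X.map φ g) = Y.map φ (ψ R g))
    (hθ : ∀ {R : Type u} [CommRing R] [Algebra F R] (g : X.G R), ψ R (X.θ g) = Y.θ (ψ R g))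
    (hbij : ∀ (R : Type u) [CommRing R] [Algebra F R], Function.Bijective (ψ R)) : Iso X Y where
  toEquiv R _ _ := MulEquiv.ofBijective (ψ R) (hbij R)
  natural φ g := hnat φ g
  comm g := hθ g

/-- A pair which maps to a finite family of pairs so that the map to the product is bijective is a
product of these pairs. -/
theorem isProductOf_of_bijective {ι : Type*} [Finite ι] {T : SymmetricPair F → Prop}
    {X : SymmetricPair F} (P : ι → SymmetricPair F) (hT : ∀ i, T (P i))
    (ψ : ∀ (i : ι) (R : Type u) [CommRing R] [Algebra F R], X.G R →* (P i).G R)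
    (hnat : ∀ (i : ι) {R S : Type u} [CommRing R] [Algebra F R] [CommRing S] [Algebra F S]
      (φ : R →ₐ[F] S) (g : X.G R), ψ i S (X.map φ g) = (P i).map φ (ψ i R g))
    (hθ : ∀ (i : ι) {R : Type u} [CommRing R] [Algebra F R] (g : X.G R),
      ψ i R (X.θ g) = (P i).θ (ψ i R g))
    (hbij : ∀ (R : Type u) [CommRing R] [Algebra F R],
      Function.Bijective fun (g : X.G R) i => ψ i R g) : X.IsProductOf T := by
  obtain ⟨n, ⟨e⟩⟩ := Finite.exists_equiv_fin ι
  refine ⟨n, fun j => P (e.symm j), fun j => hT _, ⟨Iso.ofBijective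
    (fun R _ _ => MonoidHom.mk' (fun g => fun j => ψ (e.symm j) R g)
      fun g h => funext fun j => map_mul _ g h)
    (fun φ g => funext fun j => hnat _ φ g) (fun g => funext fun j => hθ _ g)
    fun R _ _ => ?_⟩⟩
  refine ⟨fun g h hgh => (hbij R).1 (funext fun i => ?_), fun y => ?_⟩
  · have := congrFun hgh (e i)
    change ψ (e.symm (e i)) R g = ψ (e.symm (e i)) R h at this
    rwa [e.symm_apply_apply] at this
  · obtain ⟨g, hg⟩ := (hbij R).2 (Equiv.piCongrLeft (fun i => (P i).G R) e.symm y)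
    exact ⟨g, funext fun j => (congrFun hg (e.symm j)).trans
      (Equiv.piCongrLeft_apply_apply (fun i => (P i).G R) e.symm y j)⟩

end SymmetricPair

/-! ## Algebras with an anti-involution which permutes a family of factors -/

section Components

variable {F : Type u} [Field F]

theorem bijective_baseChange_pi {κ : Type u} [Finite κ] {M : Type u} {N : κ → Type u}
    [AddCommGroup M] [Module F M] [∀ i, AddCommGroup (N i)] [∀ i, Module F (N i)]
    (f : ∀ i, M →ₗ[F] N i) (hf : Function.Bijective fun m i => f i m) (R : Type u) [CommRing R]
    [Algebra F R] : Function.Bijective fun (y : R ⊗[F] M) i => (f i).baseChange R y := by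
  classical
  have := Fintype.ofFinite κ
  let e : M ≃ₗ[F] ∀ i, N i := LinearEquiv.ofBijective (LinearMap.pi f) hf
  let E := (e.baseChange F R M (∀ i, N i)).trans (TensorProduct.piRight F R R N)
  have : (fun (y : R ⊗[F] M) i => (f i).baseChange R y) = E := by
    funext y i
    induction y with
    | zero => simp
    | add x y hx hy => rw [map_add, hx, hy, map_add]; rfl
    | tmul r m =>
      simp only [LinearMap.baseChange_tmul]
      simp [E]
      rfl
  rw [this]
  exact E.bijective

variable {Z : Type u} [Ring Z] [Algebra F Z] {ι : Type u} {A : ι → Type u}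
  [∀ m, Ring (A m)] [∀ m, Algebra F (A m)] (ρ : ∀ m, Z →ₐ[F] A m)
  (hρ : Function.Bijective fun y m => ρ m y) (st : ι → ι) (hst : ∀ m, st (st m) = m)
  (a : AntiInvolution F Z) (hker : ∀ m y, ρ m (a.toLin y) = 0 ↔ ρ (st m) y = 0)
  (p : ι → ℕ) (hp : Function.Injective p)

include hρ hst hker hp

/-- For factors `m` and `st m` that are exchanged, the component of `y` at `st m` can be traded for
that of `a(y)` at `m`. The numbering `p` selects one index from each exchanged pair. Only kernels
are compared, so no identification of a factor with the opposite of its partner is needed. -/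
theorem bijective_components : Function.Bijective
    fun (y : Z) (k : {m // st m = m} ⊕ ({m // p m < p (st m)} ⊕ {m // p m < p (st m)})) =>
      (Sum.rec (fun i => (ρ i).toLinearMap)
        (Sum.rec (fun j => (ρ j).toLinearMap) (fun j => (ρ j).toLinearMap ∘ₗ a.toLin)) k :
          Z →ₗ[F] A (Sum.elim Subtype.val (Sum.elim Subtype.val Subtype.val) k)) y := by
  classical
  constructor
  · rw [show (fun (y : Z) (k : {m // st m = m} ⊕
        ({m // p m < p (st m)} ⊕ {m // p m < p (st m)})) =>
        (Sum.rec (fun i => (ρ i).toLinearMap)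
        (Sum.rec (fun j => (ρ j).toLinearMap) (fun j => (ρ j).toLinearMap ∘ₗ a.toLin)) k :
          Z →ₗ[F] A (Sum.elim Subtype.val (Sum.elim Subtype.val Subtype.val) k)) y) =
        LinearMap.pi (R := F) fun k => (Sum.rec (fun i => (ρ i).toLinearMap)
        (Sum.rec (fun j => (ρ j).toLinearMap) (fun j => (ρ j).toLinearMap ∘ₗ a.toLin)) k :
          Z →ₗ[F] A (Sum.elim Subtype.val (Sum.elim Subtype.val Subtype.val) k)) from rfl,
      ← LinearMap.ker_eq_bot, LinearMap.ker_eq_bot']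
    intro y hy
    apply hρ.1
    funext m
    change ρ m y = ρ m 0
    rw [map_zero]
    rcases lt_trichotomy (p m) (p (st m)) with h | h | h
    · exact congrFun hy (.inr (.inl ⟨m, h⟩))
    · exact congrFun hy (.inl ⟨m, (hp h).symm⟩)
    · have h1 : p (st m) < p (st (st m)) := by rwa [hst]
      have h2 : ρ (st m) (a.toLin y) = 0 := congrFun hy (.inr (.inr ⟨st m, h1⟩))
      rw [hker, hst] at h2
      exact h2
  · intro z
    obtain ⟨y₁, h₁⟩ := hρ.2 fun m =>
      if h : st m = m then z (.inl ⟨m, h⟩) else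
        if h : p m < p (st m) then z (.inr (.inl ⟨m, h⟩)) else 0
    obtain ⟨y₂, h₂⟩ := hρ.2 fun m => if h : p m < p (st m) then z (.inr (.inr ⟨m, h⟩)) else 0
    have h₁' := fun m => congrFun h₁ m
    have h₂' := fun m => congrFun h₂ m
    -- `y₁` is supported at the fixed and selected indices. `y₂` is supported at the selected ones,
    -- so `a y₂` lives at their partners and the two contributions do not interfere.
    refine ⟨y₁ + a.toLin y₂, funext fun k => ?_⟩
    rcases k with ⟨m, hm⟩ | ⟨m, hm⟩ | ⟨m, hm⟩
    · change ρ m (y₁ + a.toLin y₂) = _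
      have h3 : ρ m (a.toLin y₂) = 0 := by
        rw [hker, hm]
        refine (h₂' m).trans (dif_neg ?_)
        rw [hm]; exact lt_irrefl _
      rw [map_add, h3, add_zero]
      exact (h₁' m).trans (dif_pos hm)
    · change ρ m (y₁ + a.toLin y₂) = _
      have hne : st m ≠ m := fun h => by rw [h] at hm; exact lt_irrefl _ hm
      have h3 : ρ m (a.toLin y₂) = 0 := by
        rw [hker]
        refine (h₂' (st m)).trans (dif_neg ?_)
        rw [hst]; exact lt_asymm hm
      rw [map_add, h3, add_zero]
      exact (h₁' m).trans ((dif_neg hne).trans (dif_pos hm))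
    · change ρ m (a.toLin (y₁ + a.toLin y₂)) = _
      have h3 : ρ m (a.toLin y₁) = 0 := by
        rw [hker]
        refine (h₁' (st m)).trans ((dif_neg ?_).trans (dif_neg ?_))
        · rw [hst]; intro h; rw [← h] at hm; exact lt_irrefl _ hm
        · rw [hst]; exact lt_asymm hm
      rw [map_add, map_add, h3, zero_add, a.invol]
      exact (h₂' m).trans (dif_pos hm)

/-- After every extension of scalars, an element of an algebra with an anti-involution is determined
by its components in the factors fixed by the anti-involution, and by those of the element and of
its image in one of each two factors that are exchanged; all such components occur. -/
theorem existsUnique_components_baseChange [Finite ι] (R : Type u) [CommRing R] [Algebra F R]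
    (u : ∀ i : {m // st m = m}, R ⊗[F] A i) (v w : ∀ j : {m // p m < p (st m)}, R ⊗[F] A j) :
    ∃! y : R ⊗[F] Z,
      (∀ i : {m // st m = m}, Algebra.TensorProduct.map (AlgHom.id F R) (ρ i) y = u i) ∧
      (∀ j : {m // p m < p (st m)}, Algebra.TensorProduct.map (AlgHom.id F R) (ρ j) y = v j) ∧
      ∀ j : {m // p m < p (st m)}, Algebra.TensorProduct.map (AlgHom.id F R) (ρ j) (a.ext R y) = w j := by
  have h := bijective_baseChange_pi
    (κ := {m // st m = m} ⊕ ({m // p m < p (st m)} ⊕ {m // p m < p (st m)})) _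
    (bijective_components ρ hρ st hst a hker p hp) R
  have key : ∀ (m : ι) (y : R ⊗[F] Z), Algebra.TensorProduct.map (AlgHom.id F R) (ρ m) y =
      (ρ m).toLinearMap.baseChange R y := by
    intro m y
    induction y with
    | zero => simp
    | add x y hx hy => rw [map_add, hx, hy, map_add]
    | tmul r x => simp
  have key2 : ∀ (m : ι) (y : R ⊗[F] Z), Algebra.TensorProduct.map (AlgHom.id F R) (ρ m) (a.ext R y) =
      ((ρ m).toLinearMap ∘ₗ a.toLin).baseChange R y := by
    intro m y
    rw [key, AntiInvolution.ext, LinearMap.baseChange_comp]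
    rfl
  obtain ⟨y, hy⟩ := h.2 fun k => Sum.rec u (Sum.rec v w) k
  refine ⟨y, ⟨fun i => ?_, fun j => ?_, fun j => ?_⟩, fun y' h' => h.1 (funext fun k => ?_)⟩
  · exact (key i y).trans (congrFun hy (.inl i))
  · exact (key j y).trans (congrFun hy (.inr (.inl j)))
  · exact (key2 j y).trans (congrFun hy (.inr (.inr j)))
  · refine Eq.trans ?_ (congrFun hy k).symm
    rcases k with i | j | j
    · exact (key i y').symm.trans (h'.1 i)
    · exact (key j y').symm.trans (h'.2.1 j)
    · exact (key2 j y').symm.trans (h'.2.2 j)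

end Components

section Push

variable {F Z A : Type u} [Field F] [Ring Z] [Algebra F Z] [Ring A] [Algebra F A]

/-- The homomorphism of groups of units of `R`-points induced by a homomorphism of algebras. -/
noncomputable def unitsPush (ρ : Z →ₐ[F] A) (R : Type u) [CommRing R] [Algebra F R] :
    (R ⊗[F] Z)ˣ →* (R ⊗[F] A)ˣ :=
  Units.map (Algebra.TensorProduct.map (AlgHom.id F R) ρ : R ⊗[F] Z →* R ⊗[F] A)

variable (ρ : Z →ₐ[F] A) {R S : Type u} [CommRing R] [Algebra F R] [CommRing S] [Algebra F S]

theorem val_unitsPush (g : (R ⊗[F] Z)ˣ) : (unitsPush ρ R g : R ⊗[F] A) =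
    Algebra.TensorProduct.map (AlgHom.id F R) ρ g := rfl

theorem unitsPush_unitsMap (φ : R →ₐ[F] S) (g : (R ⊗[F] Z)ˣ) :
    unitsPush ρ S (unitsMap Z φ g) = unitsMap A φ (unitsPush ρ R g) := by
  apply Units.ext
  change Algebra.TensorProduct.map (AlgHom.id F S) ρ
    (Algebra.TensorProduct.map φ (AlgHom.id F Z) (g : R ⊗[F] Z)) =
    Algebra.TensorProduct.map φ (AlgHom.id F A)
      (Algebra.TensorProduct.map (AlgHom.id F R) ρ (g : R ⊗[F] Z))
  rw [← AlgHom.comp_apply, ← AlgHom.comp_apply, ← Algebra.TensorProduct.map_comp,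
    ← Algebra.TensorProduct.map_comp, AlgHom.id_comp, AlgHom.id_comp, AlgHom.comp_id,
    AlgHom.comp_id]

theorem map_ext_of_comm {a : AntiInvolution F Z} {a' : AntiInvolution F A}
    (h : ∀ y, ρ (a.toLin y) = a'.toLin (ρ y)) (y : R ⊗[F] Z) :
    Algebra.TensorProduct.map (AlgHom.id F R) ρ (a.ext R y) =
      a'.ext R (Algebra.TensorProduct.map (AlgHom.id F R) ρ y) := by
  induction y with
  | zero => simp
  | add x y hx hy => simp [hx, hy]
  | tmul r x => simp [AntiInvolution.ext_tmul, h]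

theorem unitsPush_unitsInv {a : AntiInvolution F Z} {a' : AntiInvolution F A}
    (h : ∀ y, ρ (a.toLin y) = a'.toLin (ρ y)) (g : (R ⊗[F] Z)ˣ) :
    unitsPush ρ R (a.unitsInv g) = a'.unitsInv (unitsPush ρ R g) :=
  Units.ext (map_ext_of_comm ρ h _)

theorem unitsPush_unitsAut {b : Z →ₐ[F] Z} {b' : A →ₐ[F] A} (h : ∀ y, ρ (b y) = b' (ρ y))
    (g : (R ⊗[F] Z)ˣ) :
    unitsPush ρ R (unitsAut b R g) = unitsAut b' R (unitsPush ρ R g) := by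
  apply Units.ext
  change Algebra.TensorProduct.map (AlgHom.id F R) ρ
    (Algebra.TensorProduct.map (AlgHom.id F R) b (g : R ⊗[F] Z)) =
    Algebra.TensorProduct.map (AlgHom.id F R) b'
      (Algebra.TensorProduct.map (AlgHom.id F R) ρ (g : R ⊗[F] Z))
  rw [← AlgHom.comp_apply, ← AlgHom.comp_apply, ← Algebra.TensorProduct.map_comp,
    ← Algebra.TensorProduct.map_comp, show ρ.comp b = b'.comp ρ from AlgHom.ext h]

end Push

/-! ### Splitting the pairs of an algebra with anti-involution along its factors. -/

section Products

open SymmetricPair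

variable {F : Type u} [Field F] {Z : Type u} [Ring Z] [Algebra F Z] {ι : Type u} [Finite ι]
  {A : ι → Type u} [∀ m, Ring (A m)] [∀ m, Algebra F (A m)] (ρ : ∀ m, Z →ₐ[F] A m)
  (hρ : Function.Bijective fun y m => ρ m y) (st : ι → ι) (hst : ∀ m, st (st m) = m)
  (a : AntiInvolution F Z) (hker : ∀ m y, ρ m (a.toLin y) = 0 ↔ ρ (st m) y = 0)
  (p : ι → ℕ) (hp : Function.Injective p)

include hρ hst hker hp

theorem ext_components {R : Type u} [CommRing R] [Algebra F R] {x y : R ⊗[F] Z}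
    (h1 : ∀ i : {m // st m = m}, Algebra.TensorProduct.map (AlgHom.id F R) (ρ i) x =
      Algebra.TensorProduct.map (AlgHom.id F R) (ρ i) y)
    (h2 : ∀ j : {m // p m < p (st m)}, Algebra.TensorProduct.map (AlgHom.id F R) (ρ j) x =
      Algebra.TensorProduct.map (AlgHom.id F R) (ρ j) y)
    (h3 : ∀ j : {m // p m < p (st m)},
      Algebra.TensorProduct.map (AlgHom.id F R) (ρ j) (a.ext R x) =
      Algebra.TensorProduct.map (AlgHom.id F R) (ρ j) (a.ext R y)) : x = y :=
  (existsUnique_components_baseChange ρ hρ st hst a hker p hp R _ _ _).unique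
    ⟨h1, h2, h3⟩ ⟨fun _ => rfl, fun _ => rfl, fun _ => rfl⟩

theorem exists_unit_components {R : Type u} [CommRing R] [Algebra F R]
    (u : ∀ i : {m // st m = m}, (R ⊗[F] A i)ˣ) (v w : ∀ j : {m // p m < p (st m)}, (R ⊗[F] A j)ˣ) :
    ∃ y : (R ⊗[F] Z)ˣ, (∀ i : {m // st m = m}, unitsPush (ρ i) R y = u i) ∧
      (∀ j : {m // p m < p (st m)}, unitsPush (ρ j) R y = v j) ∧
      ∀ j : {m // p m < p (st m)}, unitsPush (ρ j) R (a.unitsInv y) = w j := by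
  have hc := existsUnique_components_baseChange ρ hρ st hst a hker p hp R
  -- `unitsInv` is `a(y⁻¹)`, so prescribing `w` for it means prescribing `w⁻¹` for `a(y)` and `w`
  -- for `a` of the inverse.
  obtain ⟨y, ⟨h1, h2, h3⟩, -⟩ := hc (fun i => u i) (fun j => v j)
    (fun j => ((w j)⁻¹ : (R ⊗[F] A j)ˣ))
  obtain ⟨y', ⟨h1', h2', h3'⟩, -⟩ := hc (fun i => ((u i)⁻¹ : (R ⊗[F] A i)ˣ))
    (fun j => ((v j)⁻¹ : (R ⊗[F] A j)ˣ)) (fun j => w j)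
  have e1 : y * y' = 1 := ext_components ρ hρ st hst a hker p hp
    (fun i => by rw [map_mul, h1, h1', Units.mul_inv, map_one])
    (fun i => by rw [map_mul, h2, h2', Units.mul_inv, map_one])
    (fun i => by rw [a.ext_mul, map_mul, h3, h3', Units.mul_inv, a.ext_one, map_one])
  have e2 : y' * y = 1 := ext_components ρ hρ st hst a hker p hp
    (fun i => by rw [map_mul, h1, h1', Units.inv_mul, map_one])
    (fun i => by rw [map_mul, h2, h2', Units.inv_mul, map_one])
    (fun i => by rw [a.ext_mul, map_mul, h3, h3', Units.inv_mul, a.ext_one, map_one])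
  exact ⟨⟨y, y', e1, e2⟩, fun i => Units.ext (h1 i), fun j => Units.ext (h2 j),
    fun j => Units.ext (h3' j)⟩

/-- The pair of an algebra with anti-involution is the product of those of its factors: the ones
fixed by the anti-involution give pairs of the same kind, and the ones which are exchanged give
diagonal pairs. -/
theorem isProductOf_generalLinearPair {T : SymmetricPair F → Prop}
    (aI : ∀ i : {m // st m = m}, AntiInvolution F (A i))
    (haI : ∀ (i : {m // st m = m}) (y : Z), ρ i (a.toLin y) = (aI i).toLin (ρ i y))
    (hI : ∀ i, T (generalLinearPair (aI i)))
    (hJ : ∀ j : {m // p m < p (st m)}, T (diagonalPair F (A j))) :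
    (generalLinearPair a).IsProductOf T := by
  refine isProductOf_of_bijective (ι := {m // st m = m} ⊕ {m // p m < p (st m)})
    (Sum.rec (fun i => generalLinearPair (aI i)) (fun j => diagonalPair F (A j)))
    (Sum.rec hI hJ)
    (Sum.rec (fun i R _ _ => unitsPush (ρ i) R)
      (fun j R _ _ => (unitsPush (ρ j) R).prod ((unitsPush (ρ j) R).comp a.unitsInv)))
    ?_ ?_ ?_
  · rintro (i | j) R S _ _ _ _ φ g
    · exact unitsPush_unitsMap (ρ i) φ g
    · refine Prod.ext (unitsPush_unitsMap (ρ j) φ g) ?_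
      refine Eq.trans ?_ (unitsPush_unitsMap (ρ j) φ _)
      exact congrArg (unitsPush (ρ j) S) (unitsMap_unitsInv a φ g).symm
  · rintro (i | j) R _ _ g
    · exact unitsPush_unitsInv (ρ i) (haI i) g
    -- An exchanged pair of factors is recorded by the components of `g` and `θ(g)` at one of them;
    -- applying `θ` swaps these.
    · exact Prod.ext rfl (congrArg (unitsPush (ρ j) R) (unitsInv_unitsInv a R g))
  · intro R _ _
    constructor
    · intro (g : (R ⊗[F] Z)ˣ) (h : (R ⊗[F] Z)ˣ) hgh
      have hinv : g⁻¹ = h⁻¹ := by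
        apply Units.ext
        refine ext_components ρ hρ st hst a hker p hp (fun i => ?_) (fun j => ?_) (fun j => ?_)
        · have h1 : unitsPush (ρ i) R g = unitsPush (ρ i) R h := congrFun hgh (.inl i)
          rw [← val_unitsPush, ← val_unitsPush, map_inv, map_inv, h1]
        · have h1 : unitsPush (ρ j) R g = unitsPush (ρ j) R h :=
            congrArg Prod.fst (congrFun hgh (.inr j))
          rw [← val_unitsPush, ← val_unitsPush, map_inv, map_inv, h1]
        · have h1 : unitsPush (ρ j) R (a.unitsInv g) = unitsPush (ρ j) R (a.unitsInv h) :=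
            congrArg Prod.snd (congrFun hgh (.inr j))
          exact congrArg Units.val h1
      exact inv_injective hinv
    · intro y
      obtain ⟨g, h1, h2, h3⟩ := exists_unit_components ρ hρ st hst a hker p hp (R := R)
        (fun i => y (.inl i)) (fun j => Prod.fst (y (.inr j))) (fun j => Prod.snd (y (.inr j)))
      refine ⟨g, funext ?_⟩
      rintro (i | j)
      · exact h1 i
      · exact Prod.ext (h2 j) (h3 j)

/-- The unitary pair of an algebra with anti-involution is the product of those of its factors: the
ones fixed by the anti-involution give pairs of the same kind, and the ones which are exchanged
give pairs of groups of units. -/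
theorem isProductOf_unitaryPair {T : SymmetricPair F → Prop} (b : Z →ₐ[F] Z)
    (hb : ∀ x, b (b x) = x) (hab : ∀ x, b (a.toLin x) = a.toLin (b x))
    (aI : ∀ i : {m // st m = m}, AntiInvolution F (A i)) (bI : ∀ i : {m // st m = m}, A i →ₐ[F] A i)
    (hbI : ∀ i x, bI i (bI i x) = x)
    (habI : ∀ i x, bI i ((aI i).toLin x) = (aI i).toLin (bI i x))
    (haI : ∀ (i : {m // st m = m}) (y : Z), ρ i (a.toLin y) = (aI i).toLin (ρ i y))
    (hbρ : ∀ (i : {m // st m = m}) (y : Z), ρ i (b y) = bI i (ρ i y))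
    (aJ : ∀ j : {m // p m < p (st m)}, AntiInvolution F (A j))
    (haJ : ∀ (j : {m // p m < p (st m)}) (y : Z), ρ j (b (a.toLin y)) = (aJ j).toLin (ρ j y))
    (hI : ∀ i, T (unitaryPair (aI i) (bI i) (hbI i) (habI i)))
    (hJ : ∀ j, T (generalLinearPair (aJ j))) :
    (unitaryPair a b hb hab).IsProductOf T := by
  have hfix : ∀ {R : Type u} [CommRing R] [Algebra F R] (g : unitaryPoints a R),
      a.unitsInv (g : (R ⊗[F] Z)ˣ) = g := fun g => (unitsInv_eq_iff a _ _).mpr g.2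
  refine isProductOf_of_bijective (ι := {m // st m = m} ⊕ {m // p m < p (st m)})
    (Sum.rec (fun i => unitaryPair (aI i) (bI i) (hbI i) (habI i))
      (fun j => generalLinearPair (aJ j)))
    (Sum.rec hI hJ)
    (Sum.rec
      (fun i R _ _ => ((unitsPush (ρ i) R).comp (unitaryPoints a R).subtype).codRestrict
        (unitaryPoints (aI i) R) fun g => (unitsInv_eq_iff (aI i) R _).mp (by
          change (aI i).unitsInv (unitsPush (ρ i) R g) = unitsPush (ρ i) R g
          rw [← unitsPush_unitsInv (ρ i) (haI i), hfix]))
      (fun j R _ _ => (unitsPush (ρ j) R).comp (unitaryPoints a R).subtype))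
    ?_ ?_ ?_
  · rintro (i | j) R S _ _ _ _ φ ⟨g, hg⟩
    · exact Subtype.ext (unitsPush_unitsMap (ρ i) φ g)
    · exact unitsPush_unitsMap (ρ j) φ g
  · rintro (i | j) R _ _ (g : unitaryPoints a R)
    · exact Subtype.ext (unitsPush_unitsAut (ρ i) (hbρ i) g.1)
    -- On the unitary group `g = a(g)⁻¹`, so `b(g) = b(a(g)⁻¹)`. The anti-involution `b ∘ a`
    -- preserves the selected factor, and this gives the involution of a general linear pair there.
    · change unitsPush (ρ j) R (unitsAut b R g.1) = (aJ j).unitsInv (unitsPush (ρ j) R g.1)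
      rw [← unitsPush_unitsInv (a := a.comp b hb hab) (ρ j) (haJ j), comp_unitsInv, hfix]
  · intro R _ _
    constructor
    · intro (g : unitaryPoints a R) (h : unitaryPoints a R) hgh
      refine Subtype.ext (Units.ext ?_)
      have h2 : ∀ j : {m // p m < p (st m)},
          unitsPush (ρ j) R g.1 = unitsPush (ρ j) R h.1 := fun j => congrFun hgh (.inr j)
      refine ext_components ρ hρ st hst a hker p hp (fun i => ?_) (fun j => ?_) (fun j => ?_)
      · exact congrArg Units.val (congrArg Subtype.val (congrFun hgh (.inl i)))
      · exact congrArg Units.val (h2 j)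
      · have h3 : ∀ g : unitaryPoints a R, a.ext R (g : (R ⊗[F] Z)ˣ) =
            ((g : (R ⊗[F] Z)ˣ)⁻¹ : (R ⊗[F] Z)ˣ) := fun g => by
          have h4 : a.unitsInv (g : (R ⊗[F] Z)ˣ)⁻¹ = (g : (R ⊗[F] Z)ˣ)⁻¹ := by
            rw [map_inv, hfix]
          have h5 : ((a.unitsInv (g : (R ⊗[F] Z)ˣ)⁻¹ : (R ⊗[F] Z)ˣ) : R ⊗[F] Z) =
            a.ext R (((g : (R ⊗[F] Z)ˣ)⁻¹)⁻¹ : (R ⊗[F] Z)ˣ) := rfl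
          rw [h4, inv_inv] at h5
          exact h5.symm
        rw [h3, h3, ← val_unitsPush, ← val_unitsPush, map_inv, map_inv, h2]
    · intro y
      let y₁ : ∀ i : {m // st m = m}, unitaryPoints (aI i) R := fun i => y (.inl i)
      let y₂ : ∀ j : {m // p m < p (st m)}, (R ⊗[F] A j)ˣ := fun j => y (.inr j)
      -- Prescribing the same component `y₂` for `g` and for `a(g)⁻¹` is what forces `g` to be
      -- unitary.
      obtain ⟨g, h1, h2, h3⟩ := exists_unit_components ρ hρ st hst a hker p hp (R := R)
        (fun i => y₁ i) y₂ y₂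
      have hg : a.unitsInv g = g := by
        have hinv : (a.unitsInv g)⁻¹ = g⁻¹ := by
          apply Units.ext
          refine ext_components ρ hρ st hst a hker p hp (fun i => ?_) (fun j => ?_) (fun j => ?_)
          · rw [← val_unitsPush, ← val_unitsPush, map_inv, map_inv,
              unitsPush_unitsInv (ρ i) (haI i), h1, (unitsInv_eq_iff (aI i) R _).mpr (y₁ i).2]
          · rw [← val_unitsPush, ← val_unitsPush, map_inv, map_inv, h2, h3]
          · change (unitsPush (ρ j) R (a.unitsInv (a.unitsInv g)) : R ⊗[F] A j) =
              unitsPush (ρ j) R (a.unitsInv g)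
            rw [unitsInv_unitsInv, h2, h3]
        exact inv_injective hinv
      refine ⟨(⟨g, (unitsInv_eq_iff a R g).mp hg⟩ : unitaryPoints a R), funext ?_⟩
      rintro (i | j)
      · exact Subtype.ext (h1 i)
      · exact h2 j

end Products

/-! ## Centralizers -/

section Centralizer

open SymmetricPair

variable {F : Type u} [Field F]

/-- The inverse of an isomorphism of symmetric pairs. -/
def SymmetricPair.Iso.symm {X Y : SymmetricPair F} (e : Iso X Y) : Iso Y X where
  toEquiv R _ _ := (e.toEquiv R).symm
  natural φ g := by
    rw [MulEquiv.symm_apply_eq, e.natural, MulEquiv.apply_symm_apply]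
  comm g := by
    rw [MulEquiv.symm_apply_eq, e.comm, MulEquiv.apply_symm_apply]

/-- The types of the factors of a product may be enlarged by isomorphic pairs. -/
theorem SymmetricPair.IsProductOf.of_exists_iso {T : SymmetricPair F → Prop} {X : SymmetricPair F}
    (h : X.IsProductOf fun P => ∃ Q, T Q ∧ Nonempty (Iso P Q)) : X.IsProductOf T := by
  obtain ⟨n, P, hP, ⟨f⟩⟩ := h
  choose Q hQ e using hP
  have e' : ∀ i, Iso (P i) (Q i) := fun i => (e i).some
  exact ⟨n, Q, hQ, ⟨f.trans
    { toEquiv := fun R _ _ => MulEquiv.piCongrRight fun i => (e' i).toEquiv R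
      natural := fun φ g => funext fun i => (e' i).natural φ (g i)
      comm := fun g => funext fun i => (e' i).comm (g i) }⟩⟩

variable {E Z : Type u} [Ring E] [Algebra F E] [Ring Z] [Algebra F Z] (i : Z →ₐ[F] E)
  (hi : Function.Injective i)

include hi

theorem unitsPush_injective (R : Type u) [CommRing R] [Algebra F R] :
    Function.Injective (unitsPush i R) := by
  have h : Function.Injective (Algebra.TensorProduct.map (AlgHom.id F R) i) :=
    Module.Flat.lTensor_preserves_injective_linearMap (M := R) i.toLinearMap hi
  exact Units.map_injective h

theorem AntiInvolution.exists_restrict (a : AntiInvolution F E)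
    (ha : ∀ z, a.toLin (i z) ∈ Set.range i) :
    ∃ a' : AntiInvolution F Z, ∀ z, i (a'.toLin z) = a.toLin (i z) := by
  choose f hf using ha
  exact ⟨{
    toLin :=
      { toFun := f
        map_add' := fun x y => hi (by simp [hf])
        map_smul' := fun r x => hi (by simp [hf]) }
    map_mul' := fun x y => hi (by simp [hf, a.map_mul'])
    invol := fun x => hi (by simp [hf, a.invol]) }, hf⟩

theorem AlgHom.exists_restrict (b : E →ₐ[F] E) (hb : ∀ z, b (i z) ∈ Set.range i) :
    ∃ b' : Z →ₐ[F] Z, ∀ z, i (b' z) = b (i z) := by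
  choose f hf using hb
  exact ⟨{
    toFun := f
    map_one' := hi (by simp [hf])
    map_mul' := fun x y => hi (by simp [hf])
    map_zero' := hi (by simp [hf])
    map_add' := fun x y => hi (by simp [hf])
    commutes' := fun r => hi (by simp [hf]) }, hf⟩

variable {x₀ : E} (hx₀ : ∀ y : E, y * x₀ = x₀ * y ↔ y ∈ Set.range i)

include hx₀

omit hi in
theorem commute_one_tmul_map {R : Type u} [CommRing R] [Algebra F R] (z : R ⊗[F] Z) :
    Algebra.TensorProduct.map (AlgHom.id F R) i z * (1 ⊗ₜ x₀) =
      (1 ⊗ₜ x₀) * Algebra.TensorProduct.map (AlgHom.id F R) i z := by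
  induction z with
  | zero => simp
  | add x y hx hy => rw [map_add, add_mul, mul_add, hx, hy]
  | tmul r z => simp [(hx₀ (i z)).mpr ⟨z, rfl⟩]

-- The centralizer is the kernel of the linear map `y ↦ y x₀ - x₀ y`, and flatness of `R` over `F`
-- preserves this kernel.
omit hi in
theorem exists_map_eq_of_commute {R : Type u} [CommRing R] [Algebra F R] (y : R ⊗[F] E)
    (hy : y * (1 ⊗ₜ x₀) = (1 ⊗ₜ x₀) * y) :
    ∃ z, Algebra.TensorProduct.map (AlgHom.id F R) i z = y := by
  have hex : Function.Exact i.toLinearMap (LinearMap.mulRight F x₀ - LinearMap.mulLeft F x₀) := by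
    intro y
    simp only [LinearMap.sub_apply, LinearMap.mulRight_apply, LinearMap.mulLeft_apply]
    rw [sub_eq_zero, hx₀]
    rfl
  refine (Module.Flat.lTensor_exact R hex y).mp ?_
  rw [LinearMap.lTensor_sub, LinearMap.sub_apply, sub_eq_zero]
  have h1 : ∀ y : R ⊗[F] E, (LinearMap.mulRight F x₀).lTensor R y = y * (1 ⊗ₜ x₀) := by
    intro y
    induction y with
    | zero => simp
    | add x y hx hy => rw [map_add, add_mul, hx, hy]
    | tmul r z => simp
  have h2 : ∀ y : R ⊗[F] E, (LinearMap.mulLeft F x₀).lTensor R y = (1 ⊗ₜ x₀) * y := by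
    intro y
    induction y with
    | zero => simp
    | add x y hx hy => rw [map_add, mul_add, hx, hy]
    | tmul r z => simp
  rw [h1, h2, hy]

theorem exists_unitsPush_eq_iff {R : Type u} [CommRing R] [Algebra F R] (u x : (R ⊗[F] E)ˣ)
    (hx : (x : R ⊗[F] E) = 1 ⊗ₜ x₀) : (∃ v, unitsPush i R v = u) ↔ u * x = x * u := by
  have hinj : Function.Injective (Algebra.TensorProduct.map (AlgHom.id F R) i) :=
    Module.Flat.lTensor_preserves_injective_linearMap (M := R) i.toLinearMap hi
  constructor
  · rintro ⟨v, rfl⟩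
    apply Units.ext
    rw [Units.val_mul, Units.val_mul, hx]
    exact commute_one_tmul_map i hx₀ (v : R ⊗[F] Z)
  · intro h
    have h' : u⁻¹ * x = x * u⁻¹ := (Commute.inv_left (show Commute u x from h)).eq
    have e1 := congrArg Units.val h
    have e2 := congrArg Units.val h'
    rw [Units.val_mul, Units.val_mul, hx] at e1 e2
    obtain ⟨z, hz⟩ := exists_map_eq_of_commute i hx₀ _ e1
    obtain ⟨w, hw⟩ := exists_map_eq_of_commute i hx₀ _ e2
    exact ⟨⟨z, w, hinj (by rw [map_mul, hz, hw, Units.mul_inv, map_one]),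
      hinj (by rw [map_mul, hz, hw, Units.inv_mul, map_one])⟩, Units.ext hz⟩

omit hi hx₀ in
theorem val_unitsMap_ofId {x : (F ⊗[F] E)ˣ} (hx : (x : F ⊗[F] E) = 1 ⊗ₜ x₀) (R : Type u)
    [CommRing R] [Algebra F R] :
    (unitsMap E (Algebra.ofId F R) x : R ⊗[F] E) = 1 ⊗ₜ x₀ := by
  change Algebra.TensorProduct.map (Algebra.ofId F R) (AlgHom.id F E) (x : F ⊗[F] E) = _
  rw [hx]
  simp

/-- Descendants of the pair of an algebra with anti-involution. -/
theorem nonempty_iso_centralizerPair_generalLinearPair (a : AntiInvolution F E)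
    (a' : AntiInvolution F Z) (ha : ∀ z, i (a'.toLin z) = a.toLin (i z)) (g : (F ⊗[F] E)ˣ)
    (hg : (a.symmetrization g : F ⊗[F] E) = 1 ⊗ₜ x₀) :
    Nonempty (Iso ((generalLinearPair a).centralizerPair g) (generalLinearPair a')) := by
  have hx : ∀ (R : Type u) [CommRing R] [Algebra F R],
      ((unitsMap E (Algebra.ofId F R) (a.symmetrization g) : (R ⊗[F] E)ˣ) : R ⊗[F] E) = 1 ⊗ₜ x₀ :=
    fun R _ _ => val_unitsMap_ofId hg R
  refine ⟨(Iso.ofBijective (X := generalLinearPair a')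
    (Y := (generalLinearPair a).centralizerPair g)
    (fun R _ _ => (unitsPush i R).codRestrict
      (Subgroup.centralizer {unitsMap E (Algebra.ofId F R) (a.symmetrization g)}) fun v =>
        Subgroup.mem_centralizer_singleton_iff.mpr
          ((exists_unitsPush_eq_iff i hi hx₀ _ _ (hx R)).mp ⟨v, rfl⟩))
    (fun φ v => Subtype.ext (unitsPush_unitsMap i φ v))
    (fun v => Subtype.ext (unitsPush_unitsInv i ha v)) fun R _ _ => ⟨?_, ?_⟩).symm⟩
  · intro v w hvw
    exact unitsPush_injective i hi R (congrArg Subtype.val hvw)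
  · rintro ⟨u, hu⟩
    obtain ⟨v, hv⟩ := (exists_unitsPush_eq_iff i hi hx₀ u _ (hx R)).mpr
      (Subgroup.mem_centralizer_singleton_iff.mp hu)
    exact ⟨v, Subtype.ext hv⟩

/-- Descendants of the unitary pair of an algebra with anti-involution. -/
theorem nonempty_iso_centralizerPair_unitaryPair (a : AntiInvolution F E) (b : E →ₐ[F] E)
    (hb : ∀ x, b (b x) = x) (hab : ∀ x, b (a.toLin x) = a.toLin (b x))
    (a' : AntiInvolution F Z) (b' : Z →ₐ[F] Z)
    (hb' : ∀ x, b' (b' x) = x) (hab' : ∀ x, b' (a'.toLin x) = a'.toLin (b' x))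
    (ha : ∀ z, i (a'.toLin z) = a.toLin (i z)) (hbi : ∀ z, i (b' z) = b (i z))
    (g : unitaryPoints a F)
    (hg : (unitarySymmetrization b (g : (F ⊗[F] E)ˣ) : F ⊗[F] E) = 1 ⊗ₜ x₀) :
    Nonempty (Iso ((unitaryPair a b hb hab).centralizerPair g)
      (unitaryPair a' b' hb' hab')) := by
  let X := unitaryPair a b hb hab
  have hs : ∀ (R : Type u) [CommRing R] [Algebra F R],
      (X.map (Algebra.ofId F R) (X.s g) : unitaryPoints a R).1 =
        unitsMap E (Algebra.ofId F R) (unitarySymmetrization b (g : (F ⊗[F] E)ˣ)) :=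
    fun R _ _ => rfl
  have hx : ∀ (R : Type u) [CommRing R] [Algebra F R],
      (((X.map (Algebra.ofId F R) (X.s g) : unitaryPoints a R).1 : (R ⊗[F] E)ˣ) : R ⊗[F] E) =
        1 ⊗ₜ x₀ := fun R _ _ => by rw [hs]; exact val_unitsMap_ofId hg R
  have hmem : ∀ (R : Type u) [CommRing R] [Algebra F R] (u : X.G R),
      u ∈ Subgroup.centralizer {X.map (Algebra.ofId F R) (X.s g)} ↔
        ∃ v, unitsPush i R v = Subtype.val (p := (· ∈ unitaryPoints a R)) u := fun R _ _ u =>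
    (Subgroup.mem_centralizer_singleton_iff.trans Subtype.ext_iff).trans
      (exists_unitsPush_eq_iff i hi hx₀ _ _ (hx R)).symm
  have hfix : ∀ {R : Type u} [CommRing R] [Algebra F R] (v : (R ⊗[F] Z)ˣ),
      unitsPush i R v ∈ unitaryPoints a R ↔ v ∈ unitaryPoints a' R := fun {R} _ _ v => by
    refine (unitsInv_eq_iff a R _).symm.trans (Iff.trans ?_ (unitsInv_eq_iff a' R v))
    rw [← unitsPush_unitsInv i ha, (unitsPush_injective i hi R).eq_iff]
  refine ⟨(Iso.ofBijective (X := unitaryPair a' b' hb' hab') (Y := X.centralizerPair g)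
    (fun R _ _ => (((unitsPush i R).comp (unitaryPoints a' R).subtype).codRestrict
      (unitaryPoints a R) fun v => (hfix v.1).mpr v.2).codRestrict
      (Subgroup.centralizer {X.map (Algebra.ofId F R) (X.s g)}) fun v => (hmem R _).mpr ⟨v.1, rfl⟩)
    (fun φ v => Subtype.ext (Subtype.ext (unitsPush_unitsMap i φ v.1)))
    (fun v => Subtype.ext (Subtype.ext (unitsPush_unitsAut i hbi v.1))) fun R _ _ =>
      ⟨?_, ?_⟩).symm⟩
  · intro v w hvw
    exact Subtype.ext (unitsPush_injective i hi R
      (congrArg Subtype.val (congrArg Subtype.val hvw)))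
  · rintro ⟨u, hu⟩
    obtain ⟨v, hv⟩ := (hmem R u).mp hu
    have hv' : v ∈ unitaryPoints a' R := (hfix v).mp (by rw [hv]; exact u.2)
    exact ⟨(⟨v, hv'⟩ : unitaryPoints a' R), Subtype.ext (Subtype.ext hv)⟩

end Centralizer

/-! ## Modules over reduced artinian rings -/

namespace MaximalSpectrum

section Idempotents

variable {C : Type u} [CommRing C] [IsReduced C] [IsArtinianRing C]

theorem eq_zero_of_forall_mem {c : C} (h : ∀ m : MaximalSpectrum C, c ∈ m.asIdeal) : c = 0 := by
  apply (IsArtinianRing.equivPi C).injective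
  rw [map_zero]
  exact funext fun m => Ideal.Quotient.eq_zero_iff_mem.mpr (h m)

/-- The primitive idempotent of a reduced artinian ring at a maximal ideal. -/
noncomputable def idempotent (m : MaximalSpectrum C) : C :=
  open Classical in (IsArtinianRing.equivPi C).symm (Pi.single m 1)

theorem idempotent_mem {m m' : MaximalSpectrum C} (h : m' ≠ m) : m.idempotent ∈ m'.asIdeal := by
  classical
  rw [← Ideal.Quotient.eq_zero_iff_mem]
  have h1 := (IsArtinianRing.equivPi C).apply_symm_apply (Pi.single m 1)
  have h2 := congrFun h1 m'
  rw [Pi.single_eq_of_ne h] at h2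
  exact Eq.trans (by rw [idempotent]; congr!) h2

theorem one_sub_idempotent_mem (m : MaximalSpectrum C) : 1 - m.idempotent ∈ m.asIdeal := by
  classical
  rw [← Ideal.Quotient.eq_zero_iff_mem, map_sub, map_one, sub_eq_zero]
  have h1 := (IsArtinianRing.equivPi C).apply_symm_apply (Pi.single m 1)
  have h2 := congrFun h1 m
  rw [Pi.single_eq_same] at h2
  exact (h2.symm.trans (by rw [idempotent]; congr!))

theorem mul_idempotent_eq_zero_iff {m : MaximalSpectrum C} {c : C} :
    c * m.idempotent = 0 ↔ c ∈ m.asIdeal := by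
  constructor
  · intro h
    have h1 := m.asIdeal.mul_mem_left c m.one_sub_idempotent_mem
    rwa [mul_sub, h, mul_one, sub_zero] at h1
  · intro h
    refine eq_zero_of_forall_mem fun m' => ?_
    by_cases hm : m' = m
    · rw [hm]; exact Ideal.mul_mem_right _ _ h
    · exact Ideal.mul_mem_left _ _ (idempotent_mem hm)

theorem idempotent_mul_self (m : MaximalSpectrum C) : m.idempotent * m.idempotent = m.idempotent := by
  have h := mul_idempotent_eq_zero_iff.mpr m.one_sub_idempotent_mem
  rw [sub_mul, one_mul, sub_eq_zero] at h
  exact h.symm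

theorem idempotent_mul_of_ne {m m' : MaximalSpectrum C} (h : m' ≠ m) :
    m.idempotent * m'.idempotent = 0 :=
  mul_idempotent_eq_zero_iff.mpr (idempotent_mem h)

theorem eq_idempotent {m : MaximalSpectrum C} {c : C} (h1 : 1 - c ∈ m.asIdeal)
    (h2 : ∀ m', m' ≠ m → c ∈ m'.asIdeal) : c = m.idempotent := by
  rw [← sub_eq_zero]
  refine eq_zero_of_forall_mem fun m' => ?_
  by_cases hm : m' = m
  · rw [hm, show c - m.idempotent = (1 - m.idempotent) - (1 - c) by ring]
    exact Ideal.sub_mem _ m.one_sub_idempotent_mem h1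
  · exact Ideal.sub_mem _ (h2 _ hm) (idempotent_mem hm)

theorem sum_idempotent [Fintype (MaximalSpectrum C)] :
    ∑ m : MaximalSpectrum C, m.idempotent = 1 := by
  classical
  rw [← sub_eq_zero]
  refine eq_zero_of_forall_mem fun m => ?_
  rw [← Finset.add_sum_erase _ _ (Finset.mem_univ m),
    show ∀ a b c : C, a + b - c = b - (c - a) from fun a b c => by ring]
  exact Ideal.sub_mem _ (Ideal.sum_mem _ fun m' hm' =>
    idempotent_mem (Finset.ne_of_mem_erase hm').symm) m.one_sub_idempotent_mem

end Idempotents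

section Involution

variable {F C : Type u} [Field F] [CommRing C] [Algebra F C] (τ : C ≃ₐ[F] C)

/-- The action of an automorphism on the maximal ideals. -/
def comap (m : MaximalSpectrum C) : MaximalSpectrum C :=
  ⟨m.asIdeal.comap τ, Ideal.comap_isMaximal_of_equiv τ⟩

variable {τ}

theorem mem_comap {m : MaximalSpectrum C} {c : C} : c ∈ (m.comap τ).asIdeal ↔ τ c ∈ m.asIdeal :=
  Iff.rfl

theorem comap_comap (hτ : ∀ c, τ (τ c) = c) (m : MaximalSpectrum C) :
    (m.comap τ).comap τ = m := by
  apply MaximalSpectrum.ext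
  ext c
  rw [mem_comap, mem_comap, hτ]

theorem map_idempotent [IsReduced C] [IsArtinianRing C] (hτ : ∀ c, τ (τ c) = c)
    (m : MaximalSpectrum C) : τ m.idempotent = (m.comap τ).idempotent := by
  refine eq_idempotent ?_ fun m' hm' => ?_
  · rw [mem_comap, map_sub, map_one, hτ]
    exact m.one_sub_idempotent_mem
  · rw [← mem_comap]
    refine idempotent_mem fun h => hm' ?_
    rw [← h, comap_comap hτ]

end Involution

section Parts

variable {C : Type u} [CommRing C] (m : MaximalSpectrum C) (V : Type u) [AddCommGroup V] [Module C V]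

/-- The part of a module which is supported at a maximal ideal. -/
abbrev part : Submodule C V := Submodule.torsionBySet C V m.asIdeal

variable {V}

section

variable [IsReduced C] [IsArtinianRing C]

theorem mem_part_iff {v : V} : v ∈ m.part V ↔ m.idempotent • v = v := by
  rw [Submodule.mem_torsionBySet_iff]
  constructor
  · intro h
    have h1 := h ⟨_, m.one_sub_idempotent_mem⟩
    rw [sub_smul, one_smul, sub_eq_zero] at h1
    exact h1.symm
  · intro h c
    rw [← h, ← mul_smul, mul_idempotent_eq_zero_iff.mpr c.2, zero_smul]

theorem idempotent_smul_mem (v : V) : m.idempotent • v ∈ m.part V := by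
  rw [mem_part_iff, ← mul_smul, idempotent_mul_self]

end

variable {F : Type u} [Field F] [Algebra F C] [Module F V] [IsScalarTower F C V]

/-- The restriction of an endomorphism to the part of a module supported at a maximal ideal. -/
noncomputable def restrictPart : Module.End C V →ₐ[F] Module.End (C ⧸ m.asIdeal) (m.part V) where
  toFun z :=
    { toFun := fun v => ⟨z v, (Submodule.mem_torsionBySet_iff _ _).mpr fun c => by
        rw [← map_smul, (Submodule.mem_torsionBySet_iff _ _).mp v.2 c, map_zero]⟩
      map_add' := fun v w => Subtype.ext (map_add z _ _)
      map_smul' := fun k v => by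
        obtain ⟨c, rfl⟩ := Ideal.Quotient.mk_surjective k
        exact Subtype.ext (map_smul z c v.1) }
  map_one' := rfl
  map_mul' _ _ := rfl
  map_zero' := rfl
  map_add' _ _ := rfl
  commutes' _ := rfl

theorem coe_restrictPart (z : Module.End C V) (v : m.part V) :
    (m.restrictPart (F := F) z v : V) = z v := rfl

variable [IsReduced C] [IsArtinianRing C]

theorem restrictPart_eq_zero_iff {z : Module.End C V} :
    m.restrictPart (F := F) z = 0 ↔ m.idempotent • z = 0 := by
  constructor
  · intro h
    ext v
    have h1 := congrArg Subtype.val (LinearMap.congr_fun h ⟨_, m.idempotent_smul_mem v⟩)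
    rw [coe_restrictPart, map_smul] at h1
    exact h1
  · intro h
    ext v
    rw [coe_restrictPart, ← m.mem_part_iff.mp v.2, map_smul]
    exact LinearMap.congr_fun h v.1

/-- The idempotents of `C` are orthogonal with sum `1`, so `V` is the direct sum of its parts, and
every `C`-linear endomorphism preserves each of them. -/
theorem bijective_restrictPart : Function.Bijective
    fun (z : Module.End C V) (m : MaximalSpectrum C) => m.restrictPart (F := F) z := by
  classical
  have := Fintype.ofFinite (MaximalSpectrum C)
  constructor
  · intro z w h
    rw [← sub_eq_zero, ← one_smul C (z - w), ← sum_idempotent, Finset.sum_smul]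
    refine Finset.sum_eq_zero fun m _ => (m.restrictPart_eq_zero_iff (F := F)).mp ?_
    rw [map_sub, sub_eq_zero]
    exact congrFun h m
  · intro f
    let f' : ∀ m : MaximalSpectrum C, V →ₗ[C] V := fun m =>
      { toFun := fun v => f m ⟨_, m.idempotent_smul_mem v⟩
        map_add' := fun v w => by
          rw [← Submodule.coe_add, ← map_add]
          congr 3
          exact smul_add _ _ _
        map_smul' := fun c v => by
          rw [RingHom.id_apply, ← Submodule.coe_smul]
          congr 1
          refine Eq.trans ?_ (map_smul (f m) (Ideal.Quotient.mk _ c) _)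
          congr 1
          exact Subtype.ext (smul_comm _ _ _) }
    refine ⟨∑ m, f' m, funext fun m => LinearMap.ext fun v => Subtype.ext ?_⟩
    rw [coe_restrictPart, LinearMap.sum_apply, Finset.sum_eq_single m]
    · change ((f m ⟨_, m.idempotent_smul_mem v.1⟩ : m.part V) : V) = _
      congr 2
      exact Subtype.ext (m.mem_part_iff.mp v.2)
    · intro m' _ hm'
      change ((f m' ⟨_, m'.idempotent_smul_mem v.1⟩ : m'.part V) : V) = 0
      have h0 : (⟨_, m'.idempotent_smul_mem v.1⟩ : m'.part V) = 0 := Subtype.ext (by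
        change m'.idempotent • v.1 = 0
        rw [← m.mem_part_iff.mp v.2, ← mul_smul, idempotent_mul_of_ne hm'.symm, zero_smul])
      rw [h0, map_zero]
      rfl
    · intro h; exact absurd (Finset.mem_univ _) h

end Parts

end MaximalSpectrum

/-! ## Forms and traces -/

namespace HermitianForm

section Trace

variable {F K W : Type u} [Field F] [CharZero F] [Field K] [Algebra F K] [FiniteDimensional F K]

theorem eq_of_trace_mul_eq {x y : K}
    (h : ∀ k, Algebra.trace F K (k * x) = Algebra.trace F K (k * y)) : x = y := by
  rw [← sub_eq_zero]
  refine (traceForm_nondegenerate F K).2 _ fun k => ?_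
  rw [Algebra.traceForm_apply, mul_sub, map_sub, h, sub_self]

theorem exists_trace_mul_eq (f : K →ₗ[F] F) : ∃ x, ∀ k, Algebra.trace F K (k * x) = f k := by
  obtain ⟨x, hx⟩ :=
    (LinearMap.BilinForm.toDual (Algebra.traceForm F K) (traceForm_nondegenerate F K)).surjective f
  refine ⟨x, fun k => ?_⟩
  rw [← hx, LinearMap.BilinForm.toDual_def, Algebra.traceForm_apply, mul_comm]

omit [CharZero F] [FiniteDimensional F K] in
theorem trace_map_of_involutive (σ : K →+* K) (hσ : ∀ r : F, σ (algebraMap F K r) = algebraMap F K r)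
    (hσσ : ∀ k, σ (σ k) = k) (k : K) : Algebra.trace F K (σ k) = Algebra.trace F K k := by
  let s : K →ₐ[F] K := { σ with commutes' := hσ }
  let e : K ≃ₐ[F] K := AlgEquiv.ofAlgHom s s (AlgHom.ext hσσ) (AlgHom.ext hσσ)
  exact Algebra.trace_eq_of_algEquiv e k

variable [AddCommGroup W] [Module K W] [Module F W] [IsScalarTower F K W] {σ : K →+* K}

/-- A non-degenerate symmetric `F`-bilinear form on a `K`-space for which `σ` gives the adjoints of
the scalars is the trace of a hermitian form. -/
theorem exists_trace_form_eq (hσ : ∀ r : F, σ (algebraMap F K r) = algebraMap F K r)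
    (hσσ : ∀ k, σ (σ k) = k) (β : LinearMap.BilinForm F W) (hsymm : ∀ v w, β v w = β w v)
    (hnd : ∀ w, (∀ v, β v w = 0) → w = 0) (hβ : ∀ (k : K) v w, β (k • v) w = β v (σ k • w)) :
    ∃ B : HermitianForm σ W, ∀ v w, Algebra.trace F K (B.form v w) = β v w := by
  -- The value of the hermitian form at `(v, w)` is the element representing the functional `k ↦
  -- β(v, k w)` under the trace form. Its properties then follow from those of `β` by non-degeneracy
  -- of the trace.
  choose f hf using fun v w => exists_trace_mul_eq (F := F) (K := K)
    { toFun := fun k => β v (k • w)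
      map_add' := fun k l => by rw [add_smul, map_add]
      map_smul' := fun r k => by rw [smul_assoc, map_smul, RingHom.id_apply] }
  have hf : ∀ v w k, Algebra.trace F K (k * f v w) = β v (k • w) := hf
  have hσf : ∀ v w, σ (f v w) = f w v := fun v w => eq_of_trace_mul_eq (F := F) fun k => by
    rw [hf w v, hsymm, hβ, ← hf, ← trace_map_of_involutive σ hσ hσσ (k * _), map_mul σ, hσσ]
  let φ : W →ₛₗ[σ] W →ₗ[K] K := LinearMap.mk₂'ₛₗ σ (RingHom.id K) f
    (fun v v' w => eq_of_trace_mul_eq (F := F) fun k => by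
      rw [mul_add, map_add, hf, hf, hf, map_add, LinearMap.add_apply])
    (fun l v w => eq_of_trace_mul_eq (F := F) fun k => by
      rw [hf, hβ, smul_eq_mul, ← mul_assoc, hf, mul_comm k, mul_smul])
    (fun v w w' => eq_of_trace_mul_eq (F := F) fun k => by
      rw [mul_add, map_add, hf, hf, hf, smul_add, map_add])
    (fun l v w => eq_of_trace_mul_eq (F := F) fun k => by
      rw [hf, RingHom.id_apply, smul_eq_mul, ← mul_assoc, hf, mul_smul])
  have h1 : ∀ v w, Algebra.trace F K (φ v w) = β v w := fun v w => by
    change Algebra.trace F K (f v w) = _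
    rw [← one_mul (f v w), hf, one_smul]
  refine ⟨⟨φ, ⟨hσf⟩, fun v h => hnd _ fun w => ?_, fun w h => hnd _ fun v => ?_⟩, h1⟩
  · rw [hsymm, ← h1, h, map_zero]
  · rw [← h1, h, map_zero]

variable (F) (B : HermitianForm σ W)

/-- The trace of a hermitian form, as a bilinear form over the base field. -/
noncomputable def traceForm (hσ : ∀ r : F, σ (algebraMap F K r) = algebraMap F K r) :
    LinearMap.BilinForm F W :=
  LinearMap.mk₂ F (fun v w => Algebra.trace F K (B.form v w))
    (fun v v' w => by rw [map_add, LinearMap.add_apply, map_add])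
    (fun r v w => by
      rw [← algebraMap_smul K r v, map_smulₛₗ, hσ, algebraMap_smul, LinearMap.smul_apply, map_smul])
    (fun v w w' => by rw [map_add, map_add])
    (fun r v w => by rw [← algebraMap_smul K r w, map_smul, algebraMap_smul, map_smul])

variable (hσ : ∀ r : F, σ (algebraMap F K r) = algebraMap F K r)

omit [CharZero F] [FiniteDimensional F K] in
theorem traceForm_apply (v w : W) :
    B.traceForm F hσ v w = Algebra.trace F K (B.form v w) := rfl

variable {F B} {x x' y y' : W}

-- Scalars can be moved into the second argument, so non-degeneracy of the field trace recovers the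
-- value of the form from traces alone.
omit [Module F W] [IsScalarTower F K W] in
theorem form_eq_of_trace_eq
    (h : ∀ k : K, Algebra.trace F K (B.form x (k • y)) = Algebra.trace F K (B.form x' (k • y'))) :
    B.form x y = B.form x' y' :=
  eq_of_trace_mul_eq (F := F) fun k => by
    have := h k
    rwa [map_smul (B.form x), map_smul (B.form x'), smul_eq_mul, smul_eq_mul] at this

variable (F B)

omit [CharZero F] [FiniteDimensional F K] in
theorem traceForm_symm (hσσ : ∀ k, σ (σ k) = k) (v w : W) :
    B.traceForm F hσ v w = B.traceForm F hσ w v := by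
  rw [traceForm_apply, traceForm_apply, ← B.symm.eq v w]
  exact (trace_map_of_involutive σ hσ hσσ _).symm

theorem eq_zero_of_traceForm_eq_zero (w : W) (h : ∀ v, B.traceForm F hσ v w = 0)
    (hσσ : ∀ k, σ (σ k) = k) : w = 0 := by
  refine B.nondegenerate.1 _ fun v => ?_
  rw [← map_zero (B.form 0)]
  refine (B.form_eq_of_trace_eq (F := F) fun k => ?_)
  rw [← traceForm_apply F B hσ, traceForm_symm F B hσ hσσ, h, smul_zero, map_zero, map_zero]

omit [CharZero F] in
theorem traceForm_adjoint [FiniteDimensional K W] (f : Module.End K W) (v w : W) :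
    B.traceForm F hσ (f v) w = B.traceForm F hσ v ((B.adjointInvolution F hσ).toLin f w) := by
  rw [traceForm_apply, traceForm_apply]
  exact congrArg _ (B.form_adjoint_right F hσ f v w)

theorem eq_adjointInvolution_of_trace [FiniteDimensional K W] {f g : Module.End K W}
    (h : ∀ v w, Algebra.trace F K (B.form (f v) w) = Algebra.trace F K (B.form v (g w))) :
    g = (B.adjointInvolution F hσ).toLin f := by
  rw [← (B.adjointInvolution F hσ).invol g]
  congr 1
  refine (B.eq_adjoint F hσ fun x y => form_eq_of_trace_eq (F := F) fun k => ?_).symm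
  rw [map_smul (B.form _), map_smul (B.form _), ← map_smul (B.form _), ← map_smul (B.form _), h,
    map_smul g]

end Trace

end HermitianForm

/-! ### Forms and adjoints on the parts of `V` at the maximal ideals of `C`. -/

section Blocks

open MaximalSpectrum

attribute [local instance] Ideal.Quotient.field

variable {F C V : Type u} [Field F] [CommRing C] [Algebra F C] {τ : C ≃ₐ[F] C}

theorem MaximalSpectrum.exists_quotient_algEquiv (hτ : ∀ c, τ (τ c) = c) {m : MaximalSpectrum C}
    (hm : m.comap τ = m) : ∃ τ' : (C ⧸ m.asIdeal) ≃ₐ[F] (C ⧸ m.asIdeal),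
      ∀ c, τ' (Ideal.Quotient.mk _ c) = Ideal.Quotient.mk _ (τ c) := by
  have hle : m.asIdeal ≤ m.asIdeal.comap (τ : C →ₐ[F] C) := fun c hc => by
    rw [← hm, mem_comap] at hc; exact hc
  let s := Ideal.quotientMapₐ m.asIdeal (τ : C →ₐ[F] C) hle
  have hs : ∀ k, s (s k) = k := fun k => by
    obtain ⟨c, rfl⟩ := Ideal.Quotient.mk_surjective k
    exact congrArg (Ideal.Quotient.mk _) (hτ c)
  exact ⟨AlgEquiv.ofAlgHom s s (AlgHom.ext hs) (AlgHom.ext hs), fun c => rfl⟩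

variable [CharZero F] [IsReduced C] [IsArtinianRing C] [Module.Finite F C] [AddCommGroup V] [Module F V] [Module C V]
  [IsScalarTower F C V] [Module.Finite C V]

instance {C V : Type u} [CommRing C] [AddCommGroup V] [Module C V] [IsNoetherianRing C]
    [Module.Finite C V] (m : MaximalSpectrum C) : Module.Finite (C ⧸ m.asIdeal) (m.part V) :=
  Module.Finite.of_restrictScalars_finite C _ _

-- For a fixed ideal the idempotent is self-adjoint, so `β` stays non-degenerate on the part, where
-- it is the trace of a hermitian form over the residue field.
omit [Module.Finite C V] in
theorem MaximalSpectrum.exists_hermitianForm_part (hτ : ∀ c, τ (τ c) = c)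
    (β : LinearMap.BilinForm F V)
    (hsymm : ∀ v w, β v w = β w v) (hnd : ∀ w, (∀ v, β v w = 0) → w = 0)
    (hβ : ∀ (c : C) v w, β (c • v) w = β v (τ c • w)) {m : MaximalSpectrum C}
    (hm : m.comap τ = m) (τ' : (C ⧸ m.asIdeal) ≃ₐ[F] (C ⧸ m.asIdeal))
    (hτ' : ∀ c, τ' (Ideal.Quotient.mk _ c) = Ideal.Quotient.mk _ (τ c)) :
    ∃ B : HermitianForm (τ' : (C ⧸ m.asIdeal) →+* (C ⧸ m.asIdeal)) (m.part V),
      ∀ v w, Algebra.trace F (C ⧸ m.asIdeal) (B.form v w) = β v w := by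
  refine HermitianForm.exists_trace_form_eq (fun r => τ'.commutes r) (fun k => ?_)
    (β.compl₁₂ ((m.part V).subtype.restrictScalars F) ((m.part V).subtype.restrictScalars F))
    (fun v w => hsymm v w) (fun (w : m.part V) h => ?_)
    (fun k (v : m.part V) (w : m.part V) => ?_)
  · obtain ⟨c, rfl⟩ := Ideal.Quotient.mk_surjective k
    exact (congrArg τ' (hτ' c)).trans ((hτ' _).trans (by rw [hτ]))
  · refine Subtype.ext (hnd _ fun v => ?_)
    have h1 : β (m.idempotent • v) w = 0 := h ⟨_, m.idempotent_smul_mem v⟩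
    rw [hβ, map_idempotent hτ, hm, m.mem_part_iff.mp w.2] at h1
    exact h1
  · obtain ⟨c, rfl⟩ := Ideal.Quotient.mk_surjective k
    refine (hβ c v w).trans (congrArg (β v) ?_)
    have h1 : (τ' : (C ⧸ m.asIdeal) →+* (C ⧸ m.asIdeal)) (Ideal.Quotient.mk _ c) =
      Ideal.Quotient.mk _ (τ c) := hτ' c
    rw [h1]
    rfl

omit [IsReduced C] in
theorem MaximalSpectrum.restrictPart_adjoint (β : LinearMap.BilinForm F V)
    (a : AntiInvolution F (Module.End C V)) (ha : ∀ z v w, β (z v) w = β v (a.toLin z w))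
    {m : MaximalSpectrum C} {σ : (C ⧸ m.asIdeal) →+* (C ⧸ m.asIdeal)}
    (hσ : ∀ r : F, σ (algebraMap F _ r) = algebraMap F _ r)
    (B : HermitianForm σ (m.part V))
    (hB : ∀ v w, Algebra.trace F (C ⧸ m.asIdeal) (B.form v w) = β v w) (z : Module.End C V) :
    m.restrictPart (F := F) (a.toLin z) = (B.adjointInvolution F hσ).toLin (m.restrictPart (F := F) z) := by
  refine B.eq_adjointInvolution_of_trace F hσ fun v w => ?_
  rw [hB, hB]
  exact ha z v w

omit [CharZero F] [Module.Finite F C] [Module.Finite C V] in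
theorem MaximalSpectrum.restrictPart_eq_zero_iff_comap (hτ : ∀ c, τ (τ c) = c)
    (β : LinearMap.BilinForm F V)
    (hnd : ∀ w, (∀ v, β v w = 0) → w = 0)
    (hβ : ∀ (c : C) v w, β (c • v) w = β v (τ c • w))
    (a : AntiInvolution F (Module.End C V)) (ha : ∀ z v w, β (z v) w = β v (a.toLin z w))
    (m : MaximalSpectrum C) (z : Module.End C V) :
    m.restrictPart (F := F) (a.toLin z) = 0 ↔ (m.comap τ).restrictPart (F := F) z = 0 := by
  -- The adjoint is `τ`-semilinear, so it carries the component of `z` at the idempotent of one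
  -- ideal to the component of `a z` at the idempotent of the exchanged ideal.
  have key : ∀ (c : C) (z : Module.End C V), a.toLin (c • z) = τ c • a.toLin z := fun c z =>
    LinearMap.ext fun w => by
      rw [← sub_eq_zero]
      refine hnd _ fun v => ?_
      rw [map_sub, ← ha, LinearMap.smul_apply, LinearMap.smul_apply, hβ, ha, map_smul (a.toLin z),
        sub_self]
  rw [restrictPart_eq_zero_iff, restrictPart_eq_zero_iff, ← map_idempotent hτ]
  constructor
  · intro h
    have h1 := congrArg a.toLin h
    rwa [key, a.invol, map_zero] at h1
  · intro h
    have h1 := congrArg a.toLin h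
    rwa [key, hτ, map_zero] at h1

end Blocks

/-! ## The factors of the pair of an algebra of endomorphisms -/

section GeneralLinear

open MaximalSpectrum SymmetricPair

attribute [local instance] Ideal.Quotient.field

variable {F C V : Type u} [Field F] [CharZero F] [CommRing C] [Algebra F C] [IsReduced C]
  [IsArtinianRing C] [Module.Finite F C] [AddCommGroup V] [Module F V] [Module C V]
  [IsScalarTower F C V] [Module.Finite C V] {τ : C ≃ₐ[F] C}

/-- The type `T` is left open so that the orthogonal and the hermitian cases share one argument. An
enumeration of the maximal ideals selects one from each exchanged pair. -/
theorem isProductOf_generalLinearPair_end {T : SymmetricPair F → Prop} (hτ : ∀ c, τ (τ c) = c)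
    (β : LinearMap.BilinForm F V) (hsymm : ∀ v w, β v w = β w v)
    (hnd : ∀ w, (∀ v, β v w = 0) → w = 0) (hβ : ∀ (c : C) v w, β (c • v) w = β v (τ c • w))
    (a : AntiInvolution F (Module.End C V)) (ha : ∀ z v w, β (z v) w = β v (a.toLin z w))
    (hI : ∀ m : MaximalSpectrum C, m.comap τ = m →
      ∀ τ' : (C ⧸ m.asIdeal) ≃ₐ[F] (C ⧸ m.asIdeal),
      (∀ c, τ' (Ideal.Quotient.mk _ c) = Ideal.Quotient.mk _ (τ c)) →
      ∀ B : HermitianForm (τ' : (C ⧸ m.asIdeal) →+* (C ⧸ m.asIdeal)) (m.part V),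
      T (generalLinearPair (B.adjointInvolution F fun r => τ'.commutes r)))
    (hJ : ∀ m : MaximalSpectrum C, m.comap τ ≠ m →
      T (diagonalPair F (Module.End (C ⧸ m.asIdeal) (m.part V)))) :
    (generalLinearPair a).IsProductOf T := by
  obtain ⟨n, ⟨e⟩⟩ := Finite.exists_equiv_fin (MaximalSpectrum C)
  choose τ' hτ' using fun i : {m : MaximalSpectrum C // m.comap τ = m} =>
    exists_quotient_algEquiv hτ i.2
  choose B hB using fun i : {m : MaximalSpectrum C // m.comap τ = m} =>
    exists_hermitianForm_part hτ β hsymm hnd hβ i.2 (τ' i) (hτ' i)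
  let aI : ∀ i : {m : MaximalSpectrum C // m.comap τ = m},
      AntiInvolution F (Module.End (C ⧸ i.1.asIdeal) (i.1.part V)) := fun i =>
    (B i).adjointInvolution F fun r => (τ' i).commutes r
  refine isProductOf_generalLinearPair
    (A := fun m : MaximalSpectrum C => Module.End (C ⧸ m.asIdeal) (m.part V))
    (fun m => m.restrictPart (F := F)) bijective_restrictPart
    (fun m => m.comap τ) (comap_comap hτ) a (restrictPart_eq_zero_iff_comap hτ β hnd hβ a ha)
    (fun m => (e m : ℕ)) (Fin.val_injective.comp e.injective) aI (fun i z => ?_)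
    (fun i => hI i i.2 (τ' i) (hτ' i) (B i)) (fun j => hJ j fun h => ?_)
  · exact restrictPart_adjoint β a ha _ (B i) (hB i) z
  · have h1 := j.2
    rw [h] at h1
    exact lt_irrefl _ h1

end GeneralLinear

/-! ## Centralizers of generators of commutative algebras of endomorphisms -/

section Generator

open MaximalSpectrum SymmetricPair

variable {F K C V : Type u} [Field F] [Field K] [Algebra F K] [CommRing C] [Algebra F C]
  [Algebra K C] [IsScalarTower F K C] [AddCommGroup V] [Module F V] [Module K V]
  [IsScalarTower F K V] [Module C V] [IsScalarTower K C V] [IsScalarTower F C V]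

variable (F K C V) in
/-- Restriction of scalars for endomorphisms, as a homomorphism of algebras. -/
def endRestrictScalars : Module.End C V →ₐ[F] Module.End K V where
  toFun z := z.restrictScalars K
  map_one' := rfl
  map_mul' _ _ := rfl
  map_zero' := rfl
  map_add' _ _ := rfl
  commutes' _ := rfl

omit [IsScalarTower F K C] in
theorem endRestrictScalars_injective : Function.Injective (endRestrictScalars F K C V) :=
  LinearMap.restrictScalars_injective K

variable {x : C} (hx : Algebra.adjoin K {x} = ⊤)

include hx

-- Since `x` generates `C` over `K`, commuting with `x` is the same as being `C`-linear.
omit [IsScalarTower F K C] in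
theorem commute_lsmul_iff (y : Module.End K V) :
    y * Algebra.lsmul K K V x = Algebra.lsmul K K V x * y ↔
      y ∈ Set.range (endRestrictScalars F K C V) := by
  constructor
  · intro h
    have h1 : ∀ c : C, ∀ v, y (c • v) = c • y v := fun c => by
      have hc : c ∈ Algebra.adjoin K {x} := by rw [hx]; trivial
      induction hc using Algebra.adjoin_induction with
      | mem c hc =>
        obtain rfl : c = x := hc
        exact fun v => LinearMap.congr_fun h v
      | algebraMap k => intro v; rw [algebraMap_smul, algebraMap_smul, map_smul]
      | add c d _ _ hc hd => intro v; rw [add_smul, add_smul, map_add, hc, hd]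
      | mul c d _ _ hc hd => intro v; rw [mul_smul, mul_smul, hc, hd]
    exact ⟨{ y with map_smul' := h1 }, rfl⟩
  · rintro ⟨z, rfl⟩
    exact LinearMap.ext fun v => map_smul z x v

-- The adjoint sends the generators of the image of `C` back into it, hence preserves the whole
-- image; as `C` is commutative, the induced anti-automorphism is an automorphism.
omit [IsScalarTower F C V] in
theorem AntiInvolution.exists_algEquiv [FaithfulSMul C V] (a : AntiInvolution F (Module.End K V))
    (ha : ∀ k : K, a.toLin (algebraMap K _ k) ∈ Set.range (Algebra.lsmul K K V : C →ₐ[K] _))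
    (hax : a.toLin (Algebra.lsmul K K V x) ∈ Set.range (Algebra.lsmul K K V : C →ₐ[K] _)) :
    ∃ τ : C ≃ₐ[F] C, (∀ c, τ (τ c) = c) ∧
      ∀ c, (Algebra.lsmul K K V (τ c) : Module.End K V) = a.toLin (Algebra.lsmul K K V c) := by
  let j : C →ₐ[F] Module.End K V := (Algebra.lsmul K K V : C →ₐ[K] _).restrictScalars F
  have hj : Function.Injective j := fun c d h =>
    FaithfulSMul.eq_of_smul_eq_smul fun v : V => LinearMap.congr_fun h v
  have hmem : ∀ c : C, a.toLin (j c) ∈ Set.range j := fun c => by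
    have hc : c ∈ Algebra.adjoin K {x} := by rw [hx]; trivial
    induction hc using Algebra.adjoin_induction with
    | mem c hc =>
      obtain rfl : c = x := hc
      exact hax
    | algebraMap k =>
      have h1 : j (algebraMap K C k) = algebraMap K _ k :=
        (Algebra.lsmul K K V : C →ₐ[K] _).commutes k
      rw [h1]
      exact ha k
    | add c d _ _ hc hd =>
      obtain ⟨c', hc'⟩ := hc
      obtain ⟨d', hd'⟩ := hd
      exact ⟨c' + d', by rw [map_add, map_add, map_add, hc', hd']⟩
    | mul c d _ _ hc hd =>
      obtain ⟨c', hc'⟩ := hc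
      obtain ⟨d', hd'⟩ := hd
      exact ⟨d' * c', by rw [map_mul, map_mul, a.map_mul', hc', hd']⟩
  obtain ⟨a', ha'⟩ := a.exists_restrict j hj hmem
  let t : C →ₐ[F] C := AlgHom.ofLinearMap a'.toLin a'.map_one'
    fun c d => (a'.map_mul' c d).trans (mul_comm _ _)
  exact ⟨AlgEquiv.ofAlgHom t t (AlgHom.ext a'.invol) (AlgHom.ext a'.invol), a'.invol, ha'⟩

omit [IsScalarTower F K C] in
theorem AntiInvolution.map_endRestrictScalars_mem (a : AntiInvolution F (Module.End K V))
    {τ : C ≃ₐ[F] C} (hτ : ∀ c, τ (τ c) = c)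
    (hτa : ∀ c, (Algebra.lsmul K K V (τ c) : Module.End K V) = a.toLin (Algebra.lsmul K K V c))
    (z : Module.End C V) :
    a.toLin (endRestrictScalars F K C V z) ∈ Set.range (endRestrictScalars F K C V) := by
  rw [← commute_lsmul_iff hx]
  have h1 : (Algebra.lsmul K K V x : Module.End K V) = a.toLin (Algebra.lsmul K K V (τ x)) := by
    rw [← hτa, hτ]
  rw [h1, ← a.map_mul', ← a.map_mul']
  congr 1
  exact LinearMap.ext fun v => (map_smul z (τ x) v).symm

attribute [local instance] Ideal.Quotient.field

theorem isProductOf_centralizerPair_generalLinearPair [CharZero F] [FiniteDimensional F K]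
    [FiniteDimensional K V] [Module.Finite C V] [IsReduced C]
    [IsArtinianRing C] [Module.Finite F C] [FaithfulSMul C V] {T : SymmetricPair F → Prop}
    {σ : K →+* K} (hσ : ∀ r : F, σ (algebraMap F K r) = algebraMap F K r)
    (hσσ : ∀ k, σ (σ k) = k) (B : HermitianForm σ V) (g : (F ⊗[F] Module.End K V)ˣ)
    (hg : ((B.adjointInvolution F hσ).symmetrization g : F ⊗[F] Module.End K V) =
      1 ⊗ₜ Algebra.lsmul K K V x)
    (hT : ∀ τ : C ≃ₐ[F] C, (∀ k : K, τ (algebraMap K C k) = algebraMap K C (σ k)) → τ x = x →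
      (∀ c, τ (τ c) = c) →
      (∀ m : MaximalSpectrum C, m.comap τ = m →
        ∀ τ' : (C ⧸ m.asIdeal) ≃ₐ[F] (C ⧸ m.asIdeal),
        (∀ c, τ' (Ideal.Quotient.mk _ c) = Ideal.Quotient.mk _ (τ c)) →
        ∀ B : HermitianForm (τ' : (C ⧸ m.asIdeal) →+* (C ⧸ m.asIdeal)) (m.part V),
        T (generalLinearPair (B.adjointInvolution F fun r => τ'.commutes r))) ∧
      (∀ m : MaximalSpectrum C, m.comap τ ≠ m →
        T (diagonalPair F (Module.End (C ⧸ m.asIdeal) (m.part V))))) :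
    ((generalLinearPair (B.adjointInvolution F hσ)).centralizerPair g).IsProductOf T := by
  set a := B.adjointInvolution F hσ with ha
  have hinj : Function.Injective (Algebra.lsmul K K V : C →ₐ[K] _) := fun c d h =>
    FaithfulSMul.eq_of_smul_eq_smul fun v : V => LinearMap.congr_fun h v
  have hak : ∀ k : K, a.toLin (algebraMap K _ k) = algebraMap K _ (σ k) := fun k =>
    (B.eq_adjoint F hσ fun v w => by simp [Module.algebraMap_end_apply, hσσ]).symm
  have hax : a.toLin (Algebra.lsmul K K V x) = Algebra.lsmul K K V x := by
    have h1 := a.ext_symmetrization g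
    rw [hg, a.ext_tmul] at h1
    have h2 := congrArg (TensorProduct.lid F _) h1
    rwa [TensorProduct.lid_tmul, TensorProduct.lid_tmul, one_smul, one_smul] at h2
  obtain ⟨τ, hτ, hτa⟩ := a.exists_algEquiv hx
    (fun k => ⟨algebraMap K C (σ k), by rw [AlgHom.commutes, hak]⟩) ⟨x, hax.symm⟩
  obtain ⟨a', ha'⟩ := a.exists_restrict (endRestrictScalars F K C V) endRestrictScalars_injective
    (a.map_endRestrictScalars_mem hx hτ hτa)
  obtain ⟨hI, hJ⟩ := hT τ (fun k => hinj (by rw [hτa, AlgHom.commutes, AlgHom.commutes, hak]))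
    (hinj (by rw [hτa, hax])) hτ
  obtain ⟨e⟩ := nonempty_iso_centralizerPair_generalLinearPair (endRestrictScalars F K C V)
    endRestrictScalars_injective (commute_lsmul_iff hx) a a' ha' g hg
  -- The hermitian form over `K` is replaced by its trace over `F`. The resulting bilinear form can
  -- then be refined to hermitian forms over the residue fields of `C`.
  refine IsProductOf.of_iso e (isProductOf_generalLinearPair_end hτ (B.traceForm F hσ)
    (B.traceForm_symm F hσ hσσ) (fun w h => B.eq_zero_of_traceForm_eq_zero F hσ w h hσσ)
    (fun c v w => ?_) a' (fun z v w => ?_) hI hJ)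
  · refine (B.traceForm_adjoint F hσ (Algebra.lsmul K K V c) v w).trans ?_
    rw [← ha, ← hτa]
    rfl
  · refine (B.traceForm_adjoint F hσ (endRestrictScalars F K C V z) v w).trans ?_
    rw [← ha, ← ha']
    rfl

end Generator

/-! ## Descendants of the pairs `(GL(V), O(V))` and `(GL(V), U(V))` -/

section Descendants

open MaximalSpectrum SymmetricPair

open scoped IsMulCommutative

theorem exists_eq_one_tmul {F E : Type u} [Field F] [AddCommGroup E] [Module F E] (y : F ⊗[F] E) :
    ∃ x : E, y = 1 ⊗ₜ x :=
  ⟨TensorProduct.lid F E y, ((TensorProduct.lid F E).symm_apply_apply y).symm⟩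

variable {F K V : Type u} [Field F] [CharZero F] [Field K] [Algebra F K] [FiniteDimensional F K]
  [AddCommGroup V] [Module F V] [Module K V] [IsScalarTower F K V] [FiniteDimensional K V]

theorem hasRescaling_end : HasRescaling (AlgebraicClosure F)
    (AlgebraicClosure F ⊗[F] Module.End K V) := fun s n hs hsn hn _ hc =>
  exists_unit_commute_rescale_tensor_end s n hs hsn hn hc

/-- The closed orbit argument controls polynomials with coefficients in `F`; separability of `K/F`
passes from `F[x]` to `K[x]`. -/
theorem isReduced_adjoin_singleton_of_tmul {x : Module.End K V}
    (h : ∀ f : F[X], IsNilpotent (Polynomial.aeval ((1 : F) ⊗ₜ[F] x) f) →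
      Polynomial.aeval ((1 : F) ⊗ₜ[F] x) f = 0) : IsReduced (Algebra.adjoin K {x}) := by
  have : Module.Finite F (Module.End K V) := Module.Finite.trans K _
  have : IsReduced (Algebra.adjoin F {x}) := by
    rw [isReduced_adjoin_singleton_iff]
    intro f hf
    let i : Module.End K V →ₐ[F] F ⊗[F] Module.End K V := Algebra.TensorProduct.includeRight
    have hi : Function.Injective i := fun y z hyz => by
      have := congrArg (TensorProduct.lid F _) hyz
      simpa [i] using this
    have h1 : Polynomial.aeval ((1 : F) ⊗ₜ[F] x) f = i (Polynomial.aeval x f) :=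
      Polynomial.aeval_algHom_apply i x f
    apply hi
    rw [map_zero, ← h1]
    exact h f (by rw [h1]; exact hf.map i)
  exact isReduced_adjoin_singleton_extend F K _ x

omit [FiniteDimensional K V] in
theorem adjoin_singleton_self_eq_top (x : Module.End K V) :
    Algebra.adjoin K {(⟨x, Algebra.self_mem_adjoin_singleton K x⟩ : Algebra.adjoin K {x})} = ⊤ := by
  rw [← Algebra.adjoin_adjoin_coe_preimage (R := K) (s := {x})]
  congr 1
  ext y
  simp [Subtype.ext_iff]

attribute [local instance] Ideal.Quotient.field

theorem isProductOf_isDescendant_generalLinearPair {T : SymmetricPair F → Prop}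
    {σ : K →+* K} (hσ : ∀ r : F, σ (algebraMap F K r) = algebraMap F K r)
    (hσσ : ∀ k, σ (σ k) = k) (B : HermitianForm σ V)
    (hT : ∀ (C : Type u) [CommRing C] [Algebra F C] [Algebra K C] [IsScalarTower F K C]
      [Module C V] [IsScalarTower F C V] [Module.Finite C V] [IsArtinianRing C] [Module.Finite F C]
      (x : C), Algebra.adjoin K {x} = ⊤ →
      ∀ τ : C ≃ₐ[F] C, (∀ k : K, τ (algebraMap K C k) = algebraMap K C (σ k)) → τ x = x →
      (∀ c, τ (τ c) = c) →
      (∀ m : MaximalSpectrum C, m.comap τ = m →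
        ∀ τ' : (C ⧸ m.asIdeal) ≃ₐ[F] (C ⧸ m.asIdeal),
        (∀ c, τ' (Ideal.Quotient.mk _ c) = Ideal.Quotient.mk _ (τ c)) →
        ∀ B : HermitianForm (τ' : (C ⧸ m.asIdeal) →+* (C ⧸ m.asIdeal)) (m.part V),
        T (generalLinearPair (B.adjointInvolution F fun r => τ'.commutes r))) ∧
      (∀ m : MaximalSpectrum C, m.comap τ ≠ m →
        T (diagonalPair F (Module.End (C ⧸ m.asIdeal) (m.part V)))))
    {Y : SymmetricPair F} (hY : (generalLinearPair (B.adjointInvolution F hσ)).IsDescendant Y) :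
    Y.IsProductOf T := by
  obtain ⟨g, hg, rfl⟩ := hY
  have : Module.Finite F (Module.End K V) := Module.Finite.trans K _
  obtain ⟨x, hx⟩ := exists_eq_one_tmul
    ((B.adjointInvolution F hσ).symmetrization g : F ⊗[F] Module.End K V)
  have hss := aeval_eq_zero_of_hasClosedOrbit_generalLinearPair (B.adjointInvolution F hσ)
    hasRescaling_end g hg
  rw [hx] at hss
  have := isReduced_adjoin_singleton_of_tmul hss
  have : IsArtinianRing (Algebra.adjoin K {x}) := IsArtinianRing.of_finite K _
  have : Module.Finite F (Algebra.adjoin K {x}) := Module.Finite.trans K _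
  have : Module.Finite (Algebra.adjoin K {x}) V := Module.Finite.of_restrictScalars_finite K _ _
  exact isProductOf_centralizerPair_generalLinearPair (adjoin_singleton_self_eq_top x) hσ hσσ B g hx
    (hT _ _ (adjoin_singleton_self_eq_top x))

theorem isProductOf_isGLO {V : Type u} [AddCommGroup V] [Module F V] [FiniteDimensional F V]
    (B : QuadraticSpaceForm F V) {Y : SymmetricPair F} (hY : (pairGLO F B).IsDescendant Y) :
    Y.IsProductOf (IsGLO F) := by
  refine isProductOf_isDescendant_generalLinearPair (fun _ => rfl) (fun _ => rfl) B
    (fun C _ i₁ i₂ hi _ _ _ _ _ x hx τ hτF hτx _ => ?_) hY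
  -- Here `K = F`, and `C` carries two structures of an `F`-algebra, which the scalar tower forces
  -- to agree.
  obtain rfl : i₁ = i₂ := Algebra.algebra_ext _ _ fun r =>
    @IsScalarTower.algebraMap_apply F F C _ _ _ _ i₂ i₁ hi r
  -- `τ` fixes the base field and the generator `x`, so it is trivial: no ideals are exchanged and
  -- all residue forms are symmetric bilinear.
  have hτ : ∀ c : C, τ c = c := fun c => by
    have hc : c ∈ Algebra.adjoin F {x} := by rw [hx]; trivial
    induction hc using Algebra.adjoin_induction with
    | mem c hc =>
      obtain rfl : c = x := hc
      exact hτx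
    | algebraMap k => exact hτF k
    | add c d _ _ hc hd => rw [map_add, hc, hd]
    | mul c d _ _ hc hd => rw [map_mul, hc, hd]
  refine ⟨fun m _ τ' hτ' B' => ?_, fun m hm => absurd (MaximalSpectrum.ext ?_) hm⟩
  · obtain rfl : τ' = AlgEquiv.refl := AlgEquiv.ext fun k => by
      obtain ⟨c, rfl⟩ := Ideal.Quotient.mk_surjective k
      rw [hτ', hτ]
      rfl
    exact ⟨C ⧸ m.asIdeal, inferInstance, inferInstance, inferInstance, m.part V, inferInstance,
      inferInstance, inferInstance, inferInstance, inferInstance, B', rfl⟩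
  · ext c
    rw [mem_comap, hτ]

omit [CharZero F] in
theorem algEquiv_involutive_of_finrank_eq_two {D : Type u} [Field D] [Algebra F D]
    [FiniteDimensional F D] (h : Module.finrank F D = 2) (τ : D ≃ₐ[F] D) (d : D) :
    τ (τ d) = d := by
  have h1 := AlgEquiv.card_le (F := F) (K := D)
  rw [h] at h1
  have h2 : Fintype.card (D ≃ₐ[F] D) ≠ 0 := Fintype.card_ne_zero
  have h3 : τ ^ Fintype.card (D ≃ₐ[F] D) = 1 := pow_card_eq_one
  have h4 : τ ^ 2 = 1 := by
    generalize Fintype.card (D ≃ₐ[F] D) = n at h1 h2 h3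
    interval_cases n
    · exact absurd rfl h2
    · rw [pow_one] at h3; rw [h3, one_pow]
    · exact h3
  exact AlgEquiv.congr_fun h4 d

theorem isProductOf_isGLU {D : Type u} [Field D] [Algebra F D] [FiniteDimensional F D]
    (hD : Module.finrank F D = 2) (τ : D ≃ₐ[F] D) {V : Type u} [AddCommGroup V] [Module D V]
    [FiniteDimensional D V] [Module F V] [IsScalarTower F D V] (B : HermitianForm (τ : D →+* D) V)
    {Y : SymmetricPair F} (hY : (pairGLU F τ B).IsDescendant Y) :
    Y.IsProductOf fun P => IsGLGL F D P ∨ IsGLU F τ P := by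
  refine isProductOf_isDescendant_generalLinearPair (fun r => τ.commutes r)
    (algEquiv_involutive_of_finrank_eq_two hD τ) B
    (fun C _ _ _ _ _ _ _ _ _ x _ t htD _ ht => ⟨fun m hm t' ht' B' => .inr ?_, fun m _ => .inl ?_⟩) hY
  · refine ⟨C ⧸ m.asIdeal, inferInstance, inferInstance, inferInstance, inferInstance, inferInstance,
      t', fun k => ?_, fun d => ?_, m.part V, inferInstance, inferInstance, inferInstance,
      inferInstance, inferInstance, B', rfl⟩
    · obtain ⟨c, rfl⟩ := Ideal.Quotient.mk_surjective k
      rw [ht', ht', ht]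
    · exact (ht' _).trans (congrArg _ (htD d))
  · exact ⟨C ⧸ m.asIdeal, inferInstance, inferInstance, inferInstance, inferInstance, inferInstance,
      m.part V, inferInstance, inferInstance, inferInstance, inferInstance, inferInstance, rfl⟩

end Descendants

/-! ## Descent along a quadratic extension -/

section Transport

open SymmetricPair

variable {F A A' : Type u} [Field F] [Ring A] [Algebra F A] [Ring A'] [Algebra F A']

theorem nonempty_iso_unitaryPair_of_algEquiv (ρ : A ≃ₐ[F] A') (a : AntiInvolution F A)
    (b : A →ₐ[F] A) (hb : ∀ x, b (b x) = x) (hab : ∀ x, b (a.toLin x) = a.toLin (b x))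
    (a' : AntiInvolution F A') (b' : A' →ₐ[F] A') (hb' : ∀ x, b' (b' x) = x)
    (hab' : ∀ x, b' (a'.toLin x) = a'.toLin (b' x))
    (ha : ∀ z, ρ (a.toLin z) = a'.toLin (ρ z)) (hbρ : ∀ z, ρ (b z) = b' (ρ z)) :
    Nonempty (Iso (unitaryPair a b hb hab) (unitaryPair a' b' hb' hab')) := by
  let r : A →ₐ[F] A' := ρ
  have hinj := fun (R : Type u) [CommRing R] [Algebra F R] =>
    unitsPush_injective r ρ.injective R
  have hfix : ∀ {R : Type u} [CommRing R] [Algebra F R] (v : (R ⊗[F] A)ˣ),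
      unitsPush r R v ∈ unitaryPoints a' R ↔ v ∈ unitaryPoints a R := fun {R} _ _ v => by
    refine (unitsInv_eq_iff a' R _).symm.trans (Iff.trans ?_ (unitsInv_eq_iff a R v))
    rw [← unitsPush_unitsInv r ha, (hinj R).eq_iff]
  refine ⟨Iso.ofBijective (X := unitaryPair a b hb hab) (Y := unitaryPair a' b' hb' hab')
    (fun R _ _ => ((unitsPush r R).comp (unitaryPoints a R).subtype).codRestrict
      (unitaryPoints a' R) fun v => (hfix v.1).mpr v.2)
    (fun φ v => Subtype.ext (unitsPush_unitsMap r φ v.1))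
    (fun v => Subtype.ext (unitsPush_unitsAut r hbρ v.1)) fun R _ _ => ⟨?_, ?_⟩⟩
  · intro v w hvw
    exact Subtype.ext (hinj R (congrArg Subtype.val hvw))
  · intro (u : unitaryPoints a' R)
    have hv : unitsPush r R (unitsPush (ρ.symm : A' →ₐ[F] A) R u.1) = u.1 := by
      apply Units.ext
      change Algebra.TensorProduct.map (AlgHom.id F R) r
        (Algebra.TensorProduct.map (AlgHom.id F R) (ρ.symm : A' →ₐ[F] A) (u.1 : R ⊗[F] A')) = _
      rw [← AlgHom.comp_apply, ← Algebra.TensorProduct.map_comp,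
        show r.comp (ρ.symm : A' →ₐ[F] A) = AlgHom.id F A' from AlgHom.ext ρ.apply_symm_apply,
        AlgHom.id_comp, Algebra.TensorProduct.map_id]
      rfl
    have hv' := (hfix (unitsPush (ρ.symm : A' →ₐ[F] A) R u.1)).mp (by rw [hv]; exact u.2)
    exact ⟨(⟨_, hv'⟩ : unitaryPoints a R), Subtype.ext hv⟩

end Transport

section Descent

open SymmetricPair HermitianForm

variable {F K V : Type u} [Field F] [Field K] [Algebra F K]
  [AddCommGroup V] [Module F V] [Module K V] [IsScalarTower F K V]

/-- The automorphism `f ↦ c f c` of an algebra of endomorphisms, for a semilinear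
involution `c`. -/
def LinearMap.conjAlgHom {τ : K ≃ₐ[F] K} (c : V →ₛₗ[(τ : K →+* K)] V)
    (hc : ∀ v, c (c v) = v) (hτ : ∀ k, τ (τ k) = k) : Module.End K V →ₐ[F] Module.End K V where
  toFun f :=
    { toFun := fun v => c (f (c v))
      map_add' := fun v w => by simp
      map_smul' := fun k v => by simp [hτ] }
  map_one' := LinearMap.ext hc
  map_zero' := LinearMap.ext fun v => by simp
  map_mul' f g := LinearMap.ext fun v => by simp [hc]
  map_add' f g := LinearMap.ext fun v => by simp
  commutes' r := LinearMap.ext fun v => by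
    simp only [LinearMap.coe_mk, AddHom.coe_mk, Module.algebraMap_end_apply]
    rw [← algebraMap_smul K r (c v), map_smulₛₗ, hc]
    change τ (algebraMap F K r) • v = _
    rw [τ.commutes, algebraMap_smul]

/-- The fixed field of an automorphism. -/
def AlgEquiv.fixedField (τ : K ≃ₐ[F] K) : IntermediateField F K where
  carrier := {k | τ k = k}
  mul_mem' {x y} hx hy := by
    change τ (x * y) = x * y
    rw [map_mul, show τ x = x from hx, show τ y = y from hy]
  add_mem' {x y} hx hy := by
    change τ (x + y) = x + y
    rw [map_add, show τ x = x from hx, show τ y = y from hy]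
  algebraMap_mem' r := τ.commutes r
  inv_mem' x hx := by
    change τ x⁻¹ = x⁻¹
    rw [map_inv₀, show τ x = x from hx]

/-- The space of fixed points of a semilinear involution. -/
def LinearMap.fixedSpace {τ : K ≃ₐ[F] K} (c : V →ₛₗ[(τ : K →+* K)] V) :
    Submodule τ.fixedField V where
  carrier := {v | c v = v}
  add_mem' {v w} hv hw := by
    change c (v + w) = v + w
    rw [map_add, show c v = v from hv, show c w = w from hw]
  zero_mem' := map_zero c
  smul_mem' l v hv := by
    change c ((l : K) • v) = (l : K) • v
    rw [map_smulₛₗ, show c v = v from hv]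
    exact congrArg (· • v) l.2

variable [CharZero F] {τ : K ≃ₐ[F] K} (c : V →ₛₗ[(τ : K →+* K)] V) (hc : ∀ v, c (c v) = v)
  (hτ : ∀ k, τ (τ k) = k) {δ : K} (hδ : δ ≠ 0) (hτδ : τ δ = -δ)

include hc hτ hδ hτδ

-- Galois descent for a quadratic extension, made explicit by an anti-invariant `δ`: with `L` the
-- fixed field and `W` the fixed space, `K = L ⊕ δ L` and `V = W ⊕ δ W`.
omit [Module F V] [IsScalarTower F K V] in
theorem LinearMap.bijective_liftBaseChange_fixedSpace :
    Function.Bijective (LinearMap.liftBaseChange K c.fixedSpace.subtype) := by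
  have : CharZero K := charZero_of_injective_algebraMap (algebraMap F K).injective
  have h2 : (2 : K) ≠ 0 := two_ne_zero
  have hcδ : ∀ v, c (δ • v) = -(δ • c v) := fun v => by
    rw [map_smulₛₗ]
    exact (congrArg (· • c v) hτδ).trans (neg_smul _ _)
  constructor
  · rw [← LinearMap.ker_eq_bot, LinearMap.ker_eq_bot']
    have key : ∀ y : K ⊗[τ.fixedField] c.fixedSpace,
        ∃ v w : c.fixedSpace, y = 1 ⊗ₜ v + δ ⊗ₜ w := by
      intro y
      induction y with
      | zero => exact ⟨0, 0, by simp⟩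
      | add x y hx hy =>
        obtain ⟨v, w, rfl⟩ := hx
        obtain ⟨v', w', rfl⟩ := hy
        exact ⟨v + v', w + w', by rw [TensorProduct.tmul_add, TensorProduct.tmul_add]; abel⟩
      | tmul k v =>
        have h1 : τ ((k + τ k) / 2) = (k + τ k) / 2 := by
          rw [map_div₀, map_add, hτ, map_ofNat, add_comm]
        have h3 : τ ((k - τ k) / (2 * δ)) = (k - τ k) / (2 * δ) := by
          rw [map_div₀, map_sub, hτ, map_mul, map_ofNat, hτδ]
          field_simp
          ring
        refine ⟨(⟨_, h1⟩ : τ.fixedField) • v, (⟨_, h3⟩ : τ.fixedField) • v, ?_⟩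
        rw [← TensorProduct.smul_tmul, ← TensorProduct.smul_tmul, ← TensorProduct.add_tmul]
        congr 1
        change k = (k + τ k) / 2 * 1 + (k - τ k) / (2 * δ) * δ
        field_simp
        ring
    intro y hy
    obtain ⟨v, w, rfl⟩ := key y
    rw [map_add, LinearMap.liftBaseChange_tmul, LinearMap.liftBaseChange_tmul, one_smul] at hy
    have hv : c (v : V) = v := v.2
    have hw : c (w : V) = w := w.2
    change (v : V) + δ • (w : V) = 0 at hy
    have hy2 := congrArg c hy
    rw [map_add, hcδ, hv, hw, map_zero] at hy2
    have e1 : (2 : K) • (v : V) = 0 := by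
      rw [two_smul]
      have := congrArg₂ (· + ·) hy hy2
      simpa [add_add_add_comm] using this
    have e2 : (v : V) = 0 := (smul_eq_zero.mp e1).resolve_left h2
    rw [e2, zero_add] at hy
    have e3 : (w : V) = 0 := (smul_eq_zero.mp hy).resolve_left hδ
    rw [Subtype.ext (a1 := v) (a2 := 0) e2, Subtype.ext (a1 := w) (a2 := 0) e3]
    simp
  · intro v
    have h1 : c (v + c v) = v + c v := by rw [map_add, hc, add_comm]
    have h3 : c (δ • (v - c v)) = δ • (v - c v) := by
      rw [hcδ, map_sub, hc, ← smul_neg, neg_sub]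
    -- Half the sum of the invariant part `v + c v` and the anti-invariant part `v - c v`;
    -- multiplying the latter by `δ` makes it invariant.
    refine ⟨(2 : K)⁻¹ ⊗ₜ ⟨_, h1⟩ + (2 * δ)⁻¹ ⊗ₜ ⟨_, h3⟩, ?_⟩
    rw [map_add, LinearMap.liftBaseChange_tmul, LinearMap.liftBaseChange_tmul]
    change (2 : K)⁻¹ • (v + c v) + (2 * δ)⁻¹ • (δ • (v - c v)) = v
    rw [← mul_smul, mul_inv, mul_assoc, inv_mul_cancel₀ hδ, mul_one, ← smul_add,
      add_add_sub_cancel, ← two_smul K v, inv_smul_smul₀ h2]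

end Descent

/-! ## Hermitian spaces with a semilinear involution -/

section Descent

open SymmetricPair HermitianForm

variable {F K V : Type u} [Field F] [CharZero F] [Field K] [Algebra F K]
  [AddCommGroup V] [Module K V]
  {τ : K ≃ₐ[F] K} (c : V →ₛₗ[(τ : K →+* K)] V) (hc : ∀ v, c (c v) = v)
  (hτ : ∀ k, τ (τ k) = k) {δ : K} (hδ : δ ≠ 0) (hτδ : τ δ = -δ)
  (B : HermitianForm (τ : K →+* K) V) (hBc : ∀ v w, B.form (c v) (c w) = τ (B.form v w))

omit [CharZero F] in
include hBc in
theorem HermitianForm.form_mem_fixedField (v w : c.fixedSpace) :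
    B.form (v : V) (w : V) ∈ τ.fixedField := by
  change τ (B.form v w) = B.form v w
  rw [← hBc, show c (v : V) = v from v.2, show c (w : V) = w from w.2]

include hc hτ hδ hτδ in
theorem HermitianForm.eq_zero_of_form_fixedSpace_eq_zero (v : V)
    (h : ∀ w : c.fixedSpace, B.form v w = 0) : v = 0 := by
  refine B.nondegenerate.1 _ fun y => ?_
  obtain ⟨t, rfl⟩ := (c.bijective_liftBaseChange_fixedSpace hc hτ hδ hτδ).2 y
  induction t with
  | zero => simp
  | add x y hx hy => rw [map_add, map_add, hx, hy, add_zero]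
  | tmul k w =>
    rw [LinearMap.liftBaseChange_tmul, map_smul]
    exact (congrArg (k • ·) (h w)).trans (smul_zero k)

/-- The restriction of a hermitian form to the fixed space of a semilinear involution. -/
noncomputable def HermitianForm.restrictFixed : QuadraticSpaceForm τ.fixedField c.fixedSpace :=
  have hsymm : ∀ v w : c.fixedSpace, B.form (v : V) (w : V) = B.form (w : V) (v : V) :=
    fun v w => (B.symm.eq (v : V) (w : V)).symm.trans (B.form_mem_fixedField c hBc v w) |>.symm
  { form := LinearMap.mk₂ τ.fixedField
      (fun v w => ⟨B.form (v : V) (w : V), B.form_mem_fixedField c hBc v w⟩)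
      (fun v v' w => Subtype.ext (LinearMap.congr_fun (map_add B.form (v : V) v') (w : V)))
      (fun l v w => Subtype.ext (by
        change B.form ((l : K) • (v : V)) w = (l : K) * B.form v w
        rw [map_smulₛₗ, LinearMap.smul_apply]
        exact congrArg (· * B.form v w) l.2))
      (fun v w w' => Subtype.ext (map_add (B.form v) (w : V) (w' : V)))
      (fun l v w => Subtype.ext (map_smul (B.form v) (l : K) (w : V)))
    symm := ⟨fun v w => Subtype.ext (hsymm v w)⟩
    nondegenerate := by
      refine ⟨fun v h => ?_, fun w h => ?_⟩
      · exact Subtype.ext (B.eq_zero_of_form_fixedSpace_eq_zero c hc hτ hδ hτδ v fun w =>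
          congrArg Subtype.val (h w))
      · exact Subtype.ext (B.eq_zero_of_form_fixedSpace_eq_zero c hc hτ hδ hτδ w fun v =>
          (hsymm w v).trans (congrArg Subtype.val (h v))) }

variable {D : Type u} [Field D] [Algebra F D] {τ₀ : D ≃ₐ[F] D} [Algebra D K] [IsScalarTower F D K]
  [FiniteDimensional F K] [FiniteDimensional K V] [Module F V] [IsScalarTower F K V]
  (hτD : ∀ d, τ (algebraMap D K d) = algebraMap D K (τ₀ d))
  (hb : ∀ x, c.conjAlgHom hc hτ (c.conjAlgHom hc hτ x) = x)
  (hab : ∀ x, c.conjAlgHom hc hτ ((B.adjointInvolution F fun r => τ.commutes r).toLin x) =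
    (B.adjointInvolution F fun r => τ.commutes r).toLin (c.conjAlgHom hc hτ x))

-- By descent `V` is the scalar extension of the fixed space of `c`. The form `B` is the extension
-- of its restriction, which takes values in the fixed field, and `c` becomes `τ ⊗ 1`.
include hδ hτδ hBc hτD in
theorem exists_isUO_iso : ∃ Q, IsUO F τ₀ Q ∧ Nonempty (Iso
    (unitaryPair (B.adjointInvolution F fun r => τ.commutes r) (c.conjAlgHom hc hτ) hb hab) Q) := by
  let L := τ.fixedField
  let W := c.fixedSpace
  let τL : K ≃ₐ[L] K := { τ with commutes' := fun l => l.2 }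
  have : FiniteDimensional L K := Module.Finite.of_restrictScalars_finite F L K
  have : FiniteDimensional L V := Module.Finite.trans K V
  have : FiniteDimensional L W := inferInstance
  let BW : QuadraticSpaceForm L W := B.restrictFixed c hc hτ hδ hτδ hBc
  let e : (K ⊗[L] W) ≃ₗ[K] V := LinearEquiv.ofBijective _
    (c.bijective_liftBaseChange_fixedSpace hc hτ hδ hτδ)
  have he : ∀ k (w : W), e (k ⊗ₜ w) = k • (w : V) := fun k w =>
    LinearMap.liftBaseChange_tmul K c.fixedSpace.subtype k w
  let ρ : Module.End K V ≃ₐ[F] Module.End K (K ⊗[L] W) :=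
    AlgEquiv.ofRingEquiv (f := e.symm.conjRingEquiv) fun r => LinearMap.ext fun x => by
      change e.symm (r • e x) = r • x
      rw [LinearEquiv.symm_apply_eq, ← algebraMap_smul K r x, map_smul, algebraMap_smul]
  have hρ : ∀ z x, e (ρ z x) = z (e x) := fun z x => e.apply_symm_apply _
  have hform : ∀ x y, extendForm τL BW x y = B.form (e x) (e y) := by
    intro x y
    induction x with
    | zero => simp
    | add x₁ x₂ h₁ h₂ => simp [h₁, h₂]
    | tmul k v =>
      induction y with
      | zero => simp
      | add x₁ x₂ h₁ h₂ => simp [h₁, h₂]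
      | tmul l w =>
        rw [extendForm_tmul, he, he, map_smul (B.form _), map_smulₛₗ B.form, LinearMap.smul_apply,
          smul_eq_mul, smul_eq_mul, mul_comm (τL k), mul_assoc]
        rfl
  have hconj : ∀ x, e (conj τL W x) = c (e x) := by
    intro x
    induction x with
    | zero => simp
    | add x₁ x₂ h₁ h₂ => simp [h₁, h₂]
    | tmul k v =>
      rw [conj_tmul, he, he, map_smulₛₗ, show c (v : V) = v from v.2]
      rfl
  refine ⟨pairUO F τL hτ BW, ⟨K, inferInstance, inferInstance, inferInstance, inferInstance,
    inferInstance, L, inferInstance, inferInstance, inferInstance, inferInstance, τL, hτ, hτD,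
    fun k hk => ⟨⟨k, hk⟩, rfl⟩, W, inferInstance, inferInstance, inferInstance, BW, rfl⟩,
    nonempty_iso_unitaryPair_of_algEquiv ρ _ _ _ _ _ _ _ _ (fun z => ?_) (fun z => ?_)⟩
  · refine (extend τL BW hτ).eq_adjoint F (commutes_of_tower τL F) fun x y => ?_
    change extendForm τL BW _ _ = extendForm τL BW _ _
    rw [hform, hform, hρ, hρ]
    exact B.form_adjoint_left F (fun r => τ.commutes r) z _ _
  · refine LinearMap.ext fun x => e.injective ?_
    rw [hρ]
    change c (z (c (e x))) = e (conj τL W (ρ z (conj τL W x)))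
    rw [hconj, hρ, hconj]

end Descent

/-! ## The factors of the unitary pair of an algebra of endomorphisms -/

section Unitary

open MaximalSpectrum SymmetricPair

attribute [local instance] Ideal.Quotient.field

theorem HermitianForm.conjAlgHom_adjointInvolution {F K V : Type u} [Field F] [Field K] [Algebra F K]
    [FiniteDimensional F K] [AddCommGroup V] [Module F V] [Module K V] [IsScalarTower F K V]
    [FiniteDimensional K V] {τ : K ≃ₐ[F] K} (c : V →ₛₗ[(τ : K →+* K)] V)
    (hc : ∀ v, c (c v) = v) (hτ : ∀ k, τ (τ k) = k) (B : HermitianForm (τ : K →+* K) V)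
    (hBc : ∀ v w, B.form (c v) (c w) = τ (B.form v w)) (x : Module.End K V) :
    c.conjAlgHom hc hτ ((B.adjointInvolution F fun r => τ.commutes r).toLin x) =
      (B.adjointInvolution F fun r => τ.commutes r).toLin (c.conjAlgHom hc hτ x) := by
  refine B.eq_adjoint F (fun r => τ.commutes r) fun v w => ?_
  change B.form (c (B.adjoint F (fun r => τ.commutes r) x (c v))) w = B.form v (c (x (c w)))
  have h1 := hBc (B.adjoint F (fun r => τ.commutes r) x (c v)) (c w)
  have h2 := hBc (c v) (x (c w))
  rw [hc] at h1 h2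
  exact h1.trans ((congrArg τ (B.form_adjoint_left F (fun r => τ.commutes r) x (c v) (c w))).trans
    h2.symm)

variable {F C V : Type u} [Field F] [CharZero F] [CommRing C] [Algebra F C] [IsReduced C]
  [IsArtinianRing C] [Module.Finite F C] [AddCommGroup V] [Module F V] [Module C V]
  [IsScalarTower F C V] [Module.Finite C V] {τ : C ≃ₐ[F] C} (hτ : ∀ c, τ (τ c) = c)
  {β : LinearMap.BilinForm F V} (hsymm : ∀ v w, β v w = β w v)
  (hnd : ∀ w, (∀ v, β v w = 0) → w = 0) (hβ : ∀ (c : C) v w, β (c • v) w = β v (τ c • w))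
  {c : V →ₗ[F] V} (hcc : ∀ v, c (c v) = v) (hcτ : ∀ (k : C) v, c (k • v) = τ k • c v)
  (hβc : ∀ v w, β (c v) (c w) = β v w)
  {a : AntiInvolution F (Module.End C V)} (ha : ∀ z v w, β (z v) w = β v (a.toLin z w))
  {b : Module.End C V →ₐ[F] Module.End C V} (hbc : ∀ z v, b z v = c (z (c v)))
  (hb : ∀ x, b (b x) = x) (hab : ∀ x, b (a.toLin x) = a.toLin (b x))

include hτ hsymm hnd hβ hcc hcτ hβc ha hbc hb hab

/-- Both `c` and passage to the other argument of `β` twist scalars by `τ`. The twists cancel, so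
`β(c v, w)` is a symmetric form with self-adjoint scalars, whose adjoint is `b ∘ a`. It restricts to
every part, including those at exchanged ideals. -/
theorem MaximalSpectrum.exists_isGLO_part (m : MaximalSpectrum C) :
    ∃ aJ : AntiInvolution F (Module.End (C ⧸ m.asIdeal) (m.part V)),
      (∀ z, m.restrictPart (F := F) (b (a.toLin z)) = aJ.toLin (m.restrictPart (F := F) z)) ∧
      IsGLO F (generalLinearPair aJ) := by
  have hsymm' : ∀ v w, (β ∘ₗ c) v w = (β ∘ₗ c) w v := fun v w => by
    rw [LinearMap.comp_apply, LinearMap.comp_apply, ← hβc, hcc, hsymm]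
  obtain ⟨B, hB⟩ := exists_hermitianForm_part (τ := AlgEquiv.refl) (m := m) (fun _ => rfl) (β ∘ₗ c)
    hsymm' (fun w h => hnd w fun v => by have := h (c v); rwa [LinearMap.comp_apply, hcc] at this)
    (fun k v w => by rw [LinearMap.comp_apply, LinearMap.comp_apply, hcτ, hβ, hτ]; rfl)
    rfl AlgEquiv.refl (fun _ => rfl)
  refine ⟨B.adjointInvolution F fun _ => rfl, restrictPart_adjoint (β ∘ₗ c) (a.comp b hb hab)
    (fun z v w => ?_) (fun _ => rfl) B hB, C ⧸ m.asIdeal, inferInstance, inferInstance,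
    inferInstance, m.part V, inferInstance, inferInstance, inferInstance, inferInstance,
    inferInstance, B, rfl⟩
  have h1 : c (z v) = b z (c v) := by rw [hbc, hcc]
  rw [LinearMap.comp_apply, LinearMap.comp_apply, h1, ha, ← hab]
  rfl

variable {D : Type u} [Field D] [Algebra F D] {τ₀ : D ≃ₐ[F] D} [Algebra D C] [IsScalarTower F D C]
  (hτD : ∀ d, τ (algebraMap D C d) = algebraMap D C (τ₀ d)) {δ : D} (hδ : δ ≠ 0) (hτδ : τ₀ δ = -δ)

include hτD hδ hτδ

-- At a fixed ideal `c` preserves the part and acts there semilinearly over the residue field. Its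
-- compatibility with the hermitian form is checked after traces, and the image of `δ` is the
-- anti-invariant scalar needed for descent.
omit hb hab in
theorem MaximalSpectrum.exists_isUO_part (m : MaximalSpectrum C) (hm : m.comap τ = m) :
    ∃ (aI : AntiInvolution F (Module.End (C ⧸ m.asIdeal) (m.part V)))
      (bI : Module.End (C ⧸ m.asIdeal) (m.part V) →ₐ[F] Module.End (C ⧸ m.asIdeal) (m.part V))
      (hbI : ∀ x, bI (bI x) = x) (habI : ∀ x, bI (aI.toLin x) = aI.toLin (bI x)),
      (∀ z, m.restrictPart (F := F) (a.toLin z) = aI.toLin (m.restrictPart (F := F) z)) ∧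
      (∀ z, m.restrictPart (F := F) (b z) = bI (m.restrictPart (F := F) z)) ∧
      ∃ Q, IsUO F τ₀ Q ∧ Nonempty (Iso (unitaryPair aI bI hbI habI) Q) := by
  obtain ⟨τ', hτ'⟩ := exists_quotient_algEquiv hτ hm
  have hτ'τ' : ∀ k, τ' (τ' k) = k := fun k => by
    obtain ⟨r, rfl⟩ := Ideal.Quotient.mk_surjective k
    rw [hτ', hτ', hτ]
  obtain ⟨B, hB⟩ := exists_hermitianForm_part hτ β hsymm hnd hβ hm τ' hτ'
  have hmem : ∀ v ∈ m.part V, c v ∈ m.part V := fun v hv => by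
    rw [mem_part_iff] at hv ⊢
    rw [← hm, ← map_idempotent hτ, ← hcτ, hv]
  have hsmul : ∀ (k : C ⧸ m.asIdeal) (v : m.part V),
      c ((k • v : m.part V) : V) = ((τ' k • ⟨c v, hmem v v.2⟩ : m.part V) : V) := fun k v => by
    obtain ⟨r, rfl⟩ := Ideal.Quotient.mk_surjective k
    rw [hτ']
    exact hcτ r v
  let c' : m.part V →ₛₗ[(τ' : (C ⧸ m.asIdeal) →+* (C ⧸ m.asIdeal))] m.part V :=
    { toFun := fun v => ⟨c v, hmem v v.2⟩
      map_add' := fun v w => Subtype.ext (map_add c (v : V) w)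
      map_smul' := fun k v => Subtype.ext (hsmul k v) }
  have hc' : ∀ v, c' (c' v) = v := fun v => Subtype.ext (hcc v)
  have hB' : ∀ (k : C ⧸ m.asIdeal) v w,
      Algebra.trace F (C ⧸ m.asIdeal) (k * B.form v w) = β v ((k • w : m.part V) : V) :=
    fun k v w => by rw [← hB, map_smul (B.form v), smul_eq_mul]
  have hBc : ∀ v w, B.form (c' v) (c' w) = τ' (B.form v w) := fun v w =>
    HermitianForm.eq_of_trace_mul_eq (F := F) fun k => by
      have h1 : ((k • c' w : m.part V) : V) = c ((τ' k • w : m.part V) : V) := by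
        rw [hsmul, hτ'τ']
        rfl
      have h2 : k * τ' (B.form v w) = τ' (τ' k * B.form v w) := by rw [map_mul, hτ'τ']
      rw [hB', h1, h2, Algebra.trace_eq_of_algEquiv τ', hB']
      exact hβc _ _
  have hab' := B.conjAlgHom_adjointInvolution (F := F) c' hc' hτ'τ' hBc
  have hb' : ∀ x, c'.conjAlgHom hc' hτ'τ' (c'.conjAlgHom hc' hτ'τ' x) = x := fun x =>
    LinearMap.ext fun v => by
      change c' (c' (x (c' (c' v)))) = x v
      rw [hc', hc']
  refine ⟨_, _, hb', hab', restrictPart_adjoint β a ha (fun r => τ'.commutes r) B hB, fun z => ?_,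
    exists_isUO_iso c' hc' hτ'τ' (δ := algebraMap D _ δ) ?_ ?_ B hBc ?_ hb' hab'⟩
  · exact LinearMap.ext fun v => Subtype.ext (hbc z v)
  · exact (map_ne_zero _).mpr hδ
  · have h1 : τ' (algebraMap D _ δ) = algebraMap D _ (τ₀ δ) :=
      (hτ' _).trans (congrArg _ (hτD δ))
    rw [h1, hτδ, map_neg]
  · exact fun d => (hτ' _).trans (congrArg _ (hτD d))

theorem isProductOf_unitaryPair_end :
    (unitaryPair a b hb hab).IsProductOf fun P => IsGLO F P ∨ IsUO F τ₀ P := by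
  obtain ⟨n, ⟨e⟩⟩ := Finite.exists_equiv_fin (MaximalSpectrum C)
  choose aI bI hbI habI haI hbρ hQ using fun i : {m : MaximalSpectrum C // m.comap τ = m} =>
    exists_isUO_part hτ hsymm hnd hβ hcc hcτ hβc ha hbc hτD hδ hτδ i.1 i.2
  choose aJ haJ hJ using exists_isGLO_part hτ hsymm hnd hβ hcc hcτ hβc ha hbc hb hab
  refine IsProductOf.of_exists_iso (isProductOf_unitaryPair
    (A := fun m : MaximalSpectrum C => Module.End (C ⧸ m.asIdeal) (m.part V))
    (fun m => m.restrictPart (F := F)) bijective_restrictPart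
    (fun m => m.comap τ) (comap_comap hτ) a (restrictPart_eq_zero_iff_comap hτ β hnd hβ a ha)
    (fun m => (e m : ℕ)) (Fin.val_injective.comp e.injective) b hb hab aI bI hbI habI haI hbρ
    (fun j => aJ j.1) (fun j => haJ j.1) (fun i => ?_) (fun j => ?_))
  · obtain ⟨Q, hQ, f⟩ := hQ i
    exact ⟨Q, .inr hQ, f⟩
  · exact ⟨_, .inl (hJ j.1), ⟨⟨fun _ _ _ => MulEquiv.refl _, fun _ _ => rfl, fun _ => rfl⟩⟩⟩

end Unitary

/-! ## Descendants of the pairs `(U(V_D), O(V))` -/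

section UnitaryDescendants

open MaximalSpectrum SymmetricPair HermitianForm

variable {F K : Type u} [Field F] [CharZero F] [Field K] [Algebra F K] [FiniteDimensional F K]

/-- The point is that `a` and `b` agree on `K[x]`: both conjugate the scalars and invert `x`. A
single involution of `C` therefore governs both the adjoint and the conjugation of `V`. -/
theorem isProductOf_centralizerPair_unitaryPair {C V : Type u} [CommRing C] [Algebra F C]
    [Algebra K C] [IsScalarTower F K C] [AddCommGroup V] [Module F V] [Module K V]
    [IsScalarTower F K V] [Module C V] [IsScalarTower K C V] [IsScalarTower F C V]
    [FiniteDimensional K V] [Module.Finite C V] [IsReduced C]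
    [IsArtinianRing C] [Module.Finite F C] [FaithfulSMul C V] {x : C}
    (hx : Algebra.adjoin K {x} = ⊤) {τ : K ≃ₐ[F] K} (hτ : ∀ k, τ (τ k) = k) {δ : K} (hδ : δ ≠ 0)
    (hτδ : τ δ = -δ) (B : HermitianForm (τ : K →+* K) V) (c : V →ₛₗ[(τ : K →+* K)] V)
    (hcc : ∀ v, c (c v) = v) (hBc : ∀ v w, B.form (c v) (c w) = τ (B.form v w))
    (b : Module.End K V →ₐ[F] Module.End K V) (hbc : ∀ z v, b z v = c (z (c v)))
    (hb : ∀ z, b (b z) = z)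
    (hab : ∀ z, b ((B.adjointInvolution F fun r => τ.commutes r).toLin z) =
      (B.adjointInvolution F fun r => τ.commutes r).toLin (b z))
    (g : unitaryPoints (B.adjointInvolution F fun r => τ.commutes r) F)
    (hg : (unitarySymmetrization b (g : (F ⊗[F] Module.End K V)ˣ) : F ⊗[F] Module.End K V) =
      1 ⊗ₜ Algebra.lsmul K K V x) :
    ((unitaryPair (B.adjointInvolution F fun r => τ.commutes r) b hb hab).centralizerPair
      g).IsProductOf fun P => IsGLO F P ∨ IsUO F τ P := by
  have hσ : ∀ r : F, (τ : K →+* K) (algebraMap F K r) = algebraMap F K r := fun r => τ.commutes r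
  let a := B.adjointInvolution F hσ
  let j : C →ₐ[K] Module.End K V := Algebra.lsmul K K V
  have hinj : Function.Injective j := fun c d h =>
    FaithfulSMul.eq_of_smul_eq_smul fun v : V => LinearMap.congr_fun h v
  have hak : ∀ k : K, a.toLin (algebraMap K _ k) = algebraMap K _ (τ k) := fun k =>
    (B.eq_adjoint F hσ fun v w => by simp [Module.algebraMap_end_apply, hτ]).symm
  have hbk : ∀ k : K, b (algebraMap K _ k) = algebraMap K _ (τ k) := fun k =>
    LinearMap.ext fun v => by
      rw [hbc, Module.algebraMap_end_apply, map_smulₛₗ, hcc]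
      rfl
  have hlid : ∀ y z : Module.End K V, (1 : F) ⊗ₜ[F] y = 1 ⊗ₜ z → y = z := fun y z h => by
    have h2 := congrArg (TensorProduct.lid F _) h
    rwa [TensorProduct.lid_tmul, TensorProduct.lid_tmul, one_smul, one_smul] at h2
  have hax : a.toLin (j x) * j x = 1 := by
    have h1 := (unitsInv_eq_iff a F _).mp (unitsInv_unitarySymmetrization a b hab
      (g : (F ⊗[F] Module.End K V)ˣ) ((unitsInv_eq_iff a F _).mpr g.2))
    rw [hg, a.ext_tmul, Algebra.TensorProduct.tmul_mul_tmul, mul_one,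
      Algebra.TensorProduct.one_def] at h1
    exact hlid _ _ h1
  have hbx : b (j x) * j x = 1 := by
    have h1 := unitsAut_unitarySymmetrization b hb (g : (F ⊗[F] Module.End K V)ˣ)
    have h2 := congrArg Units.val (eq_inv_iff_mul_eq_one.mp h1)
    change Algebra.TensorProduct.map (AlgHom.id F F) b
      (unitarySymmetrization b (g : (F ⊗[F] Module.End K V)ˣ) : F ⊗[F] Module.End K V) *
      (unitarySymmetrization b (g : (F ⊗[F] Module.End K V)ˣ) : F ⊗[F] Module.End K V) = 1 at h2
    rw [hg, Algebra.TensorProduct.map_tmul, Algebra.TensorProduct.tmul_mul_tmul, map_one, mul_one,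
      Algebra.TensorProduct.one_def] at h2
    exact hlid _ _ h2
  -- The inverse of `x` is needed inside `C`, so that `a` and `b` map `C` to itself; `x` is a
  -- non-zero-divisor there because `a(x) x = 1` in the endomorphism algebra.
  have hux : IsUnit x := by
    refine IsArtinianRing.isUnit_of_mem_nonZeroDivisors (mem_nonZeroDivisors_iff_right.mpr
      fun c hc => hinj ?_)
    rw [map_zero, ← one_mul (j c), ← hax, mul_assoc, ← map_mul, mul_comm, hc, map_zero, mul_zero]
  obtain ⟨y, hxy⟩ := hux.exists_right_inv
  have hinv : ∀ z : Module.End K V, z * j x = 1 → z = j y := fun z hz => by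
    rw [← mul_one z, ← map_one j, ← hxy, map_mul, ← mul_assoc, hz, one_mul]
  obtain ⟨t, ht, hta⟩ := a.exists_algEquiv hx
    (fun k => ⟨algebraMap K C (τ k), by rw [AlgHom.commutes, hak]⟩) ⟨y, (hinv _ hax).symm⟩
  have htb : ∀ k : C, b (j k) = j (t k) := fun k => by
    refine Eq.trans ?_ (hta k).symm
    change b (j k) = a.toLin (j k)
    have hk : k ∈ Algebra.adjoin K {x} := by rw [hx]; trivial
    induction hk using Algebra.adjoin_induction with
    | mem k hk =>
      obtain rfl : k = x := hk
      rw [hinv _ hbx]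
      exact (hinv _ hax).symm
    | algebraMap k =>
      have h1 : j (algebraMap K C k) = algebraMap K _ k := j.commutes k
      exact (congrArg b h1).trans ((hbk k).trans ((congrArg a.toLin h1).trans (hak k)).symm)
    | add c d _ _ hc hd =>
      rw [map_add j, map_add b, hc, hd, map_add]
    | mul c d _ _ hc hd =>
      rw [map_mul j, map_mul b, hc, hd, ← map_mul j, mul_comm c d, map_mul j, a.map_mul']
  let i := endRestrictScalars F K C V
  have hi : Function.Injective i := endRestrictScalars_injective
  have hbi : ∀ z, b (i z) ∈ Set.range i := fun z => by
    refine (commute_lsmul_iff hx _).mp ?_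
    have h1 : (Algebra.lsmul K K V x : Module.End K V) = b (j (t x)) := by rw [htb, ht]
    rw [h1, ← map_mul, ← map_mul]
    congr 1
    exact LinearMap.ext fun v => map_smul z (t x) v
  obtain ⟨a', ha'⟩ := a.exists_restrict i hi (a.map_endRestrictScalars_mem hx ht hta)
  obtain ⟨b', hb'⟩ := AlgHom.exists_restrict i hi b hbi
  have hb'b' : ∀ z, b' (b' z) = z := fun z => hi (by rw [hb', hb', hb])
  have hab' : ∀ z, b' (a'.toLin z) = a'.toLin (b' z) := fun z =>
    hi (by rw [hb', ha', ha', hb', hab])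
  obtain ⟨e⟩ := nonempty_iso_centralizerPair_unitaryPair i hi (commute_lsmul_iff hx) a b hb hab
    a' b' hb'b' hab' ha' hb' g hg
  let c' : V →ₗ[F] V :=
    { toFun := c
      map_add' := map_add c
      map_smul' := fun r v => by
        rw [← algebraMap_smul K r v, map_smulₛₗ, hσ, algebraMap_smul]
        rfl }
  refine IsProductOf.of_iso e (isProductOf_unitaryPair_end ht (β := B.traceForm F hσ)
    (B.traceForm_symm F hσ hτ) (fun w h => B.eq_zero_of_traceForm_eq_zero F hσ w h hτ)
    (fun k v w => ?_) (c := c') hcc (fun k v => ?_) (fun v w => ?_) (fun z v w => ?_)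
    (fun z v => ?_) hb'b' hab' (fun k => hinj ?_) hδ hτδ)
  · exact (B.traceForm_adjoint F hσ (j k) v w).trans
      (congrArg (fun f : Module.End K V => B.traceForm F hσ v (f w)) (hta k).symm)
  · have h1 := LinearMap.congr_fun (htb k) (c v)
    rw [hbc, hcc] at h1
    exact h1
  · refine (congrArg (Algebra.trace F K) (hBc v w)).trans ?_
    exact Algebra.trace_eq_of_algEquiv τ _
  · exact (B.traceForm_adjoint F hσ (i z) v w).trans
      (congrArg (fun f : Module.End K V => B.traceForm F hσ v (f w)) (ha' z).symm)
  · exact (LinearMap.congr_fun (hb' z) v).trans (hbc (i z) v)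
  · rw [← htb, AlgHom.commutes, AlgHom.commutes, hbk]

-- A quadratic extension has no proper intermediate field, so the fixed field of a non-trivial
-- automorphism is `F`.
omit [CharZero F] [FiniteDimensional F K] in
theorem mem_range_algebraMap_of_finrank_eq_two (h : Module.finrank F K = 2) {τ : K ≃ₐ[F] K}
    (hτ : τ ≠ 1) {k : K} (hk : τ k = k) : k ∈ Set.range (algebraMap F K) := by
  have := IntermediateField.isSimpleOrder_of_finrank_prime F K (h ▸ Nat.prime_two)
  rcases eq_bot_or_eq_top τ.fixedField with h1 | h1
  · have h2 : k ∈ τ.fixedField := hk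
    rwa [h1, IntermediateField.mem_bot] at h2
  · refine absurd (AlgEquiv.ext fun l => ?_) hτ
    have h2 : l ∈ τ.fixedField := by rw [h1]; trivial
    exact h2

open scoped IsMulCommutative in
theorem isProductOf_isDescendant_unitaryPair {V : Type u} [AddCommGroup V] [Module F V]
    [Module K V] [IsScalarTower F K V] [FiniteDimensional K V] {τ : K ≃ₐ[F] K}
    (hτ : ∀ k, τ (τ k) = k) {δ : K} (hδ : δ ≠ 0) (hτδ : τ δ = -δ)
    (hδF : δ * δ ∈ Set.range (algebraMap F K))
    (B : HermitianForm (τ : K →+* K) V) (c : V →ₛₗ[(τ : K →+* K)] V)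
    (hcc : ∀ v, c (c v) = v) (hBc : ∀ v w, B.form (c v) (c w) = τ (B.form v w))
    (b : Module.End K V →ₐ[F] Module.End K V) (hbc : ∀ z v, b z v = c (z (c v)))
    (hb : ∀ z, b (b z) = z)
    (hab : ∀ z, b ((B.adjointInvolution F fun r => τ.commutes r).toLin z) =
      (B.adjointInvolution F fun r => τ.commutes r).toLin (b z))
    {Y : SymmetricPair F}
    (hY : (unitaryPair (B.adjointInvolution F fun r => τ.commutes r) b hb hab).IsDescendant Y) :
    Y.IsProductOf fun P => IsGLO F P ∨ IsUO F τ P := by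
  obtain ⟨g, hg, rfl⟩ := hY
  obtain ⟨r, hr⟩ := hδF
  have hr0 : r ≠ 0 := by
    rintro rfl
    rw [map_zero] at hr
    exact hδ (mul_self_eq_zero.mp hr.symm)
  have : Module.Finite F (Module.End K V) := Module.Finite.trans K _
  obtain ⟨x, hx⟩ := exists_eq_one_tmul (F := F) (E := Module.End K V)
    (unitarySymmetrization b (Subtype.val (p := (· ∈ unitaryPoints
      (B.adjointInvolution F fun r => τ.commutes r) F)) g))
  have hss := aeval_eq_zero_of_hasClosedOrbit_unitaryPair
    (B.adjointInvolution F fun r => τ.commutes r) b hb hab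
    hasRescaling_end (δ := algebraMap K (Module.End K V) δ) hr0
    (by rw [← map_mul, ← hr, ← IsScalarTower.algebraMap_apply]) (Algebra.commutes δ)
    (by
      refine Eq.trans (B.eq_adjoint F (fun r => τ.commutes r) fun v w => ?_).symm (map_neg _ δ)
      rw [Module.algebraMap_end_apply, Module.algebraMap_end_apply, map_smulₛₗ, map_smul,
        LinearMap.smul_apply]
      congr 1
      change τ (-δ) = δ
      rw [map_neg, hτδ, neg_neg])
    (by
      refine LinearMap.ext fun v => ?_
      rw [hbc, LinearMap.neg_apply, Module.algebraMap_end_apply, Module.algebraMap_end_apply,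
        map_smulₛₗ, hcc, ← neg_smul]
      exact congrArg (· • v) hτδ)
    g hg
  rw [hx] at hss
  have := isReduced_adjoin_singleton_of_tmul hss
  have : IsArtinianRing (Algebra.adjoin K {x}) := IsArtinianRing.of_finite K _
  have : Module.Finite F (Algebra.adjoin K {x}) := Module.Finite.trans K _
  have : Module.Finite (Algebra.adjoin K {x}) V := Module.Finite.of_restrictScalars_finite K _ _
  exact isProductOf_centralizerPair_unitaryPair (adjoin_singleton_self_eq_top x) hτ hδ hτδ B
    c hcc hBc b hbc hb hab g hx

theorem isProductOf_isGLO_or_isUO (h : Module.finrank F K = 2) {τ : K ≃ₐ[F] K} (hτ₁ : τ ≠ 1)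
    (hτ : ∀ k, τ (τ k) = k) {V : Type u} [AddCommGroup V] [Module F V] [FiniteDimensional F V]
    (B : QuadraticSpaceForm F V) {Y : SymmetricPair F} (hY : (pairUO F τ hτ B).IsDescendant Y) :
    Y.IsProductOf fun P => IsGLO F P ∨ IsUO F τ P := by
  obtain ⟨d, hd⟩ : ∃ d, τ d ≠ d := by
    by_contra! h1
    exact hτ₁ (AlgEquiv.ext h1)
  -- The anti-invariant element is `δ = d - τ d` for any `d` moved by `τ`. Its square is
  -- `τ`-invariant and so lies in `F`, as the splitting idempotent requires.
  have hτδ : τ (d - τ d) = -(d - τ d) := by rw [map_sub, hτ, neg_sub]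
  exact isProductOf_isDescendant_unitaryPair hτ (sub_ne_zero.mpr hd.symm) hτδ
    (mem_range_algebraMap_of_finrank_eq_two h hτ₁ (by rw [map_mul, hτδ, neg_mul_neg]))
    (extend τ B hτ) (conj τ V) (conj_conj τ hτ) (extendForm_conj τ B) (conjEnd τ hτ F V)
    (fun _ _ => rfl) (conjEnd_conjEnd τ hτ F) (conjEnd_extendAdjoint τ B hτ F) hY

end UnitaryDescendants

theorem mainTheorem12 (F : Type u) [Field F] [CharZero F] :
    (∀ (D : Type u) [Field D] [Algebra F D] (_ : Module.finrank F D = 2) [FiniteDimensional F D]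
      (τ : D ≃ₐ[F] D) (_ : τ ≠ 1) (hτ : ∀ d, τ (τ d) = d)
      (V : Type u) [AddCommGroup V] [Module F V] [FiniteDimensional F V]
      (B : QuadraticSpaceForm F V) (Y : SymmetricPair F),
      (pairUO F τ hτ B).IsDescendant Y →
        Y.IsProductOf fun P => IsGLO F P ∨ IsUO F τ P) ∧
    (∀ (V : Type u) [AddCommGroup V] [Module F V] [FiniteDimensional F V]
      (B : QuadraticSpaceForm F V) (Y : SymmetricPair F),
      (pairGLO F B).IsDescendant Y → Y.IsProductOf (IsGLO F)) ∧
    (∀ (D : Type u) [Field D] [Algebra F D] (_ : Module.finrank F D = 2) [FiniteDimensional F D]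
      (τ : D ≃ₐ[F] D) (_ : τ ≠ 1)
      (V : Type u) [AddCommGroup V] [Module D V] [FiniteDimensional D V] [Module F V]
      [IsScalarTower F D V] (B : HermitianForm (τ : D →+* D) V) (Y : SymmetricPair F),
      (pairGLU F τ B).IsDescendant Y →
        Y.IsProductOf fun P => IsGLGL F D P ∨ IsGLU F τ P) :=
  ⟨fun _ _ _ h _ _ hτ₁ hτ _ _ _ _ B _ hY => isProductOf_isGLO_or_isUO h hτ₁ hτ B hY,
    fun _ _ _ _ B _ hY => isProductOf_isGLO B hY,
    fun _ _ _ h _ τ _ _ _ _ _ _ _ B _ hY => isProductOf_isGLU h τ B hY⟩
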